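/- Let $p\neq l$ be primes with $l$ odd, let $F$ be a finite extension of $\mathbb{Q}_p$, and let $E/F$ be a Galois extension of degree $l$ with group $\Gamma=\langle\gamma\rangle$. Let $\overline{\mathbb{Z}}_l$ be the integral closure of $\mathbb{Z}_l$ in $\overline{\mathbb{Q}}_l$, with residue field $\overline{\mathbb{F}}_l$. For $K\in\{E,F\}$ let $B\subset P_{2,1},P_{1,2}\subset \mathrm{GL}_3(K)$ be the upper triangular Borel subgroup and the two standard maximal parabolic subgroups. For a commutative ring $R$ put $$\mathrm{St}_K(R)=\mathrm{coker}\Big(C_c^\infty(\mathrm{GL}_3(K)/P_{2,1},R)\oplus C_c^\infty(\mathrm{GL}_3(K)/P_{1,2},R)\to C_c^\infty(\mathrm{GL}_3(K)/B,R)\Big),$$ where $C_c^\infty$ denotes the locally constant functions with compact support and the maps are pullbacks. Then $\mathrm{GL}_3(K)$ acts by left translation, $\Gamma$ acts on $\mathrm{St}_E(R)$ through its action on matrix entries, $\mathrm{St}_E(\overline{\mathbb{Q}}_l)$ is the Steinberg representation of $\mathrm{GL}_3(E)$, and $\mathrm{St}_F(\overline{\mathbb{F}}_l)$ is the mod-$l$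 Steinberg representation of $\mathrm{GL}_3(F)$. A $\mathrm{GL}_3(E)\rtimes\Gamma$-stable lattice in a $\overline{\mathbb{Q}}_l$-representation $V$ is a stable $\overline{\mathbb{Z}}_l$-submodule $\mathcal{L}\subset V$ with $\mathcal{L}\otimes_{\overline{\mathbb{Z}}_l}\overline{\mathbb{Q}}_l=V$. For a $\Gamma$-module $M$ let $N=1+\gamma+\dots+\gamma^{l-1}$, $\widehat H^0(M)=\ker(1-\gamma)/\mathrm{im}(N)$ and $\widehat H^1(M)=\ker(N)/\mathrm{im}(1-\gamma)$. For an $\overline{\mathbb{F}}_l$-representation $W$ let $W^{(l)}$ be its Frobenius twist: the same additive group and group action, with scalar action $\lambda * w=\lambda^{1/l}w$. 1. The natural map $\mathrm{St}_E(\overline{\mathbb{Z}}_l)\to \mathrm{St}_E(\overline{\mathbb{Q}}_l)$ is injective and $\mathrm{GL}_3(E)\rtimes\Gamma$-equivariant, and its image $(\mathrm{St}_E(3))_e$ is a $\mathrm{GL}_3(E)\rtimes\Gamma$-stable lattice. 2. There is an isomorphism of $\overline{\mathbb{Z}}_l[\mathrm{GL}_3(F)]$-modules $\widehat H^0((\mathrm{St}_E(3))_e)\simeq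 \mathrm{St}_F(\overline{\mathbb{Z}}_l/l)$, and there is an isomorphism of $\overline{\mathbb{F}}_l$-representations of $\mathrm{GL}_3(F)$ $$\widehat H^0((\mathrm{St}_E(3))_e)\otimes_{\overline{\mathbb{Z}}_l}\overline{\mathbb{F}}_l\;\simeq\;\mathrm{St}_F(\overline{\mathbb{F}}_l)^{(l)}.$$ 3. For every smooth character $\chi_F:F^\times\to\overline{\mathbb{Q}}_l^\times$, put $\chi_E=\chi_F\circ\mathrm{Nr}_{E/F}$ and let $\Gamma$ act on the space of $\mathrm{St}_E(\overline{\mathbb{Q}}_l)\otimes(\chi_E\circ\det)$ as it acts on $\mathrm{St}_E(\overline{\mathbb{Q}}_l)$. Then $\widehat H^1(\mathcal{L})=0$ for every $\mathrm{GL}_3(E)\rtimes\Gamma$-stable lattice $\mathcal{L}$ in this representation. -/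

import Mathlib

open scoped MatrixGroups TensorProduct

noncomputable section

namespace SteinbergTate

/-! ### Coefficient rings -/

section Coefficients

variable (l : ℕ) [Fact l.Prime]

/-- `Qbar l` is an algebraic closure of `ℚ_l`. -/
abbrev Qbar : Type := PadicAlgCl l

/-- `Zbar l` is the integral closure of `ℤ_l` in `Qbar l`. -/
abbrev Zbar : Subalgebra ℤ_[l] (Qbar l) := integralClosure ℤ_[l] (Qbar l)

/-- An element of `Qbar l` is integral over `ℤ_l` iff its `l`-adic norm is at most `1`. -/
theorem isIntegral_iff_norm_le_one (x : Qbar l) : IsIntegral ℤ_[l] x ↔ ‖x‖ ≤ 1 := by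
  have hx : IsIntegral ℚ_[l] x := (PadicAlgCl.isAlgebraic l).isAlgebraic x |>.isIntegral
  have key : ‖x‖ ≤ 1 ↔ ∀ n, ‖(minpoly ℚ_[l] x).coeff n‖ ≤ 1 :=
    spectralValue_le_one_iff (minpoly.monic hx)
  rw [key]
  constructor
  · intro h n
    rw [minpoly.isIntegrallyClosed_eq_field_fractions' ℚ_[l] h, Polynomial.coeff_map]
    exact PadicInt.norm_le_one _
  · intro h
    have hl : minpoly ℚ_[l] x ∈ Polynomial.lifts (algebraMap ℤ_[l] ℚ_[l]) := by
      rw [Polynomial.lifts_iff_coeff_lifts]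
      intro n
      exact ⟨⟨_, h n⟩, rfl⟩
    obtain ⟨q, hq, -, hm⟩ := Polynomial.lifts_and_degree_eq_and_monic hl (minpoly.monic hx)
    refine ⟨q, hm, ?_⟩
    have := minpoly.aeval ℚ_[l] x
    rw [← hq, Polynomial.aeval_map_algebraMap] at this
    exact this

theorem isUnit_iff_norm_eq_one (x : Zbar l) : IsUnit x ↔ ‖(x : Qbar l)‖ = 1 := by
  have hx := (isIntegral_iff_norm_le_one l x).1 x.2
  constructor
  · rintro ⟨u, rfl⟩
    have hy := (isIntegral_iff_norm_le_one l ((u⁻¹ : (Zbar l)ˣ) : Zbar l)).1 (Subtype.property _)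
    have h1 : (((u : Zbar l) : Qbar l)) * (((u⁻¹ : (Zbar l)ˣ) : Zbar l) : Qbar l) = 1 := by
      exact congrArg (Subtype.val) (Units.mul_inv u)
    have h2 := congrArg norm h1
    rw [norm_mul, norm_one] at h2
    have := norm_nonneg (((u : Zbar l) : Qbar l))
    nlinarith
  · intro h
    have hne : (x : Qbar l) ≠ 0 := by
      intro h0
      rw [h0, norm_zero] at h
      exact zero_ne_one h
    have hi : IsIntegral ℤ_[l] (x : Qbar l)⁻¹ := by
      rw [isIntegral_iff_norm_le_one, norm_inv, h, inv_one]
    exact IsUnit.of_mul_eq_one (⟨_, hi⟩ : Zbar l) (Subtype.ext (mul_inv_cancel₀ hne))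

instance : IsLocalRing (Zbar l) := by
  refine IsLocalRing.of_nonunits_add ?_
  intro a b ha hb
  have ha' := lt_of_le_of_ne ((isIntegral_iff_norm_le_one l a).1 a.2)
    (fun h => ha ((isUnit_iff_norm_eq_one l a).2 h))
  have hb' := lt_of_le_of_ne ((isIntegral_iff_norm_le_one l b).1 b.2)
    (fun h => hb ((isUnit_iff_norm_eq_one l b).2 h))
  intro hab
  have h1 := (isUnit_iff_norm_eq_one l _).1 hab
  have h2 := PadicAlgCl.isNonarchimedean l (a : Qbar l) (b : Qbar l)
  have h3 : max ‖(a : Qbar l)‖ ‖(b : Qbar l)‖ < 1 := max_lt ha' hb'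
  have h4 : ((a + b : Zbar l) : Qbar l) = (a : Qbar l) + (b : Qbar l) := rfl
  rw [h4] at h1
  linarith

/-- The quotient ring `Zbar l / l`. -/
abbrev ZbarMod : Type := Zbar l ⧸ Ideal.span {(l : Zbar l)}

/-- `Fbar l` is the residue field of `Zbar l` at its unique maximal ideal. -/
abbrev Fbar : Type := IsLocalRing.ResidueField (Zbar l)

instance : CharP (Fbar l) l := by
  have h0 : ((l : ℕ) : Fbar l) = 0 := by
    have h : (IsLocalRing.residue (Zbar l)) ((l : ℕ) : Zbar l) = 0 := by
      rw [IsLocalRing.residue_eq_zero_iff, IsLocalRing.mem_maximalIdeal, mem_nonunits_iff,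
        isUnit_iff_norm_eq_one]
      have h2 : (((l : ℕ) : Zbar l) : Qbar l) = algebraMap ℚ_[l] (Qbar l) (l : ℚ_[l]) := by
        simp
      rw [h2, PadicAlgCl.norm_extends, Padic.norm_p]
      have : (1 : ℝ) < l := by exact_mod_cast (Fact.out : l.Prime).one_lt
      exact (inv_lt_one_of_one_lt₀ this).ne
    simpa using h
  exact (CharP.charP_iff_prime_eq_zero Fact.out).2 h0

instance : PerfectRing (Fbar l) l := by
  refine PerfectRing.ofSurjective _ _ ?_
  intro y
  obtain ⟨x, rfl⟩ := IsLocalRing.residue_surjective y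
  have hl : 0 < l := (Fact.out : l.Prime).pos
  obtain ⟨z, hz⟩ := IsAlgClosed.exists_pow_nat_eq (x : Qbar l) hl
  have hzi : IsIntegral ℤ_[l] z := IsIntegral.of_pow hl (hz ▸ x.2)
  refine ⟨IsLocalRing.residue _ (⟨z, hzi⟩ : Zbar l), ?_⟩
  rw [frobenius_def, ← map_pow]
  exact congrArg _ (Subtype.ext hz)

end Coefficients

/-! ### Frobenius twist -/

section FrobeniusTwist

variable (k : Type*) [Field k] (l : ℕ) [ExpChar k l] [PerfectRing k l]
variable (W : Type*) [AddCommGroup W] [Module k W]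

/-- The Frobenius twist of a `k`-vector space `W`: the same additive group, with scalar
action `c * w = c ^ (1 / l) • w`. -/
@[nolint unusedArguments]
def FrobTwist (_k : Type*) (_l : ℕ) (W : Type*) : Type _ := W

instance : AddCommGroup (FrobTwist k l W) := inferInstanceAs (AddCommGroup W)

instance : Module k (FrobTwist k l W) :=
  Module.compHom W ((frobeniusEquiv k l).symm : k →+* k)

variable {W} {H : Type*} [Group H]

/-- The Frobenius twist of a representation: the same operators on the twisted space. -/
def frobTwistRep (ρ : Representation k H W) : Representation k H (FrobTwist k l W) where
  toFun h :=
    { toFun := fun w => ρ h w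
      map_add' := fun v w => (ρ h).map_add v w
      map_smul' := fun c w => (ρ h).map_smul ((frobeniusEquiv k l).symm c) w }
  map_one' := LinearMap.ext fun w => LinearMap.congr_fun ρ.map_one w
  map_mul' a b := LinearMap.ext fun w => LinearMap.congr_fun (ρ.map_mul a b) w

end FrobeniusTwist

/-! ### Tate cohomology of a cyclic group of order `l` generated by an operator `T` -/

section Tate

variable {R M : Type*} [CommRing R] [AddCommGroup M] [Module R M]

/-- The norm `1 + T + ⋯ + T ^ (l - 1)`. -/
def tateNorm (T : Module.End R M) (l : ℕ) : Module.End R M := ∑ i ∈ Finset.range l, T ^ i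

/-- `Ĥ⁰ = ker (1 - T) / im N`. -/
abbrev TateH0 (T : Module.End R M) (l : ℕ) : Type _ :=
  LinearMap.ker (1 - T) ⧸
    (LinearMap.range (tateNorm T l)).comap (LinearMap.ker (1 - T)).subtype

/-- `Ĥ¹ = ker N / im (1 - T)`. -/
abbrev TateH1 (T : Module.End R M) (l : ℕ) : Type _ :=
  LinearMap.ker (tateNorm T l) ⧸
    (LinearMap.range (1 - T)).comap (LinearMap.ker (tateNorm T l)).subtype

theorem ker_le_comap_of_commute {A B : Module.End R M} (h : Commute A B) :
    LinearMap.ker B ≤ (LinearMap.ker B).comap A := by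
  intro v hv
  rw [LinearMap.mem_ker] at hv
  rw [Submodule.mem_comap, LinearMap.mem_ker, ← Module.End.mul_apply, ← h.eq,
    Module.End.mul_apply, hv, map_zero]

theorem range_le_comap_of_commute {A B : Module.End R M} (h : Commute A B) :
    LinearMap.range B ≤ (LinearMap.range B).comap A := by
  rintro _ ⟨v, rfl⟩
  exact ⟨A v, by rw [← Module.End.mul_apply, ← h.eq, Module.End.mul_apply]⟩

theorem commute_tateNorm {A T : Module.End R M} (h : Commute A T) (l : ℕ) :
    Commute A (tateNorm T l) :=
  Commute.sum_right _ _ _ fun i _ => h.pow_right i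

/-- A representation commuting with `T` induces a representation on `Ĥ⁰`. -/
def tateH0Rep {H : Type*} [Group H] (ρ : Representation R H M) (T : Module.End R M) (l : ℕ)
    (h : ∀ g, Commute (ρ g) T) : Representation R H (TateH0 T l) :=
  (ρ.subrepresentation (LinearMap.ker (1 - T)) fun g =>
    ker_le_comap_of_commute ((Commute.one_right _).sub_right (h g))).quotient _
    fun g _ hv => range_le_comap_of_commute (commute_tateNorm (h g) l) hv

end Tate

/-- Extension of scalars of a representation. -/
def baseChangeRep {R M H : Type*} (k : Type*) [CommRing R] [AddCommGroup M] [Module R M] [Group H]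
    [CommRing k] [Algebra R k] (ρ : Representation R H M) : Representation k H (k ⊗[R] M) where
  toFun h := (ρ h).baseChange k
  map_one' := by rw [map_one]; exact LinearMap.baseChange_id
  map_mul' a b := by rw [map_mul]; exact LinearMap.baseChange_comp _ _

/-! ### Locally constant functions with compact support -/

section Functions

variable (X R : Type*) [TopologicalSpace X] [CommRing R]

/-- `C_c^∞(X, R)`: the locally constant functions `X → R` with compact support. -/
def CcInf : Submodule R (X → R) where
  carrier := {f | IsLocallyConstant f ∧ HasCompactSupport f}
  zero_mem' := ⟨IsLocallyConstant.const 0, HasCompactSupport.zero⟩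
  add_mem' := fun hf hg => ⟨hf.1.add hg.1, hf.2.add hg.2⟩
  smul_mem' := fun c _ hf =>
    ⟨hf.1.comp (fun r => c • r), hf.2.comp_left (g := fun r => c • r) (smul_zero c)⟩

variable {X} {H : Type*} [Group H]

/-- The action of `H` on `C_c^∞(X, R)` induced by an action of `H` on `X` by homeomorphisms,
`(h f)(x) = f (h⁻¹ x)`. -/
def ccRep (φ : H →* (X ≃ₜ X)) : Representation R H (CcInf X R) where
  toFun h := (LinearMap.funLeft R R (φ h⁻¹)).restrict fun f hf =>
    show _ ∧ _ from ⟨hf.1.comp_continuous (φ h⁻¹).continuous, hf.2.comp_homeomorph (φ h⁻¹)⟩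
  map_one' := by
    ext f x
    change f.1 (φ 1⁻¹ x) = f.1 x
    simp
  map_mul' a b := by
    ext f x
    change f.1 (φ (a * b)⁻¹ x) = f.1 (φ b⁻¹ (φ a⁻¹ x))
    rw [mul_inv_rev, map_mul]
    rfl

end Functions

/-! ### Flag varieties of `GL₃` -/

section Flags

set_option linter.unusedSectionVars false

variable (K : Type*) [Field K]

/-- The group of block upper triangular matrices in `GL₃(K)`; the blocks are the fibres of `b`. -/
def parabolic (b : Fin 3 → ℕ) : Subgroup (GL (Fin 3) K) where
  carrier := {g | Matrix.BlockTriangular (g : Matrix (Fin 3) (Fin 3) K) b}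
  one_mem' := Matrix.blockTriangular_one
  mul_mem' := fun hg hh => by
    simpa using Matrix.BlockTriangular.mul hg hh
  inv_mem' := fun {g} hg => by
    have : Invertible (g : Matrix (Fin 3) (Fin 3) K) := g.invertible
    have h : Matrix.BlockTriangular (g : Matrix (Fin 3) (Fin 3) K)⁻¹ b :=
      Matrix.blockTriangular_inv_of_blockTriangular hg
    rw [Set.mem_ofPred_eq, Matrix.coe_units_inv]
    exact h

/-- The block pattern of the upper triangular Borel subgroup. -/
abbrev bB : Fin 3 → ℕ := ![0, 1, 2]

/-- The block pattern of the parabolic subgroup of type `(2, 1)`. -/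
abbrev b21 : Fin 3 → ℕ := ![0, 0, 1]

/-- The block pattern of the parabolic subgroup of type `(1, 2)`. -/
abbrev b12 : Fin 3 → ℕ := ![0, 1, 1]

theorem borel_le_21 : parabolic K bB ≤ parabolic K b21 := by
  intro g hg i j hij
  refine hg ?_
  revert hij
  fin_cases i <;> fin_cases j <;> simp

theorem borel_le_12 : parabolic K bB ≤ parabolic K b12 := by
  intro g hg i j hij
  refine hg ?_
  revert hij
  fin_cases i <;> fin_cases j <;> simp

/-- The homogeneous space `GL₃(K) / P`. -/
abbrev Flag (b : Fin 3 → ℕ) : Type _ := GL (Fin 3) K ⧸ parabolic K b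

variable [TopologicalSpace K] [IsTopologicalRing K]

/-- Left translation on `GL₃(K) / P`. -/
def leftTranslation (b : Fin 3 → ℕ) : GL (Fin 3) K →* (Flag K b ≃ₜ Flag K b) where
  toFun g := Homeomorph.smul g
  map_one' := by ext x; exact one_smul (GL (Fin 3) K) x
  map_mul' g h := by ext x; exact mul_smul g h x

/-- The functions in `C_c^∞(GL₃(K) / B, R)` that are pulled back from functions in
`C_c^∞(GL₃(K) / P, R)`. -/
def pulledBack (R : Type*) [CommRing R] {b : Fin 3 → ℕ} (hb : parabolic K bB ≤ parabolic K b) :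
    Submodule R (CcInf (Flag K bB) R) :=
  ((CcInf (Flag K b) R).map
    (LinearMap.funLeft R R (Subgroup.quotientMapOfLE hb))).comap (CcInf (Flag K bB) R).subtype

/-- The image of `C_c^∞(X₂₁) ⊕ C_c^∞(X₁₂)` in `C_c^∞(X)`. -/
def steinbergRel (R : Type*) [CommRing R] : Submodule R (CcInf (Flag K bB) R) :=
  pulledBack K R (borel_le_21 K) ⊔ pulledBack K R (borel_le_12 K)

/-- The Steinberg module of `GL₃(K)` with coefficients in `R`: the cokernel of
`C_c^∞(X₂₁, R) ⊕ C_c^∞(X₁₂, R) → C_c^∞(X, R)`. For `R` the ring `Zbar l` this is the lattice given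
by the Borel–Serre resolution, for `Qbar l` the Steinberg representation, and for `Fbar l`
the mod-`l` Steinberg representation. -/
abbrev Steinberg (R : Type*) [CommRing R] : Type _ :=
  CcInf (Flag K bB) R ⧸ steinbergRel K R

variable {K} in
/-- Operators on functions induced by compatible homeomorphisms of `X` and `GL₃(K) / P`
preserve the functions pulled back from `GL₃(K) / P`. -/
theorem pulledBack_le_comap (R : Type*) [CommRing R] {b : Fin 3 → ℕ}
    (hb : parabolic K bB ≤ parabolic K b) {H : Type*} [Group H]
    (φ : H →* (Flag K bB ≃ₜ Flag K bB)) (φ' : H →* (Flag K b ≃ₜ Flag K b))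
    (hφ : ∀ h x, Subgroup.quotientMapOfLE hb (φ h x) = φ' h (Subgroup.quotientMapOfLE hb x))
    (h : H) : pulledBack K R hb ≤ (pulledBack K R hb).comap (ccRep R φ h) := by
  rintro f ⟨u, hu, huf⟩
  refine ⟨ccRep R φ' h ⟨u, hu⟩, Subtype.property _, ?_⟩
  funext x
  change u (φ' h⁻¹ (Subgroup.quotientMapOfLE hb x)) = f.1 (φ h⁻¹ x)
  rw [← hφ]
  exact congrFun huf _

theorem steinbergRel_le_comap_left (R : Type*) [CommRing R] (g : GL (Fin 3) K) :
    steinbergRel K R ≤ (steinbergRel K R).comap (ccRep R (leftTranslation K bB) g) := by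
  have key : ∀ {b : Fin 3 → ℕ} (hb : parabolic K bB ≤ parabolic K b),
      pulledBack K R hb ≤ (pulledBack K R hb).comap (ccRep R (leftTranslation K bB) g) := by
    intro b hb
    refine pulledBack_le_comap R hb _ (leftTranslation K b) ?_ g
    intro h x
    induction x using QuotientGroup.induction_on with
    | H x => rfl
  exact sup_le ((key _).trans (Submodule.comap_mono le_sup_left))
    ((key _).trans (Submodule.comap_mono le_sup_right))

/-- The action of `GL₃(K)` on the Steinberg module. -/
def steinbergRep (R : Type*) [CommRing R] : Representation R (GL (Fin 3) K) (Steinberg K R) :=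
  (ccRep R (leftTranslation K bB)).quotient _ (steinbergRel_le_comap_left K R)

/-- The twist of the Steinberg representation by a character `χ` of `Kˣ`, composed with `det`. -/
def twistedSteinbergRep (R : Type*) [CommRing R] (χ : Kˣ →* Rˣ) :
    Representation R (GL (Fin 3) K) (Steinberg K R) where
  toFun g := (χ (Matrix.GeneralLinearGroup.det g) : R) • steinbergRep K R g
  map_one' := by simp
  map_mul' a b := by
    simp only [map_mul, Units.val_mul]
    rw [smul_mul_smul_comm]

/-- Change of coefficients `C_c^∞(X, R) → C_c^∞(X, S)`. -/
def ccCoeff (X R S : Type*) [TopologicalSpace X] [CommRing R] [CommRing S] [Algebra R S] :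
    CcInf X R →ₗ[R] CcInf X S where
  toFun f := ⟨fun x => algebraMap R S (f.1 x),
    f.2.1.comp (algebraMap R S), f.2.2.comp_left (g := algebraMap R S) (map_zero _)⟩
  map_add' f g := by ext x; exact map_add (algebraMap R S) _ _
  map_smul' c f := by
    ext x
    change algebraMap R S (c * f.1 x) = c • algebraMap R S (f.1 x)
    rw [map_mul, Algebra.smul_def]

/-- Change of coefficients on Steinberg modules. -/
def steinbergCoeff (R S : Type*) [CommRing R] [CommRing S] [Algebra R S] :
    Steinberg K R →ₗ[R] Steinberg K S :=
  (steinbergRel K R).liftQ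
    (((steinbergRel K S).mkQ.restrictScalars R) ∘ₗ ccCoeff (Flag K bB) R S) <| by
    have key : ∀ {b : Fin 3 → ℕ} (hb : parabolic K bB ≤ parabolic K b),
        ∀ f ∈ pulledBack K R hb, ccCoeff (Flag K bB) R S f ∈ pulledBack K S hb := by
      rintro b hb f ⟨u, hu, huf⟩
      refine ⟨ccCoeff (Flag K b) R S ⟨u, hu⟩, Subtype.property _, ?_⟩
      funext x
      exact congrArg (algebraMap R S) (congrFun huf x)
    refine sup_le ?_ ?_
    · intro f hf
      exact (Submodule.Quotient.mk_eq_zero _).2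
        ((le_sup_left : _ ≤ steinbergRel K S) (key _ f hf))
    · intro f hf
      exact (Submodule.Quotient.mk_eq_zero _).2
        ((le_sup_right : _ ≤ steinbergRel K S) (key _ f hf))

end Flags

/-! ### The Galois action -/

section Galois

set_option linter.unusedSectionVars false

variable (F E : Type*) [Field F] [Field E] [Algebra F E]

/-- The action of the Galois group on `GL₃(E) / P`, induced by the action on matrix entries. -/
def galFlag (b : Fin 3 → ℕ) (σ : E ≃ₐ[F] E) : Flag E b → Flag E b :=
  Quotient.map' (Matrix.GeneralLinearGroup.map (σ : E →+* E)) <| by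
    intro g h hgh
    rw [QuotientGroup.leftRel_apply] at hgh ⊢
    rw [← map_inv, ← map_mul]
    intro i j hij
    rw [Matrix.GeneralLinearGroup.map_apply, hgh hij, map_zero]

variable [TopologicalSpace F] [IsTopologicalRing F]
variable [TopologicalSpace E] [IsTopologicalRing E] [IsModuleTopology F E]

theorem continuous_galFlag (b : Fin 3 → ℕ) (σ : E ≃ₐ[F] E) : Continuous (galFlag F E b σ) := by
  have hσ : Continuous σ := IsModuleTopology.continuous_of_linearMap σ.toLinearMap
  refine Continuous.quotient_map' ?_ _
  refine Units.continuous_iff.2 ⟨?_, ?_⟩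
  · exact Units.continuous_val.matrix_map hσ
  · exact Units.continuous_coe_inv.matrix_map hσ

/-- The Galois action on `GL₃(E) / P` by homeomorphisms. -/
def galAction (b : Fin 3 → ℕ) : (E ≃ₐ[F] E) →* (Flag E b ≃ₜ Flag E b) where
  toFun σ :=
    { toFun := galFlag F E b σ
      invFun := galFlag F E b σ⁻¹
      left_inv := fun x => by
        induction x using QuotientGroup.induction_on with
        | H x =>
          refine congrArg QuotientGroup.mk ?_
          ext i j
          exact σ.symm_apply_apply _
      right_inv := fun x => by
        induction x using QuotientGroup.induction_on with
        | H x =>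
          refine congrArg QuotientGroup.mk ?_
          ext i j
          exact σ.apply_symm_apply _
      continuous_toFun := continuous_galFlag F E b σ
      continuous_invFun := continuous_galFlag F E b σ⁻¹ }
  map_one' := by
    ext x
    induction x using QuotientGroup.induction_on with
    | H x => rfl
  map_mul' σ τ := by
    ext x
    induction x using QuotientGroup.induction_on with
    | H x => rfl

theorem steinbergRel_le_comap_gal (R : Type*) [CommRing R] (σ : E ≃ₐ[F] E) :
    steinbergRel E R ≤ (steinbergRel E R).comap (ccRep R (galAction F E bB) σ) := by
  have key : ∀ {b : Fin 3 → ℕ} (hb : parabolic E bB ≤ parabolic E b),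
      pulledBack E R hb ≤ (pulledBack E R hb).comap (ccRep R (galAction F E bB) σ) := by
    intro b hb
    refine pulledBack_le_comap R hb _ (galAction F E b) ?_ σ
    intro h x
    induction x using QuotientGroup.induction_on with
    | H x => rfl
  exact sup_le ((key _).trans (Submodule.comap_mono le_sup_left))
    ((key _).trans (Submodule.comap_mono le_sup_right))

/-- The action of `Gal(E/F)` on the Steinberg module of `GL₃(E)`. Together with `steinbergRep` it
gives the action of `GL₃(E) ⋊ Gal(E/F)`. -/
def steinbergGal (R : Type*) [CommRing R] : Representation R (E ≃ₐ[F] E) (Steinberg E R) :=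
  (ccRep R (galAction F E bB)).quotient _ (steinbergRel_le_comap_gal F E R)

/-- The action of `GL₃(F)` on the Steinberg module of `GL₃(E)`. -/
def steinbergRes (R : Type*) [CommRing R] : Representation R (GL (Fin 3) F) (Steinberg E R) :=
  (steinbergRep E R).comp (Matrix.GeneralLinearGroup.map (algebraMap F E))

/-- In `GL₃(E) ⋊ Gal(E/F)` one has `σ g σ⁻¹ = σ(g)`. -/
theorem steinbergGal_mul_steinbergRep (R : Type*) [CommRing R] (σ : E ≃ₐ[F] E)
    (g : GL (Fin 3) E) :
    steinbergGal F E R σ * steinbergRep E R g =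
      steinbergRep E R (Matrix.GeneralLinearGroup.map (σ : E →+* E) g) *
        steinbergGal F E R σ := by
  refine LinearMap.ext fun v => ?_
  induction v using Submodule.Quotient.induction_on with
  | H f =>
    refine congrArg (Submodule.Quotient.mk (p := steinbergRel E R)) ?_
    ext x
    change f.1 (leftTranslation E bB g⁻¹ (galAction F E bB σ⁻¹ x)) =
      f.1 (galAction F E bB σ⁻¹ (leftTranslation E bB
        (Matrix.GeneralLinearGroup.map (σ : E →+* E) g)⁻¹ x))
    refine congrArg f.1 ?_
    induction x using QuotientGroup.induction_on with
    | H x =>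
      refine congrArg QuotientGroup.mk ?_
      change g⁻¹ * Matrix.GeneralLinearGroup.map ((σ⁻¹ : E ≃ₐ[F] E) : E →+* E) x =
        Matrix.GeneralLinearGroup.map ((σ⁻¹ : E ≃ₐ[F] E) : E →+* E)
          ((Matrix.GeneralLinearGroup.map (σ : E →+* E) g)⁻¹ * x)
      rw [map_mul, ← map_inv]
      congr 1
      ext i j
      exact (σ.symm_apply_apply _).symm

theorem steinbergRes_commute (R : Type*) [CommRing R] (σ : E ≃ₐ[F] E) (g : GL (Fin 3) F) :
    Commute (steinbergRes F E R g) (steinbergGal F E R σ) := by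
  have h := steinbergGal_mul_steinbergRep F E R σ
    (Matrix.GeneralLinearGroup.map (algebraMap F E) g)
  have h2 : Matrix.GeneralLinearGroup.map (σ : E →+* E)
      (Matrix.GeneralLinearGroup.map (algebraMap F E) g) =
      Matrix.GeneralLinearGroup.map (algebraMap F E) g := by
    ext i j
    exact σ.commutes _
  rw [h2] at h
  exact h.symm

/-- The representation of `GL₃(F)` on `Ĥ⁰(⟨γ⟩, St)`, where `St` is the Steinberg module of `GL₃(E)`
with coefficients in `R`. -/
def steinbergTateH0Rep (R : Type*) [CommRing R] (γ : E ≃ₐ[F] E) (l : ℕ) :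
    Representation R (GL (Fin 3) F) (TateH0 (steinbergGal F E R γ) l) :=
  tateH0Rep (steinbergRes F E R) (steinbergGal F E R γ) l (steinbergRes_commute F E R γ)

end Galois

/-! ### Stable lattices -/

section Lattices

/-- A `Zbar l`-submodule `L` of a `Qbar l`-vector space `V` with `L ⊗ Qbar l = V`, stable under
the actions of the groups `G` and `Γ` on `V`. -/
structure IsStableLattice {l : ℕ} [Fact l.Prime] {V : Type*} [AddCommGroup V] [Module (Qbar l) V]
    {G Γ : Type*} [Group G] [Group Γ] (ρ : Representation (Qbar l) G V)
    (θ : Representation (Qbar l) Γ V) (L : Submodule (Zbar l) V) : Prop where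
  span_eq_top : Submodule.span (Qbar l) (L : Set V) = ⊤
  stable_left : ∀ g, ∀ v ∈ L, ρ g v ∈ L
  stable_right : ∀ σ, ∀ v ∈ L, θ σ v ∈ L

/-- The operator on a stable lattice `L` given by `σ`. -/
def IsStableLattice.operator {l : ℕ} [Fact l.Prime] {V : Type*} [AddCommGroup V]
    [Module (Qbar l) V] {G Γ : Type*} [Group G] [Group Γ] {ρ : Representation (Qbar l) G V}
    {θ : Representation (Qbar l) Γ V} {L : Submodule (Zbar l) V} (hL : IsStableLattice ρ θ L)
    (σ : Γ) : Module.End (Zbar l) L :=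
  ((θ σ).restrictScalars (Zbar l)).restrict (hL.stable_right σ)

/-- The character `χ ∘ Nr` of `Eˣ`. -/
def normChar {F : Type*} (E : Type*) [Field F] [Field E] [Algebra F E] {A : Type*} [CommMonoid A]
    (χ : Fˣ →* A) : Eˣ →* A :=
  χ.comp (Units.map (Algebra.norm F : E →* F))

end Lattices

end SteinbergTate

end

open scoped MatrixGroups TensorProduct

noncomputable section

set_option linter.unusedSectionVars false

namespace SteinbergTate

open Topology Filter Matrix

/-! ### Norms on local fields -/

/-! A full flag in K³ is a point together with a line through it. Fix the flag with point `![0, 0,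
1]` and line `![1, 0, 0]`. The flags opposite to it form the big cell, an orbit of the lower
unipotent group, which is a copy of K³. Off the cell every locally constant function is a function
of the point plus a function of the line (`eq_parts`), and such a sum is zero if it vanishes off the
cell. So each class in the Steinberg module has exactly one representative supported in the cell
(`exists_cellFns`, `eq_zero_of_mem_cellFns`): St_K(R) is C_c^∞(K³, R), compatibly with Γ and with
change of R. This gives injectivity of St_E(Zbar) → St_E(Qbar). The image is a lattice because a
locally constant function on the compact flag variety has finitely many values, whose denominators
are cleared by one power of l.

The map on Ĥ⁰ restricts functions to F-rational flags and reduces their values modulo l. It kills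
norms, since Galois translates have equal restrictions. For bijectivity, work on E³ modulo a small
box, where γ has free orbits and fixed classes. As l is prime to p, averaging over Γ does not
increase the norm, so a fixed class contains an F-rational point. An invariant function is a norm on
the free orbits, and it is a norm on the fixed classes once its values there are divisible by l
(`exists_norm_eq`). Conversely, any function on F³ extends to an invariant one
(`exists_invariant_lift`). Base change to Fbar is reduction of coefficients; following it by the
inverse of Frobenius gives a linear map to the twist.

For Ĥ¹, let m be killed by N and not in im(1 - γ). By Fourier analysis on an additive group of E, a
vector outside a stable submodule stays outside it in the coinvariants twisted by a suitable
character, and twisted coinvariants acquire no l-torsion, because the finite quotients of balls have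
order prime to l (`exists_notMem_sup_twistRel`, `saturated_sup_twistRel`). The character can be
chosen Γ-invariant so that m also stays outside im(1 - γ)
(`IsCyclicLocal.exists_notMem_sup_twistRel`). Apply this to the center of the unipotent group and
then to a second coordinate. If the central character is nontrivial, conjugation by an element of
GL₂(F) makes it trivial; then the third coordinate can be treated as well. The unipotent group now
acts on a torsion-free quotient by an invariant character. Up to powers of l this quotient is
generated by unipotent translates of γ-fixed vectors (`mem_span_lowerUnip`), so γ acts on it
trivially, N is multiplication by l, and m dies there: a contradiction. For a twist by χ, either χ
takes a value of norm greater than one and the lattice is divisible by l, or the lattice is already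
stable under the untwisted action. -/

/-- A non-archimedean absolute value on `K` which induces the given topology and whose closed balls
are compact. -/
class LocalNorm (K : Type*) [Field K] [TopologicalSpace K] where
  v : AbsoluteValue K ℝ
  add_le_max : ∀ x y, v (x + y) ≤ max (v x) (v y)
  hasBasis : (𝓝 (0 : K)).HasBasis (fun r : ℝ => 0 < r) (fun r => {x | v x ≤ r})
  isCompact_ball : ∀ r, IsCompact {x | v x ≤ r}

/-- Linear maps out of a module topology are continuous, and so are linear maps out of a
finite-dimensional normed space over a complete field. This transports the spectral norm to the
given topology on K. -/
theorem isHomeomorph_of_isModuleTopology {k V W : Type*} [NontriviallyNormedField k]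
    [CompleteSpace k] [AddCommGroup V] [Module k V] [FiniteDimensional k V] [TopologicalSpace V]
    [IsModuleTopology k V] [NormedAddCommGroup W] [NormedSpace k W] (e : V ≃ₗ[k] W) :
    Continuous e ∧ Continuous e.symm := by
  have : FiniteDimensional k W := e.finiteDimensional
  have := IsModuleTopology.topologicalAddGroup k V
  exact ⟨IsModuleTopology.continuous_of_linearMap e.toLinearMap,
    LinearMap.continuous_of_finiteDimensional e.symm.toLinearMap⟩

/-- The copy of `K` that carries the spectral norm over `ℚ_[p]`. -/
@[nolint unusedArguments]
def SpectralCopy (_p : ℕ) (K : Type*) : Type _ := K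

section SpectralCopy

variable (p : ℕ) [Fact p.Prime] (K : Type*) [Field K] [Algebra ℚ_[p] K] [FiniteDimensional ℚ_[p] K]

instance : NontriviallyNormedField (SpectralCopy p K) :=
  spectralNorm.nontriviallyNormedField ℚ_[p] K

instance : NormedAlgebra ℚ_[p] (SpectralCopy p K) :=
  spectralNorm.normedAlgebra ℚ_[p] K

/-- The identity from `K` to its normed copy. -/
def toSpectralCopy : K ≃ₐ[ℚ_[p]] SpectralCopy p K := AlgEquiv.refl (A₁ := K)

theorem norm_toSpectralCopy (x : K) : ‖toSpectralCopy p K x‖ = spectralNorm ℚ_[p] K x := rfl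

variable [TopologicalSpace K] [IsModuleTopology ℚ_[p] K]

/-- The spectral norm over `ℚ_[p]` of a finite extension. -/
@[reducible]
def LocalNorm.ofPadic : LocalNorm K where
  v :=
    { toFun := spectralNorm ℚ_[p] K
      map_mul' := fun x y => norm_mul (toSpectralCopy p K x) (toSpectralCopy p K y)
      nonneg' := fun x => norm_nonneg (toSpectralCopy p K x)
      eq_zero' := fun x => by
        rw [← norm_toSpectralCopy, norm_eq_zero, EmbeddingLike.map_eq_zero_iff]
      add_le' := fun x y => norm_add_le (toSpectralCopy p K x) (toSpectralCopy p K y) }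
  add_le_max := isNonarchimedean_spectralNorm
  hasBasis := by
    obtain ⟨h1, h2⟩ := isHomeomorph_of_isModuleTopology (toSpectralCopy p K).toLinearEquiv
    let e : K ≃ₜ SpectralCopy p K := ⟨(toSpectralCopy p K).toEquiv, h1, h2⟩
    have h := (Metric.nhds_basis_closedBall (x := (0 : SpectralCopy p K))).comap e
    rw [← show e 0 = 0 from map_zero (toSpectralCopy p K), ← e.nhds_eq_comap] at h
    refine h.congr (fun _ => Iff.rfl) fun r _ => ?_
    ext x
    rw [Set.mem_preimage, show e 0 = 0 from map_zero (toSpectralCopy p K),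
      mem_closedBall_zero_iff]
    exact Iff.rfl
  isCompact_ball := fun r => by
    obtain ⟨h1, h2⟩ := isHomeomorph_of_isModuleTopology (toSpectralCopy p K).toLinearEquiv
    let e : K ≃ₜ SpectralCopy p K := ⟨(toSpectralCopy p K).toEquiv, h1, h2⟩
    have : FiniteDimensional ℚ_[p] (SpectralCopy p K) :=
      (toSpectralCopy p K).toLinearEquiv.finiteDimensional
    have : ProperSpace (SpectralCopy p K) := FiniteDimensional.proper ℚ_[p] _
    have h := e.isCompact_preimage.2 (isCompact_closedBall (0 : SpectralCopy p K) r)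
    convert h using 1
    ext x
    rw [Set.mem_preimage, mem_closedBall_zero_iff]
    exact Iff.rfl

end SpectralCopy

namespace LocalNorm

variable {K : Type*} [Field K] [TopologicalSpace K] [LocalNorm K]

variable (K) in
/-- The ball of radius `r` around `0`. -/
def ball (r : ℝ) (hr : 0 ≤ r) : AddSubgroup K where
  carrier := {x | v x ≤ r}
  zero_mem' := by simpa using hr
  add_mem' := fun ha hb => (add_le_max _ _).trans (max_le ha hb)
  neg_mem' := fun {x} hx => by simpa using hx

theorem sub_le_max (x y : K) : v (x - y) ≤ max (v x) (v y) := by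
  have := add_le_max x (-y)
  rwa [AbsoluteValue.map_neg, ← sub_eq_add_neg] at this

variable [IsTopologicalRing K]

theorem hasBasis_nhds (x : K) :
    (𝓝 x).HasBasis (fun r : ℝ => 0 < r) (fun r => {y | v (y - x) ≤ r}) := by
  have h := (hasBasis (K := K)).comap (fun y => y - x)
  have h2 : comap (fun y => y - x) (𝓝 (0 : K)) = 𝓝 x := by
    have := (Homeomorph.subRight x).nhds_eq_comap x
    simpa using this.symm
  rw [h2] at h
  exact h

theorem eventually_le (x : K) {r : ℝ} (hr : 0 < r) : ∀ᶠ y in 𝓝 x, v (y - x) ≤ r :=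
  (hasBasis_nhds x).mem_of_mem hr

theorem eventually_eq {x : K} (hx : x ≠ 0) : ∀ᶠ y in 𝓝 x, v y = v x := by
  have hx' : 0 < v x := v.pos hx
  filter_upwards [eventually_le x (half_pos hx')] with y hy
  have h1 : v y ≤ v x := by
    have := add_le_max (y - x) x
    rw [sub_add_cancel] at this
    exact this.trans (max_le (by linarith) le_rfl)
  have h2 : v x ≤ v y := by
    have := sub_le_max y (y - x)
    rw [sub_sub_cancel] at this
    rcases le_max_iff.1 this with h | h
    · exact h
    · linarith
  exact le_antisymm h1 h2

instance : T2Space K := by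
  refine IsTopologicalAddGroup.t2Space_of_zero_sep fun x hx => ?_
  refine ⟨_, hasBasis.mem_of_mem (half_pos (v.pos hx)), fun h => ?_⟩
  have h1 : v x ≤ v x / 2 := h
  linarith [v.pos hx]

instance : ContinuousInv₀ K where
  continuousAt_inv₀ x hx := by
    have hx' : 0 < v x := v.pos hx
    refine (hasBasis_nhds x⁻¹).tendsto_right_iff.2 fun r hr => ?_
    filter_upwards [eventually_eq hx, eventually_le x (mul_pos hr (mul_pos hx' hx'))] with y h1 h2
    have hy : y ≠ 0 := by rw [← v.ne_zero_iff, h1]; exact hx'.ne'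
    have h3 : y⁻¹ - x⁻¹ = (x - y) * (y⁻¹ * x⁻¹) := by field_simp
    change v (y⁻¹ - x⁻¹) ≤ r
    rw [h3, map_mul, map_mul, map_inv₀, map_inv₀, h1, v.map_sub]
    calc v (y - x) * ((v x)⁻¹ * (v x)⁻¹) ≤ r * (v x * v x) * ((v x)⁻¹ * (v x)⁻¹) := by gcongr
      _ = r := by field_simp

end LocalNorm

section FlagPairs

variable {K : Type*} [Field K]

/-! ### Flags as pairs of a point and a line -/

theorem mem_parabolic_bB {h : GL (Fin 3) K} :
    h ∈ parabolic K bB ↔ h 1 0 = 0 ∧ h 2 0 = 0 ∧ h 2 1 = 0 := by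
  constructor
  · exact fun H => ⟨H (by simp), H (by simp), H (by simp)⟩
  · rintro ⟨h1, h2, h3⟩ i j hij
    revert hij
    fin_cases i <;> fin_cases j <;> simp [h1, h2, h3]

theorem mem_parabolic_b12 {h : GL (Fin 3) K} :
    h ∈ parabolic K b12 ↔ h 1 0 = 0 ∧ h 2 0 = 0 := by
  constructor
  · exact fun H => ⟨H (by simp), H (by simp)⟩
  · rintro ⟨h1, h2⟩ i j hij
    revert hij
    fin_cases i <;> fin_cases j <;> simp [h1, h2]

theorem mem_parabolic_b21 {h : GL (Fin 3) K} :
    h ∈ parabolic K b21 ↔ h 2 0 = 0 ∧ h 2 1 = 0 := by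
  constructor
  · exact fun H => ⟨H (by simp), H (by simp)⟩
  · rintro ⟨h1, h2⟩ i j hij
    revert hij
    fin_cases i <;> fin_cases j <;> simp [h1, h2]

/-- The coset of `g` in `GL₃(K) / P`. -/
abbrev flag (b : Fin 3 → ℕ) (g : GL (Fin 3) K) : Flag K b := QuotientGroup.mk g

/-- `p` spans the line of the flag of `g`. -/
def IsPoint (g : GL (Fin 3) K) (p : Fin 3 → K) : Prop :=
  ∃ c : K, c ≠ 0 ∧ p = c • g.1.col 0

/-- `r` is an equation of the plane of the flag of `g`. -/
def IsLine (g : GL (Fin 3) K) (r : Fin 3 → K) : Prop :=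
  r ≠ 0 ∧ (r ᵥ* g.1) 0 = 0 ∧ (r ᵥ* g.1) 1 = 0

theorem IsPoint.flag_eq {g g' : GL (Fin 3) K} {p : Fin 3 → K} (h : IsPoint g p)
    (h' : IsPoint g' p) : flag b12 g = flag b12 g' := by
  obtain ⟨c, hc, rfl⟩ := h
  obtain ⟨c', hc', h'⟩ := h'
  refine QuotientGroup.eq.2 (mem_parabolic_b12.2 ?_)
  have key : ∀ i, (g⁻¹ * g') i 0 = c'⁻¹ * c * (1 : Matrix (Fin 3) (Fin 3) K) i 0 := by
    intro i
    have h2 : g'.1.col 0 = (c'⁻¹ * c) • g.1.col 0 := by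
      rw [mul_smul, h', smul_smul, inv_mul_cancel₀ hc', one_smul]
    have h3 : (g⁻¹ * g') i 0 = ((g⁻¹).1 *ᵥ g'.1.col 0) i := rfl
    have h4 : ((g⁻¹).1 *ᵥ g.1.col 0) i = ((g⁻¹).1 * g.1) i 0 := rfl
    rw [h3, h2, mulVec_smul, Pi.smul_apply, h4, ← Units.val_mul, inv_mul_cancel]
    rfl
  exact ⟨by simp [key], by simp [key]⟩

theorem IsLine.vecMul_two_ne {g : GL (Fin 3) K} {r : Fin 3 → K} (h : IsLine g r) :
    (r ᵥ* g.1) 2 ≠ 0 := by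
  intro h2
  refine h.1 ?_
  have h3 : r ᵥ* g.1 = 0 := by
    funext i
    fin_cases i
    exacts [h.2.1, h.2.2, h2]
  have h4 : r ᵥ* g.1 ᵥ* (g⁻¹).1 = r := by
    rw [vecMul_vecMul, ← Units.val_mul, mul_inv_cancel, Units.val_one, vecMul_one]
  rw [← h4, h3, zero_vecMul]

theorem IsLine.flag_eq {g g' : GL (Fin 3) K} {r : Fin 3 → K} (h : IsLine g r)
    (h' : IsLine g' r) : flag b21 g = flag b21 g' := by
  refine QuotientGroup.eq.2 (mem_parabolic_b21.2 ?_)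
  have key : ∀ k, (r ᵥ* g.1) 2 * (g⁻¹ * g') 2 k = (r ᵥ* g'.1) k := by
    intro k
    have h4 : r ᵥ* g.1 ᵥ* (g⁻¹ * g').1 = r ᵥ* g'.1 := by
      rw [vecMul_vecMul, ← Units.val_mul, mul_inv_cancel_left]
    rw [← h4]
    change _ = ∑ j, (r ᵥ* g.1) j * (g⁻¹ * g').1 j k
    rw [Fin.sum_univ_three, h.2.1, h.2.2]
    simp
  have h0 := key 0
  have h1 := key 1
  rw [h'.2.1] at h0
  rw [h'.2.2] at h1
  exact ⟨(mul_eq_zero.1 h0).resolve_left h.vecMul_two_ne,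
    (mul_eq_zero.1 h1).resolve_left h.vecMul_two_ne⟩

/-- The Borel subgroup is the intersection of the two maximal parabolics, so a full flag is known
from its point and its line. -/
theorem flag_bB_eq {g g' : GL (Fin 3) K} (h1 : flag b12 g = flag b12 g')
    (h2 : flag b21 g = flag b21 g') : flag bB g = flag bB g' := by
  have h1 := mem_parabolic_b12.1 (QuotientGroup.eq.1 h1)
  have h2 := mem_parabolic_b21.1 (QuotientGroup.eq.1 h2)
  exact QuotientGroup.eq.2 (mem_parabolic_bB.2 ⟨h1.1, h1.2, h2.2⟩)

theorem isPoint_col (g : GL (Fin 3) K) : IsPoint g (g.1.col 0) :=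
  ⟨1, one_ne_zero, (one_smul _ _).symm⟩

theorem row_inv_vecMul (g : GL (Fin 3) K) (j k : Fin 3) :
    ((g⁻¹).1.row j ᵥ* g.1) k = (1 : Matrix (Fin 3) (Fin 3) K) j k := by
  have h : ((g⁻¹).1.row j ᵥ* g.1) k = ((g⁻¹).1 * g.1) j k := rfl
  rw [h, ← Units.val_mul, inv_mul_cancel]
  rfl

theorem isLine_row (g : GL (Fin 3) K) : IsLine g ((g⁻¹).1.row 2) := by
  have key := row_inv_vecMul g 2
  refine ⟨fun h => ?_, (key 0).trans (by simp), (key 1).trans (by simp)⟩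
  have := key 2
  rw [h, zero_vecMul] at this
  simp at this

theorem IsPoint.smul {g : GL (Fin 3) K} {p : Fin 3 → K} (h : IsPoint g p) {c : K} (hc : c ≠ 0) :
    IsPoint g (c • p) := by
  obtain ⟨d, hd, rfl⟩ := h
  exact ⟨c * d, mul_ne_zero hc hd, smul_smul _ _ _⟩

theorem IsLine.smul {g : GL (Fin 3) K} {r : Fin 3 → K} (h : IsLine g r) {c : K} (hc : c ≠ 0) :
    IsLine g (c • r) := by
  refine ⟨smul_ne_zero hc h.1, ?_, ?_⟩
  · rw [smul_vecMul, Pi.smul_apply, h.2.1, smul_zero]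
  · rw [smul_vecMul, Pi.smul_apply, h.2.2, smul_zero]

theorem IsPoint.ne_zero {g : GL (Fin 3) K} {p : Fin 3 → K} (h : IsPoint g p) : p ≠ 0 := by
  obtain ⟨c, hc, rfl⟩ := h
  refine smul_ne_zero hc fun h0 => ?_
  have h1 : (g⁻¹).1 *ᵥ g.1.col 0 = ((g⁻¹).1 * g.1).col 0 := rfl
  rw [h0, mulVec_zero, ← Units.val_mul, inv_mul_cancel] at h1
  simpa [Matrix.col] using congrFun h1 0

theorem IsPoint.dotProduct_eq_zero {g : GL (Fin 3) K} {p r : Fin 3 → K} (h : IsPoint g p)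
    (h' : IsLine g r) : r ⬝ᵥ p = 0 := by
  obtain ⟨c, hc, rfl⟩ := h
  have h1 : r ⬝ᵥ g.1.col 0 = 0 := h'.2.1
  rw [dotProduct_smul, h1, smul_zero]

theorem IsPoint.mul {g : GL (Fin 3) K} {p : Fin 3 → K} (h : IsPoint g p) (w : GL (Fin 3) K) :
    IsPoint (w * g) (w.1 *ᵥ p) := by
  obtain ⟨c, hc, rfl⟩ := h
  exact ⟨c, hc, by rw [mulVec_smul]; rfl⟩

theorem IsLine.mul {g : GL (Fin 3) K} {r : Fin 3 → K} (w : GL (Fin 3) K)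
    (h : IsLine g (r ᵥ* w.1)) : IsLine (w * g) r := by
  refine ⟨fun h0 => h.1 (by rw [h0, zero_vecMul]), ?_, ?_⟩
  · rw [Units.val_mul, ← vecMul_vecMul]; exact h.2.1
  · rw [Units.val_mul, ← vecMul_vecMul]; exact h.2.2

/-- A matrix whose flag has the point `p` and the line `r`, on the chart `p i ≠ 0`, `r j ≠ 0`. -/
def chartMatrix (i j : Fin 3) (p r : Fin 3 → K) : Matrix (Fin 3) (Fin 3) K :=
  (Matrix.of ![p, crossProduct r (Pi.single i 1), Pi.single j 1])ᵀ

/-- The columns are p, r × e_i and e_j, and p × (r × e_i) = p_i r because r ⬝ p = 0. -/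
theorem det_chartMatrix (i j : Fin 3) {p r : Fin 3 → K} (h : r ⬝ᵥ p = 0) :
    (chartMatrix i j p r).det = p i * r j := by
  have h1 : (chartMatrix i j p r).det
      = Pi.single j 1 ⬝ᵥ crossProduct p (crossProduct r (Pi.single i 1)) := by
    rw [chartMatrix, det_transpose, ← triple_product_permutation, ← triple_product_permutation,
      triple_product_eq_det]
    rfl
  have h2 := cross_cross_eq_smul_sub_smul' p r (Pi.single i 1)
  rw [h1, h2, h]
  simp

theorem isPoint_isLine_chart {i j : Fin 3} {p r : Fin 3 → K} (h : r ⬝ᵥ p = 0)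
    (hj : r j ≠ 0) {g : GL (Fin 3) K} (hg : g.1 = chartMatrix i j p r) :
    IsPoint g p ∧ IsLine g r := by
  refine ⟨⟨1, one_ne_zero, ?_⟩, fun h0 => hj (by rw [h0]; rfl), ?_, ?_⟩
  · rw [hg, one_smul]; rfl
  · rw [hg]; exact h
  · rw [hg]; exact dot_self_cross r _

theorem exists_isPoint_isLine {p r : Fin 3 → K} (hp : p ≠ 0) (hr : r ≠ 0) (h : r ⬝ᵥ p = 0) :
    ∃ g : GL (Fin 3) K, IsPoint g p ∧ IsLine g r := by
  obtain ⟨i, hi⟩ := Function.ne_iff.1 hp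
  obtain ⟨j, hj⟩ := Function.ne_iff.1 hr
  have hd : (chartMatrix i j p r).det ≠ 0 := by
    rw [det_chartMatrix i j h]; exact mul_ne_zero hi hj
  exact ⟨GeneralLinearGroup.mkOfDetNeZero _ hd, isPoint_isLine_chart h hj rfl⟩

end FlagPairs

/-! ### Continuity of the passage from matrices to GL₃. -/

section FlagTopology

variable {K : Type*} [Field K]

/-- The invertible matrix `A`, or `1` if `A` is not invertible. -/
def toGL (A : Matrix (Fin 3) (Fin 3) K) : GL (Fin 3) K :=
  open Classical in
  if h : A.det ≠ 0 then GeneralLinearGroup.mkOfDetNeZero A h else 1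

theorem coe_toGL {A : Matrix (Fin 3) (Fin 3) K} (h : A.det ≠ 0) : (toGL A).1 = A := by
  rw [toGL, dif_pos h]; rfl

variable [TopologicalSpace K] [IsTopologicalRing K] [ContinuousInv₀ K] [T2Space K]

/-- The topology on units also requires continuity of the inverse, which is det⁻¹ times the adjugate
near A. -/
theorem continuousAt_toGL {A : Matrix (Fin 3) (Fin 3) K} (h : A.det ≠ 0) :
    ContinuousAt (toGL : Matrix (Fin 3) (Fin 3) K → GL (Fin 3) K) A := by
  have hdet : ContinuousAt (fun B : Matrix (Fin 3) (Fin 3) K => B.det) A :=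
    (continuous_id.matrix_det).continuousAt
  have hev : ∀ᶠ B in 𝓝 A, B.det ≠ 0 := hdet.eventually_ne h
  rw [Units.isInducing_embedProduct.continuousAt_iff]
  refine ContinuousAt.prodMk ?_ ?_
  · refine (continuousAt_id (x := A)).congr ?_
    filter_upwards [hev] with B hB using (coe_toGL hB).symm
  · refine MulOpposite.continuous_op.continuousAt.comp ?_
    have h1 : ContinuousAt (fun B : Matrix (Fin 3) (Fin 3) K => (B.det)⁻¹ • B.adjugate) A :=
      (hdet.inv₀ h).smul (continuous_id.matrix_adjugate).continuousAt
    refine h1.congr ?_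
    filter_upwards [hev] with B hB
    rw [Matrix.coe_units_inv, coe_toGL hB, Matrix.inv_def, Ring.inverse_eq_inv']

end FlagTopology

/-! ### Functions on flags in homogeneous coordinates of the point and the line. -/

section PairValues

variable {K : Type*} [Field K]

theorem IsPoint.of_flag_eq {g g' : GL (Fin 3) K} {p : Fin 3 → K} (h : IsPoint g p)
    (hg : flag b12 g = flag b12 g') : IsPoint g' p := by
  obtain ⟨c, hc, rfl⟩ := h
  have h1 := mem_parabolic_b12.1 (QuotientGroup.eq.1 hg)
  have h2 : g'.1.col 0 = ((g⁻¹ * g') 0 0) • g.1.col 0 := by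
    have h3 : g'.1.col 0 = g.1 *ᵥ (g⁻¹ * g').1.col 0 := by
      have : g.1 *ᵥ (g⁻¹ * g').1.col 0 = (g.1 * (g⁻¹ * g').1).col 0 := rfl
      rw [this, ← Units.val_mul, mul_inv_cancel_left]
    rw [h3]
    funext i
    change ∑ j, g.1 i j * (g⁻¹ * g') j 0 = (g⁻¹ * g') 0 0 * g.1 i 0
    rw [Fin.sum_univ_three, h1.1, h1.2]
    ring
  have hne : (g⁻¹ * g') 0 0 ≠ 0 := fun h0 => (isPoint_col g').ne_zero (by rw [h2, h0, zero_smul])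
  refine ⟨c * ((g⁻¹ * g') 0 0)⁻¹, mul_ne_zero hc (inv_ne_zero hne), ?_⟩
  rw [h2, smul_smul, mul_assoc, inv_mul_cancel₀ hne, mul_one]

theorem IsLine.of_flag_eq {g g' : GL (Fin 3) K} {r : Fin 3 → K} (h : IsLine g r)
    (hg : flag b21 g = flag b21 g') : IsLine g' r := by
  have h1 := mem_parabolic_b21.1 (QuotientGroup.eq.1 hg)
  have key : ∀ k, (r ᵥ* g'.1) k = (r ᵥ* g.1) 2 * (g⁻¹ * g') 2 k := by
    intro k
    have h4 : r ᵥ* g.1 ᵥ* (g⁻¹ * g').1 = r ᵥ* g'.1 := by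
      rw [vecMul_vecMul, ← Units.val_mul, mul_inv_cancel_left]
    rw [← h4]
    change ∑ j, (r ᵥ* g.1) j * (g⁻¹ * g').1 j k = _
    rw [Fin.sum_univ_three, h.2.1, h.2.2]
    simp
  exact ⟨h.1, by rw [key, h1.1, mul_zero], by rw [key, h1.2, mul_zero]⟩

variable {R : Type*} [CommRing R]

/-- The value of `f` at the flag with point `p` and line `r`. -/
def pairVal (f : Flag K bB → R) (p r : Fin 3 → K) : R :=
  -- Pairs that come from no flag get the value 0, so that rescaling p or r needs no incidence
  -- hypothesis.
  open Classical in
  if h : ∃ g : GL (Fin 3) K, IsPoint g p ∧ IsLine g r then f (flag bB h.choose) else 0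

theorem pairVal_eq (f : Flag K bB → R) {p r : Fin 3 → K} {g : GL (Fin 3) K} (hp : IsPoint g p)
    (hr : IsLine g r) : pairVal f p r = f (flag bB g) := by
  have h : ∃ g : GL (Fin 3) K, IsPoint g p ∧ IsLine g r := ⟨g, hp, hr⟩
  rw [pairVal, dif_pos h]
  exact congrArg f (flag_bB_eq (h.choose_spec.1.flag_eq hp) (h.choose_spec.2.flag_eq hr))

theorem pairVal_smul_left (f : Flag K bB → R) {p r : Fin 3 → K} {c : K} (hc : c ≠ 0) :
    pairVal f (c • p) r = pairVal f p r := by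
  by_cases h : ∃ g : GL (Fin 3) K, IsPoint g p ∧ IsLine g r
  · obtain ⟨g, h1, h2⟩ := h
    rw [pairVal_eq f h1 h2, pairVal_eq f (h1.smul hc) h2]
  · rw [pairVal, pairVal, dif_neg h, dif_neg]
    rintro ⟨g, h1, h2⟩
    refine h ⟨g, ?_, h2⟩
    simpa [smul_smul, hc] using h1.smul (inv_ne_zero hc)

theorem pairVal_smul_right (f : Flag K bB → R) {p r : Fin 3 → K} {c : K} (hc : c ≠ 0) :
    pairVal f p (c • r) = pairVal f p r := by
  by_cases h : ∃ g : GL (Fin 3) K, IsPoint g p ∧ IsLine g r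
  · obtain ⟨g, h1, h2⟩ := h
    rw [pairVal_eq f h1 h2, pairVal_eq f h1 (h2.smul hc)]
  · rw [pairVal, pairVal, dif_neg h, dif_neg]
    rintro ⟨g, h1, h2⟩
    refine h ⟨g, h1, ?_⟩
    simpa [smul_smul, hc] using h2.smul (inv_ne_zero hc)

/-- The function on `GL₃(K) / P₁₂` given by a homogeneous function of the point. -/
def ofPoint (φ : (Fin 3 → K) → R) (x : Flag K b12) : R := φ (x.out.1.col 0)

/-- The function on `GL₃(K) / P₂₁` given by a homogeneous function of the line. -/
def ofLine (φ : (Fin 3 → K) → R) (x : Flag K b21) : R := φ ((x.out⁻¹).1.row 2)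

theorem ofPoint_flag {φ : (Fin 3 → K) → R} (hφ : ∀ (c : K) p, c ≠ 0 → φ (c • p) = φ p)
    {g : GL (Fin 3) K} {p : Fin 3 → K} (hp : IsPoint g p) : ofPoint φ (flag b12 g) = φ p := by
  have h := hp.of_flag_eq (g' := (flag b12 g).out) (QuotientGroup.out_eq' _).symm
  obtain ⟨c, hc, h⟩ := h
  rw [h, hφ _ _ hc]
  rfl

theorem IsLine.exists_smul {g : GL (Fin 3) K} {r r' : Fin 3 → K} (h : IsLine g r)
    (h' : IsLine g r') : ∃ c : K, c ≠ 0 ∧ r = c • r' := by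
  refine ⟨(r ᵥ* g.1) 2 / (r' ᵥ* g.1) 2, div_ne_zero h.vecMul_two_ne h'.vecMul_two_ne, ?_⟩
  have h4 : ∀ r : Fin 3 → K, r ᵥ* g.1 ᵥ* (g⁻¹).1 = r := fun r => by
    rw [vecMul_vecMul, ← Units.val_mul, mul_inv_cancel, Units.val_one, vecMul_one]
  rw [← h4 r, ← h4 r', ← smul_vecMul]
  congr 1
  funext i
  fin_cases i
  · simp [h.2.1, h'.2.1]
  · simp [h.2.2, h'.2.2]
  · simp [h'.vecMul_two_ne]

theorem ofLine_flag {φ : (Fin 3 → K) → R} (hφ : ∀ (c : K) p, c ≠ 0 → φ (c • p) = φ p)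
    {g : GL (Fin 3) K} {r : Fin 3 → K} (hr : IsLine g r) : ofLine φ (flag b21 g) = φ r := by
  have h := hr.of_flag_eq (g' := (flag b21 g).out) (QuotientGroup.out_eq' _).symm
  obtain ⟨c, hc, h⟩ := h.exists_smul (isLine_row _)
  rw [h, hφ _ _ hc]
  rfl

end PairValues

/-! ### Compactness of the flag varieties and its consequences. -/

section FlagCompact

variable {K : Type*} [Field K] [TopologicalSpace K] [IsTopologicalRing K]

theorem isLocallyConstant_of_comp_flag {b : Fin 3 → ℕ} {R : Type*} {f : Flag K b → R}
    (h : IsLocallyConstant fun g => f (flag b g)) : IsLocallyConstant f :=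
  fun s => (QuotientGroup.isQuotientMap_mk _).isOpen_preimage.1 (h s)

theorem continuous_chartMatrix (i j : Fin 3) :
    Continuous fun x : (Fin 3 → K) × (Fin 3 → K) => chartMatrix i j x.1 x.2 := by
  refine continuous_matrix fun a b => ?_
  fin_cases b
  · exact (continuous_apply a).comp continuous_fst
  · change Continuous fun x : (Fin 3 → K) × (Fin 3 → K) => crossProduct x.2 (Pi.single i 1) a
    simp only [cross_apply]
    fin_cases a <;> (simp; fun_prop)
  · exact continuous_const

variable [LocalNorm K]

theorem continuousAt_flag_chart {i j : Fin 3} {x : (Fin 3 → K) × (Fin 3 → K)}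
    (hd : (chartMatrix i j x.1 x.2).det ≠ 0) :
    ContinuousAt (fun x : (Fin 3 → K) × (Fin 3 → K) =>
      flag bB (toGL (chartMatrix i j x.1 x.2))) x :=
  QuotientGroup.continuous_mk.continuousAt.comp
    (ContinuousAt.comp (f := fun x : (Fin 3 → K) × (Fin 3 → K) => chartMatrix i j x.1 x.2)
      (continuousAt_toGL hd) (continuous_chartMatrix i j).continuousAt)

theorem exists_smul_norm_le {p : Fin 3 → K} (hp : p ≠ 0) :
    ∃ c : K, c ≠ 0 ∧ ∃ i, (c • p) i = 1 ∧ ∀ j, LocalNorm.v ((c • p) j) ≤ 1 := by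
  obtain ⟨i, hi⟩ := Finite.exists_max fun i => LocalNorm.v (p i)
  have hpi : p i ≠ 0 := by
    intro h0
    refine hp (funext fun j => ?_)
    have := hi j
    rw [h0, map_zero] at this
    exact (LocalNorm.v.nonpos_iff).1 this
  refine ⟨(p i)⁻¹, inv_ne_zero hpi, i, inv_mul_cancel₀ hpi, fun j => ?_⟩
  rw [Pi.smul_apply, smul_eq_mul, map_mul, map_inv₀]
  exact (inv_mul_le_one₀ (LocalNorm.v.pos hpi)).2 (hi j)

/-- After rescaling, the point and the line of a flag have coordinates of norm at most 1, one of
them equal to 1. Such pairs form nine compact sets `C i j`, whose images under the continuous charts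
cover everything. -/
instance : CompactSpace (Flag K bB) := by
  let C : Fin 3 → Fin 3 → Set ((Fin 3 → K) × (Fin 3 → K)) := fun i j =>
    (Set.univ.pi (fun _ => {x | LocalNorm.v x ≤ 1}) ×ˢ
      Set.univ.pi (fun _ => {x | LocalNorm.v x ≤ 1})) ∩
      {x | x.1 i = 1 ∧ x.2 j = 1 ∧ x.2 ⬝ᵥ x.1 = 0}
  have hC : ∀ i j, IsCompact (C i j) := by
    intro i j
    refine ((isCompact_univ_pi fun _ => LocalNorm.isCompact_ball 1).prod
      (isCompact_univ_pi fun _ => LocalNorm.isCompact_ball 1)).inter_right ?_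
    refine (isClosed_eq (by fun_prop) (by fun_prop)).inter
      ((isClosed_eq (by fun_prop) (by fun_prop)).inter (isClosed_eq ?_ (by fun_prop)))
    exact Continuous.dotProduct continuous_snd continuous_fst
  have hI : ∀ i j, IsCompact (Set.image (fun x : (Fin 3 → K) × (Fin 3 → K) =>
      flag bB (toGL (chartMatrix i j x.1 x.2))) (C i j)) := by
    intro i j
    refine (hC i j).image_of_continuousOn fun x hx => ContinuousAt.continuousWithinAt ?_
    have hd : (chartMatrix i j x.1 x.2).det ≠ 0 := by
      rw [det_chartMatrix i j hx.2.2.2, hx.2.1, hx.2.2.1]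
      simp
    exact continuousAt_flag_chart hd
  refine ⟨(isCompact_iUnion fun i => isCompact_iUnion fun j => hI i j).of_isClosed_subset
    isClosed_univ ?_⟩
  intro x _
  induction x using QuotientGroup.induction_on with
  | H g =>
    obtain ⟨c, hc, i, hi, hi'⟩ := exists_smul_norm_le (isPoint_col g).ne_zero
    obtain ⟨d, hd, j, hj, hj'⟩ := exists_smul_norm_le (isLine_row g).1
    have hp := (isPoint_col g).smul hc
    have hr := (isLine_row g).smul hd
    have h0 := hp.dotProduct_eq_zero hr
    refine Set.mem_iUnion.2 ⟨i, Set.mem_iUnion.2 ⟨j, ⟨(c • g.1.col 0, d • (g⁻¹).1.row 2),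
      ⟨⟨fun k _ => hi' k, fun k _ => hj' k⟩, hi, hj, h0⟩, ?_⟩⟩⟩
    have hdet : (chartMatrix i j (c • g.1.col 0) (d • (g⁻¹).1.row 2)).det ≠ 0 := by
      rw [det_chartMatrix i j h0, hi, hj]
      simp
    obtain ⟨h1, h2⟩ := isPoint_isLine_chart (g := toGL _) h0 (by rw [hj]; exact one_ne_zero)
      (coe_toGL hdet)
    exact flag_bB_eq (h1.flag_eq hp) (h2.flag_eq hr)

theorem compactSpace_flag {b : Fin 3 → ℕ} (hb : parabolic K bB ≤ parabolic K b) :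
    CompactSpace (Flag K b) := by
  have hc : Continuous (Subgroup.quotientMapOfLE hb) :=
    (QuotientGroup.isQuotientMap_mk _).continuous_iff.2 QuotientGroup.continuous_mk
  have hs : Function.Surjective (Subgroup.quotientMapOfLE hb) := by
    intro x
    induction x using QuotientGroup.induction_on with
    | H g => exact ⟨flag bB g, rfl⟩
  exact hs.compactSpace hc

theorem mem_ccInf {X R : Type*} [TopologicalSpace X] [CompactSpace X] [CommRing R] {f : X → R} :
    f ∈ CcInf X R ↔ IsLocallyConstant f :=
  ⟨fun h => h.1, fun h => ⟨h, HasCompactSupport.of_compactSpace f⟩⟩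

/-- Compactness makes local constancy uniform: one neighbourhood of 1 works for all flags. It serves
at the points where the chart argument of `eventually_pairVal` breaks down, and again for
smoothness. -/
theorem eventually_smul_eq {R : Type*} {f : Flag K bB → R} (hf : IsLocallyConstant f) :
    ∀ᶠ w in 𝓝 (1 : GL (Fin 3) K), ∀ x, f (w • x) = f x := by
  have h := (isCompact_univ (X := Flag K bB)).eventually_forall_of_forall_eventually
    (x₀ := (1 : GL (Fin 3) K)) (P := fun w x => f (w • x) = f x) ?_
  · exact h.mono fun w hw x => hw x trivial
  · intro x _
    have h1 : Continuous fun z : GL (Fin 3) K × Flag K bB => z.1 • z.2 := continuous_smul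
    have h2 := (hf.comp_continuous h1).eventually_eq (1, x)
    have h3 := (hf.comp_continuous (continuous_snd (X := GL (Fin 3) K))).eventually_eq (1, x)
    filter_upwards [h2, h3] with z hz hz'
    simp only [Function.comp_apply, one_smul] at hz hz'
    rw [hz, hz']

/-- A chart that is valid at (p, r) stays valid at nearby incident pairs, and the flag depends
continuously on the pair there. -/
theorem eventually_pairVal {R : Type*} [CommRing R] {f : Flag K bB → R} (hf : IsLocallyConstant f)
    {p r : Fin 3 → K} (hp : p ≠ 0) (hr : r ≠ 0) (h : r ⬝ᵥ p = 0) :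
    ∀ᶠ x in 𝓝 (p, r), x.2 ⬝ᵥ x.1 = 0 → pairVal f x.1 x.2 = pairVal f p r := by
  obtain ⟨i, hi⟩ : ∃ i, p i ≠ 0 := Function.ne_iff.1 hp
  obtain ⟨j, hj⟩ : ∃ j, r j ≠ 0 := Function.ne_iff.1 hr
  have hd : (chartMatrix i j p r).det ≠ 0 := by
    rw [det_chartMatrix i j h]; exact mul_ne_zero hi hj
  have hc : ContinuousAt (fun x : (Fin 3 → K) × (Fin 3 → K) =>
      flag bB (toGL (chartMatrix i j x.1 x.2))) (p, r) :=
    continuousAt_flag_chart (x := (p, r)) hd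
  have key : ∀ x : (Fin 3 → K) × (Fin 3 → K), x.2 ⬝ᵥ x.1 = 0 → x.1 i ≠ 0 → x.2 j ≠ 0 →
      pairVal f x.1 x.2 = f (flag bB (toGL (chartMatrix i j x.1 x.2))) := by
    intro x h0 h1 h2
    have hd : (chartMatrix i j x.1 x.2).det ≠ 0 := by
      rw [det_chartMatrix i j h0]; exact mul_ne_zero h1 h2
    obtain ⟨h3, h4⟩ := isPoint_isLine_chart h0 h2 (coe_toGL hd)
    exact pairVal_eq f h3 h4
  have e1 : ∀ᶠ x : (Fin 3 → K) × (Fin 3 → K) in 𝓝 (p, r), x.1 i ≠ 0 :=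
    (((continuous_apply i).comp continuous_fst).continuousAt (x := (p, r))).eventually_ne hi
  have e2 : ∀ᶠ x : (Fin 3 → K) × (Fin 3 → K) in 𝓝 (p, r), x.2 j ≠ 0 :=
    (((continuous_apply j).comp continuous_snd).continuousAt (x := (p, r))).eventually_ne hj
  have e3 : ∀ᶠ x : (Fin 3 → K) × (Fin 3 → K) in 𝓝 (p, r),
      f (flag bB (toGL (chartMatrix i j x.1 x.2))) = f (flag bB (toGL (chartMatrix i j p r))) :=
    hc.eventually (hf.eventually_eq _)
  have e4 := key (p, r) h hi hj
  filter_upwards [e1, e2, e3] with x h1 h2 h3 h0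
  rw [key x h0 h1 h2, h3]
  exact e4.symm

end FlagCompact

/-! ### The decomposition of functions on the flag variety along the big cell -/

section Decomposition

variable {K : Type*} [Field K] {R : Type*} [CommRing R]

theorem IsPoint.of_flag_bB_eq {g g' : GL (Fin 3) K} {p : Fin 3 → K} (h : IsPoint g p)
    (hg : flag bB g = flag bB g') : IsPoint g' p :=
  h.of_flag_eq (congrArg (Subgroup.quotientMapOfLE (borel_le_12 K)) hg)

theorem IsLine.of_flag_bB_eq {g g' : GL (Fin 3) K} {r : Fin 3 → K} (h : IsLine g r)
    (hg : flag bB g = flag bB g') : IsLine g' r :=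
  h.of_flag_eq (congrArg (Subgroup.quotientMapOfLE (borel_le_21 K)) hg)

theorem IsPoint.exists_smul {g : GL (Fin 3) K} {p p' : Fin 3 → K} (h : IsPoint g p)
    (h' : IsPoint g p') : ∃ c : K, c ≠ 0 ∧ p = c • p' := by
  obtain ⟨c, hc, rfl⟩ := h
  obtain ⟨d, hd, rfl⟩ := h'
  exact ⟨c * d⁻¹, mul_ne_zero hc (inv_ne_zero hd), by
    rw [smul_smul, mul_assoc, inv_mul_cancel₀ hd, mul_one]⟩

/-- The function of the point in the decomposition of `f`. -/
def pointPart (f : Flag K bB → R) (p : Fin 3 → K) : R :=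
  open Classical in
  if p 0 = 0 ∧ p 1 = 0 then 0
  -- `![p 1, -p 0, 0]` is the line joining p to the fixed point `![0, 0, 1]`. The two values agree
  -- when p is close to the fixed point, which is why 0 is the right value there.
  else pairVal f p ![p 1, -p 0, 0] - pairVal f ![0, 0, 1] ![p 1, -p 0, 0]

/-- The function of the line in the decomposition of `f`. -/
def linePart (f : Flag K bB → R) (r : Fin 3 → K) : R :=
  open Classical in
  if r 1 = 0 ∧ r 2 = 0 then 0
  -- Dually, `![0, r 2, -r 1]` is the intersection of r with the fixed line `![1, 0, 0]`.
  else pairVal f ![0, r 2, -r 1] r - pairVal f ![0, r 2, -r 1] ![1, 0, 0]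

theorem pointPart_smul (f : Flag K bB → R) (c : K) (p : Fin 3 → K) (hc : c ≠ 0) :
    pointPart f (c • p) = pointPart f p := by
  have h : ![(c • p) 1, -(c • p) 0, 0] = c • ![p 1, -p 0, 0] := by simp
  unfold pointPart
  rw [h, pairVal_smul_left f hc, pairVal_smul_right f hc, pairVal_smul_right f hc]
  congr 1
  simp [hc]

theorem linePart_smul (f : Flag K bB → R) (c : K) (r : Fin 3 → K) (hc : c ≠ 0) :
    linePart f (c • r) = linePart f r := by
  have h : ![0, (c • r) 2, -(c • r) 1] = c • ![0, r 2, -r 1] := by simp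
  unfold linePart
  rw [h, pairVal_smul_left f hc, pairVal_smul_right f hc, pairVal_smul_left f hc]
  congr 1
  simp [hc]

theorem vec_eq_smul_two {p : Fin 3 → K} (h0 : p 0 = 0) (h1 : p 1 = 0) :
    p = p 2 • ![0, 0, 1] := by
  funext i
  fin_cases i <;> simp [h0, h1]

theorem vec_eq_smul_zero {p : Fin 3 → K} (h1 : p 1 = 0) (h2 : p 2 = 0) :
    p = p 0 • ![1, 0, 0] := by
  funext i
  fin_cases i <;> simp [h1, h2]

theorem vec_ne_zero_two : (![0, 0, 1] : Fin 3 → K) ≠ 0 := fun h => by simpa using congrFun h 2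

theorem vec_ne_zero_zero : (![1, 0, 0] : Fin 3 → K) ≠ 0 := fun h => by simpa using congrFun h 0

theorem lineThrough_ne_zero {p : Fin 3 → K} (h : ¬(p 0 = 0 ∧ p 1 = 0)) :
    (![p 1, -p 0, 0] : Fin 3 → K) ≠ 0 := fun h0 =>
  h ⟨by simpa using congrFun h0 1, by simpa using congrFun h0 0⟩

theorem pointOn_ne_zero {r : Fin 3 → K} (h : ¬(r 1 = 0 ∧ r 2 = 0)) :
    (![0, r 2, -r 1] : Fin 3 → K) ≠ 0 := fun h0 =>
  h ⟨by simpa using congrFun h0 2, by simpa using congrFun h0 1⟩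

/-- Off the big cell, `f` is the sum of its parts. -/
theorem eq_parts {f : Flag K bB → R} {p r : Fin 3 → K} (hp : p ≠ 0) (hr : r ≠ 0)
    (h : r ⬝ᵥ p = 0) (hD : p 0 = 0 ∨ r 2 = 0) :
    pairVal f p r = pointPart f p + linePart f r + pairVal f ![0, 0, 1] ![1, 0, 0] := by
  have h' : r 0 * p 0 + r 1 * p 1 + r 2 * p 2 = 0 := by
    rwa [dotProduct, Fin.sum_univ_three] at h
  -- Both cases telescope. If r passes through the fixed point z, then r joins p to z and meets the
  -- fixed line ℓ in z, so the parts are f(p, r) - f(z, r) and f(z, r) - f(z, ℓ). If p lies on ℓ,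
  -- they are f(p, ℓ) - f(z, ℓ) and f(p, r) - f(p, ℓ). The subcases below deal with p = z and r = ℓ,
  -- where a part is 0 by definition.
  unfold pointPart linePart
  by_cases hp' : p 0 = 0 ∧ p 1 = 0
  · have hp2 : p 2 ≠ 0 := fun h2 => hp (by rw [vec_eq_smul_two hp'.1 hp'.2, h2, zero_smul])
    have hr2 : r 2 = 0 := by
      rw [hp'.1, hp'.2] at h'
      simpa [hp2] using h'
    rw [if_pos hp', vec_eq_smul_two hp'.1 hp'.2, pairVal_smul_left f hp2, zero_add]
    by_cases hr' : r 1 = 0 ∧ r 2 = 0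
    · have hr0 : r 0 ≠ 0 := fun h2 => hr (by rw [vec_eq_smul_zero hr'.1 hr'.2, h2, zero_smul])
      rw [if_pos hr', vec_eq_smul_zero hr'.1 hr'.2, pairVal_smul_right f hr0, zero_add]
    · have hr1 : -r 1 ≠ 0 := fun h1 => hr' ⟨by simpa using h1, hr2⟩
      have : ![0, r 2, -r 1] = (-r 1) • ![0, 0, 1] := by simp [hr2]
      rw [if_neg hr', this, pairVal_smul_left f hr1, pairVal_smul_left f hr1]
      ring
  · rw [if_neg hp']
    by_cases hr' : r 1 = 0 ∧ r 2 = 0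
    · have hr0 : r 0 ≠ 0 := fun h2 => hr (by rw [vec_eq_smul_zero hr'.1 hr'.2, h2, zero_smul])
      have hp0 : p 0 = 0 := by
        rw [hr'.1, hr'.2] at h'
        simpa [hr0] using h'
      have hp1 : p 1 ≠ 0 := fun h1 => hp' ⟨hp0, h1⟩
      have : ![p 1, -p 0, 0] = p 1 • ![1, 0, 0] := by simp [hp0]
      rw [if_pos hr', vec_eq_smul_zero hr'.1 hr'.2, this, pairVal_smul_right f hr0,
        pairVal_smul_right f hp1, pairVal_smul_right f hp1]
      ring
    · rw [if_neg hr']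
      by_cases hr2 : r 2 = 0
      · have hr1 : r 1 ≠ 0 := fun h1 => hr' ⟨h1, hr2⟩
        have hp0 : p 0 ≠ 0 := by
          intro h0
          rw [h0, hr2] at h'
          exact hp' ⟨h0, by simpa [hr1] using h'⟩
        have e1 : ![p 1, -p 0, 0] = (-(p 0) / r 1) • r := by
          funext i
          fin_cases i
          · simp only [Fin.zero_eta, cons_val_zero, Pi.smul_apply, smul_eq_mul]
            rw [hr2] at h'
            field_simp
            linear_combination h'
          · simp [hr1]
          · simp [hr2]
        have e2 : ![0, r 2, -r 1] = (-r 1) • ![0, 0, 1] := by simp [hr2]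
        rw [e1, e2, pairVal_smul_left f (neg_ne_zero.2 hr1),
          pairVal_smul_left f (neg_ne_zero.2 hr1),
          pairVal_smul_right f (div_ne_zero (neg_ne_zero.2 hp0) hr1),
          pairVal_smul_right f (div_ne_zero (neg_ne_zero.2 hp0) hr1)]
        ring
      · have hp0 : p 0 = 0 := hD.resolve_right hr2
        have hp1 : p 1 ≠ 0 := fun h1 => hp' ⟨hp0, h1⟩
        have e1 : ![p 1, -p 0, 0] = p 1 • ![1, 0, 0] := by simp [hp0]
        have e2 : ![0, r 2, -r 1] = (r 2 / p 1) • p := by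
          funext i
          fin_cases i
          · simp [hp0]
          · simp [hp1]
          · simp only [Fin.reduceFinMk, cons_val, Pi.smul_apply, smul_eq_mul]
            rw [hp0] at h'
            field_simp
            linear_combination -h'
        rw [e1, e2, pairVal_smul_left f (div_ne_zero hr2 hp1),
          pairVal_smul_left f (div_ne_zero hr2 hp1), pairVal_smul_right f hp1,
          pairVal_smul_right f hp1]
        ring

end Decomposition

/-! ### Local constancy of the two parts. -/

section LocallyConstant

variable {K : Type*} [Field K] [TopologicalSpace K] [IsTopologicalRing K] [LocalNorm K]
  {R : Type*} [CommRing R] {f : Flag K bB → R}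

theorem eventually_pointPart (hf : IsLocallyConstant f) {p : Fin 3 → K} (hp : p ≠ 0) :
    ∀ᶠ q in 𝓝 p, pointPart f q = pointPart f p := by
  by_cases hp' : p 0 = 0 ∧ p 1 = 0
  · have hp2 : p 2 ≠ 0 := fun h2 => hp (by rw [vec_eq_smul_two hp'.1 hp'.2, h2, zero_smul])
    have hval : pointPart f p = 0 := if_pos hp'
    -- Here p is the fixed point and the joining line is undefined in the limit. `A q` tends to 1,
    -- moves `![0, 0, 1]` to q / q₂ and preserves the line joining them, so `eventually_smul_eq`
    -- makes the two terms of `pointPart` equal.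
    let A : (Fin 3 → K) → Matrix (Fin 3) (Fin 3) K := fun q =>
      !![1, 0, q 0 / q 2; 0, 1, q 1 / q 2; 0, 0, 1]
    have hdet : ∀ q, (A q).det ≠ 0 := fun q => by simp [A, det_fin_three]
    have hA : ContinuousAt A p := by
      refine continuousAt_pi.2 fun i => continuousAt_pi.2 fun j => ?_
      have h2 : ∀ i, ContinuousAt (fun q : Fin 3 → K => q i / q 2) p := fun i =>
        (continuous_apply i).continuousAt.div (continuous_apply 2).continuousAt hp2
      fin_cases i <;> fin_cases j <;> first | exact continuousAt_const | exact h2 0 | exact h2 1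
    have hw : ContinuousAt (fun q => toGL (A q)) p :=
      ContinuousAt.comp (f := A) (continuousAt_toGL (hdet p)) hA
    have hw1 : toGL (A p) = 1 := by
      refine Units.ext ?_
      rw [coe_toGL (hdet p)]
      ext i j
      fin_cases i <;> fin_cases j <;> simp [A, hp'.1, hp'.2]
    have e1 : ∀ᶠ q in 𝓝 p, ∀ x, f (toGL (A q) • x) = f x := by
      have := eventually_smul_eq hf
      rw [← hw1] at this
      exact hw.eventually this
    filter_upwards [e1, (continuous_apply 2).continuousAt.eventually_ne hp2] with q h1 h2
    rw [hval]
    by_cases hq : q 0 = 0 ∧ q 1 = 0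
    · exact if_pos hq
    · rw [pointPart, if_neg hq, sub_eq_zero]
      obtain ⟨g, hg1, hg2⟩ := exists_isPoint_isLine (K := K) vec_ne_zero_two
        (lineThrough_ne_zero hq) (by simp)
      have h3 : IsPoint (toGL (A q) * g) q := by
        have h4 := (hg1.mul (toGL (A q))).smul h2
        rw [coe_toGL (hdet q)] at h4
        convert h4 using 1
        funext i
        fin_cases i <;> simp [A] <;> field_simp
      have h5 : IsLine (toGL (A q) * g) ![q 1, -q 0, 0] := by
        refine IsLine.mul _ ?_
        rw [coe_toGL (hdet q)]
        convert hg2 using 1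
        funext i
        fin_cases i <;> simp [A, vecMul, dotProduct, Fin.sum_univ_three]
        ring
      rw [pairVal_eq f h3 h5, pairVal_eq f hg1 hg2]
      exact h1 (flag bB g)
  · have hne : ∀ᶠ q in 𝓝 p, ¬(q 0 = 0 ∧ q 1 = 0) := by
      rw [not_and_or] at hp'
      rcases hp' with h | h
      · filter_upwards [(continuous_apply 0).continuousAt.eventually_ne h] with q hq h0
        exact hq h0.1
      · filter_upwards [(continuous_apply 1).continuousAt.eventually_ne h] with q hq h0
        exact hq h0.2
    have hl : Continuous fun q : Fin 3 → K => (![q 1, -q 0, 0] : Fin 3 → K) := by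
      refine continuous_pi fun i => ?_
      fin_cases i <;> simp <;> fun_prop
    have e1 : ∀ᶠ q : Fin 3 → K in 𝓝 p, ![q 1, -q 0, 0] ⬝ᵥ q = 0 →
        pairVal f q ![q 1, -q 0, 0] = pairVal f p ![p 1, -p 0, 0] :=
      (continuous_id.prodMk hl).continuousAt.eventually
        (eventually_pairVal hf hp (lineThrough_ne_zero hp')
          (by simp [dotProduct, Fin.sum_univ_three]; ring))
    have e2 : ∀ᶠ q : Fin 3 → K in 𝓝 p, ![q 1, -q 0, 0] ⬝ᵥ ![0, 0, 1] = 0 →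
        pairVal f ![0, 0, 1] ![q 1, -q 0, 0] = pairVal f ![0, 0, 1] ![p 1, -p 0, 0] :=
      ((continuous_const (y := ![0, 0, 1])).prodMk hl).continuousAt.eventually
        (eventually_pairVal hf vec_ne_zero_two (lineThrough_ne_zero hp') (by simp))
    filter_upwards [e1, e2, hne] with q h1 h2 h3
    rw [pointPart, pointPart, if_neg h3, if_neg hp', h2 (by simp),
      h1 (by simp [dotProduct, Fin.sum_univ_three]; ring)]

theorem eventually_linePart (hf : IsLocallyConstant f) {r : Fin 3 → K} (hr : r ≠ 0) :
    ∀ᶠ q in 𝓝 r, linePart f q = linePart f r := by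
  by_cases hr' : r 1 = 0 ∧ r 2 = 0
  · have hr0 : r 0 ≠ 0 := fun h2 => hr (by rw [vec_eq_smul_zero hr'.1 hr'.2, h2, zero_smul])
    have hval : linePart f r = 0 := if_pos hr'
    -- Dually, `A q` tends to 1, moves the fixed line to the line q and fixes their intersection.
    let A : (Fin 3 → K) → Matrix (Fin 3) (Fin 3) K := fun q =>
      !![1, -(q 1 / q 0), -(q 2 / q 0); 0, 1, 0; 0, 0, 1]
    have hdet : ∀ q, (A q).det ≠ 0 := fun q => by simp [A, det_fin_three]
    have hA : ContinuousAt A r := by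
      refine continuousAt_pi.2 fun i => continuousAt_pi.2 fun j => ?_
      have h2 : ∀ i, ContinuousAt (fun q : Fin 3 → K => -(q i / q 0)) r := fun i =>
        ((continuous_apply i).continuousAt.div (continuous_apply 0).continuousAt hr0).neg
      fin_cases i <;> fin_cases j <;> first | exact continuousAt_const | exact h2 1 | exact h2 2
    have hw : ContinuousAt (fun q => toGL (A q)) r :=
      ContinuousAt.comp (f := A) (continuousAt_toGL (hdet r)) hA
    have hw1 : toGL (A r) = 1 := by
      refine Units.ext ?_
      rw [coe_toGL (hdet r)]
      ext i j
      fin_cases i <;> fin_cases j <;> simp [A, hr'.1, hr'.2]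
    have e1 : ∀ᶠ q in 𝓝 r, ∀ x, f (toGL (A q) • x) = f x := by
      have := eventually_smul_eq hf
      rw [← hw1] at this
      exact hw.eventually this
    filter_upwards [e1, (continuous_apply 0).continuousAt.eventually_ne hr0] with q h1 h2
    rw [hval]
    by_cases hq : q 1 = 0 ∧ q 2 = 0
    · exact if_pos hq
    · rw [linePart, if_neg hq, sub_eq_zero]
      obtain ⟨g, hg1, hg2⟩ := exists_isPoint_isLine (K := K) (pointOn_ne_zero hq)
        vec_ne_zero_zero (by simp)
      have h3 : IsPoint (toGL (A q) * g) ![0, q 2, -q 1] := by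
        have h4 := hg1.mul (toGL (A q))
        rw [coe_toGL (hdet q)] at h4
        convert h4 using 1
        funext i
        fin_cases i <;> simp [A, mulVec, dotProduct, Fin.sum_univ_three]
        ring
      have h5 : IsLine (toGL (A q) * g) q := by
        refine IsLine.mul _ ?_
        rw [coe_toGL (hdet q)]
        convert hg2.smul h2 using 1
        funext i
        fin_cases i <;> simp [A, vecMul, dotProduct, Fin.sum_univ_three] <;> field_simp <;> ring
      rw [pairVal_eq f h3 h5, pairVal_eq f hg1 hg2]
      exact h1 (flag bB g)
  · have hne : ∀ᶠ q in 𝓝 r, ¬(q 1 = 0 ∧ q 2 = 0) := by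
      rw [not_and_or] at hr'
      rcases hr' with h | h
      · filter_upwards [(continuous_apply 1).continuousAt.eventually_ne h] with q hq h0
        exact hq h0.1
      · filter_upwards [(continuous_apply 2).continuousAt.eventually_ne h] with q hq h0
        exact hq h0.2
    have hl : Continuous fun q : Fin 3 → K => (![0, q 2, -q 1] : Fin 3 → K) := by
      refine continuous_pi fun i => ?_
      fin_cases i <;> simp <;> fun_prop
    have e1 : ∀ᶠ q : Fin 3 → K in 𝓝 r, q ⬝ᵥ ![0, q 2, -q 1] = 0 →
        pairVal f ![0, q 2, -q 1] q = pairVal f ![0, r 2, -r 1] r :=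
      (hl.prodMk continuous_id).continuousAt.eventually
        (eventually_pairVal hf (pointOn_ne_zero hr') hr
          (by simp [dotProduct, Fin.sum_univ_three]; ring))
    have e2 : ∀ᶠ q : Fin 3 → K in 𝓝 r, ![1, 0, 0] ⬝ᵥ ![0, q 2, -q 1] = 0 →
        pairVal f ![0, q 2, -q 1] ![1, 0, 0] = pairVal f ![0, r 2, -r 1] ![1, 0, 0] :=
      (hl.prodMk (continuous_const (y := ![1, 0, 0]))).continuousAt.eventually
        (eventually_pairVal hf (pointOn_ne_zero hr') vec_ne_zero_zero (by simp))
    filter_upwards [e1, e2, hne] with q h1 h2 h3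
    rw [linePart, linePart, if_neg h3, if_neg hr', h2 (by simp),
      h1 (by simp [dotProduct, Fin.sum_univ_three]; ring)]

theorem ofPoint_mem {φ : (Fin 3 → K) → R} (hφ : ∀ (c : K) p, c ≠ 0 → φ (c • p) = φ p)
    (h : ∀ p, p ≠ 0 → ∀ᶠ q in 𝓝 p, φ q = φ p) : ofPoint φ ∈ CcInf (Flag K b12) R := by
  have := compactSpace_flag (borel_le_12 K)
  refine mem_ccInf.2 (isLocallyConstant_of_comp_flag ?_)
  refine (IsLocallyConstant.iff_eventually_eq _).2 fun g => ?_
  have hc : Continuous fun g : GL (Fin 3) K => g.1.col 0 :=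
    continuous_pi fun i => Units.continuous_val.matrix_elem i 0
  filter_upwards [hc.continuousAt.eventually (h _ (isPoint_col g).ne_zero)] with g' hg'
  rw [ofPoint_flag hφ (isPoint_col g'), ofPoint_flag hφ (isPoint_col g), hg']

theorem ofLine_mem {φ : (Fin 3 → K) → R} (hφ : ∀ (c : K) p, c ≠ 0 → φ (c • p) = φ p)
    (h : ∀ p, p ≠ 0 → ∀ᶠ q in 𝓝 p, φ q = φ p) : ofLine φ ∈ CcInf (Flag K b21) R := by
  have := compactSpace_flag (borel_le_21 K)
  refine mem_ccInf.2 (isLocallyConstant_of_comp_flag ?_)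
  refine (IsLocallyConstant.iff_eventually_eq _).2 fun g => ?_
  have hc : Continuous fun g : GL (Fin 3) K => (g⁻¹).1.row 2 :=
    continuous_pi fun i => Units.continuous_coe_inv.matrix_elem 2 i
  filter_upwards [hc.continuousAt.eventually (h _ (isLine_row g).1)] with g' hg'
  rw [ofLine_flag hφ (isLine_row g'), ofLine_flag hφ (isLine_row g), hg']

end LocallyConstant

set_option linter.unnecessarySeqFocus false

/-! ### The big cell -/

section Cell

variable {K : Type*} [Field K]

variable (K) in
/-- The big cell: the flags in general position to the flag of `⟨e₂⟩ ⊆ ⟨e₁, e₂⟩`. -/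
def cell : Set (Flag K bB) := {x | x.out.1 0 0 ≠ 0 ∧ (x.out⁻¹).1 2 2 ≠ 0}

/-- The coordinates on the big cell. -/
def cellCoord (x : Flag K bB) : Fin 3 → K :=
  ![x.out.1 1 0 / x.out.1 0 0, -(x.out⁻¹).1 2 1 / (x.out⁻¹).1 2 2, x.out.1 2 0 / x.out.1 0 0]

theorem exists_out_eq {g : GL (Fin 3) K} {p r : Fin 3 → K} (hp : IsPoint g p) (hr : IsLine g r) :
    ∃ c d : K, c ≠ 0 ∧ d ≠ 0 ∧ (∀ i, p i = c * (flag bB g).out.1 i 0) ∧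
      ∀ i, r i = d * ((flag bB g).out⁻¹).1 2 i := by
  have h : flag bB g = flag bB (flag bB g).out := (QuotientGroup.out_eq' _).symm
  obtain ⟨c, hc, h1⟩ := (hp.of_flag_bB_eq h).exists_smul (isPoint_col _)
  obtain ⟨d, hd, h2⟩ := (hr.of_flag_bB_eq h).exists_smul (isLine_row _)
  exact ⟨c, d, hc, hd, fun i => congrFun h1 i, fun i => congrFun h2 i⟩

theorem flag_mem_cell {g : GL (Fin 3) K} {p r : Fin 3 → K} (hp : IsPoint g p) (hr : IsLine g r) :
    flag bB g ∈ cell K ↔ p 0 ≠ 0 ∧ r 2 ≠ 0 := by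
  obtain ⟨c, d, hc, hd, h1, h2⟩ := exists_out_eq hp hr
  rw [h1 0, h2 2, mul_ne_zero_iff_left hc, mul_ne_zero_iff_left hd]
  rfl

theorem cellCoord_flag {g : GL (Fin 3) K} {p r : Fin 3 → K} (hp : IsPoint g p)
    (hr : IsLine g r) : cellCoord (flag bB g) = ![p 1 / p 0, -r 1 / r 2, p 2 / p 0] := by
  obtain ⟨c, d, hc, hd, h1, h2⟩ := exists_out_eq hp hr
  rw [h1 0, h1 1, h1 2, h2 1, h2 2, mul_div_mul_left _ _ hc, mul_div_mul_left _ _ hc,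
    ← mul_neg, mul_div_mul_left _ _ hd]
  rfl

/-- Lower triangular unipotent matrices. -/
def lowerUnip (x : Fin 3 → K) : GL (Fin 3) K where
  val := !![1, 0, 0; x 0, 1, 0; x 2, x 1, 1]
  inv := !![1, 0, 0; -x 0, 1, 0; x 0 * x 1 - x 2, -x 1, 1]
  val_inv := by
    ext i j
    fin_cases i <;> fin_cases j <;> simp [Matrix.mul_apply, Fin.sum_univ_three] <;> ring
  inv_val := by
    ext i j
    fin_cases i <;> fin_cases j <;> simp [Matrix.mul_apply, Fin.sum_univ_three] <;> ring

/-- The parametrization of the big cell. -/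
def cellMap (x : Fin 3 → K) : Flag K bB := flag bB (lowerUnip x)

theorem isPoint_lowerUnip (x : Fin 3 → K) : IsPoint (lowerUnip x) ![1, x 0, x 2] := by
  refine ⟨1, one_ne_zero, ?_⟩
  funext i
  fin_cases i <;> simp [lowerUnip, Matrix.col]

theorem isLine_lowerUnip (x : Fin 3 → K) :
    IsLine (lowerUnip x) ![x 0 * x 1 - x 2, -x 1, 1] := by
  refine ⟨fun h => by simpa using congrFun h 2, ?_, ?_⟩ <;>
    simp [lowerUnip, vecMul, dotProduct, Fin.sum_univ_three] <;> ring

theorem cellMap_mem (x : Fin 3 → K) : cellMap x ∈ cell K :=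
  (flag_mem_cell (isPoint_lowerUnip x) (isLine_lowerUnip x)).2 ⟨by simp, by simp⟩

theorem cellCoord_cellMap (x : Fin 3 → K) : cellCoord (cellMap x) = x := by
  rw [cellMap, cellCoord_flag (isPoint_lowerUnip x) (isLine_lowerUnip x)]
  funext i
  fin_cases i <;> simp

theorem cellMap_cellCoord {x : Flag K bB} (hx : x ∈ cell K) : cellMap (cellCoord x) = x := by
  induction x using QuotientGroup.induction_on with
  | H g =>
    have hp := isPoint_col g
    have hr := isLine_row g
    have h0 := hp.dotProduct_eq_zero hr
    obtain ⟨hp0, hr2⟩ := (flag_mem_cell hp hr).1 hx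
    rw [cellCoord_flag hp hr]
    generalize g.1.col 0 = p at *
    generalize (g⁻¹).1.row 2 = r at *
    rw [dotProduct, Fin.sum_univ_three] at h0
    refine flag_bB_eq (IsPoint.flag_eq (p := p) ?_ hp) (IsLine.flag_eq (r := r) ?_ hr)
    · have h1 := (isPoint_lowerUnip ![p 1 / p 0, -r 1 / r 2, p 2 / p 0]).smul hp0
      convert h1 using 1
      funext i
      fin_cases i <;> simp <;> field_simp
    · have h1 := (isLine_lowerUnip ![p 1 / p 0, -r 1 / r 2, p 2 / p 0]).smul hr2
      convert h1 using 1
      funext i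
      fin_cases i <;> simp <;> field_simp
      linear_combination h0

end Cell

/-! ### Functions supported in the big cell as representatives of Steinberg classes. -/

section CellTopology

variable {K : Type*} [Field K] [TopologicalSpace K] [IsTopologicalRing K] [LocalNorm K]
  {R : Type*} [CommRing R]

theorem continuous_lowerUnip : Continuous (lowerUnip : (Fin 3 → K) → GL (Fin 3) K) := by
  refine Units.continuous_iff.2 ⟨?_, ?_⟩
  · refine continuous_matrix fun i j => ?_
    fin_cases i <;> fin_cases j <;> simp [lowerUnip] <;> fun_prop
  · refine continuous_matrix fun i j => ?_
    change Continuous fun x : Fin 3 → K =>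
      (!![1, 0, 0; -x 0, 1, 0; x 0 * x 1 - x 2, -x 1, 1] : Matrix (Fin 3) (Fin 3) K) i j
    fin_cases i <;> fin_cases j <;> simp <;> fun_prop

theorem continuous_cellMap : Continuous (cellMap : (Fin 3 → K) → Flag K bB) :=
  QuotientGroup.continuous_mk.comp continuous_lowerUnip

theorem continuous_coe_elem (i j : Fin 3) : Continuous fun g : GL (Fin 3) K => g.1 i j :=
  Units.continuous_val.matrix_elem i j

theorem continuous_inv_elem (i j : Fin 3) : Continuous fun g : GL (Fin 3) K => (g⁻¹).1 i j :=
  Units.continuous_coe_inv.matrix_elem i j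

theorem flag_mem_cell' (g : GL (Fin 3) K) :
    flag bB g ∈ cell K ↔ g.1 0 0 ≠ 0 ∧ (g⁻¹).1 2 2 ≠ 0 :=
  flag_mem_cell (p := g.1.col 0) (r := (g⁻¹).1.row 2) (isPoint_col g) (isLine_row g)

theorem cellCoord_flag' (g : GL (Fin 3) K) : cellCoord (flag bB g) =
    ![g.1 1 0 / g.1 0 0, -(g⁻¹).1 2 1 / (g⁻¹).1 2 2, g.1 2 0 / g.1 0 0] :=
  cellCoord_flag (isPoint_col g) (isLine_row g)

theorem isOpen_cell : IsOpen (cell K) := by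
  refine (QuotientGroup.isQuotientMap_mk _).isOpen_preimage.1 ?_
  have h : (QuotientGroup.mk ⁻¹' cell K : Set (GL (Fin 3) K)) =
      {g | g.1 0 0 ≠ 0} ∩ {g | (g⁻¹).1 2 2 ≠ 0} := Set.ext flag_mem_cell'
  rw [h]
  exact (isOpen_ne_fun (continuous_coe_elem 0 0) continuous_const).inter
    (isOpen_ne_fun (continuous_inv_elem 2 2) continuous_const)

theorem continuousAt_cellCoord {x : Flag K bB} (hx : x ∈ cell K) : ContinuousAt cellCoord x := by
  induction x using QuotientGroup.induction_on with
  | H g =>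
    obtain ⟨h1, h2⟩ := (flag_mem_cell' g).1 hx
    rw [ContinuousAt, QuotientGroup.nhds_eq, tendsto_map'_iff]
    have h : (cellCoord ∘ QuotientGroup.mk : GL (Fin 3) K → Fin 3 → K) = fun g =>
      ![g.1 1 0 / g.1 0 0, -(g⁻¹).1 2 1 / (g⁻¹).1 2 2, g.1 2 0 / g.1 0 0] :=
      funext cellCoord_flag'
    rw [h]
    change Tendsto _ _ (𝓝 (cellCoord (flag bB g)))
    rw [cellCoord_flag']
    refine continuousAt_pi.2 fun i => ?_
    fin_cases i
    · exact (continuous_coe_elem 1 0).continuousAt.div (continuous_coe_elem 0 0).continuousAt h1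
    · exact (continuous_inv_elem 2 1).continuousAt.neg.div
        (continuous_inv_elem 2 2).continuousAt h2
    · exact (continuous_coe_elem 2 0).continuousAt.div (continuous_coe_elem 0 0).continuousAt h1

/-- `cellCoord` is a left inverse, continuous on the cell. The lemma is needed to pull compact
supports back to affine space. -/
theorem isInducing_cellMap : IsInducing (cellMap : (Fin 3 → K) → Flag K bB) := by
  refine isInducing_iff_nhds.2 fun x => le_antisymm
    (map_le_iff_le_comap.1 continuous_cellMap.continuousAt) ?_
  have h : Tendsto cellCoord (𝓝 (cellMap x)) (𝓝 x) := by
    simpa only [ContinuousAt, cellCoord_cellMap] using continuousAt_cellCoord (cellMap_mem x)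
  intro s hs
  refine mem_comap.2 ⟨_, h hs, fun y hy => ?_⟩
  rwa [Set.mem_preimage, Set.mem_preimage, cellCoord_cellMap] at hy

variable (K R) in
/-- The functions supported in the big cell. -/
def cellFns : Submodule R (CcInf (Flag K bB) R) where
  carrier := {f | ∀ x, x ∉ cell K → f.1 x = 0}
  zero_mem' := fun _ _ => rfl
  add_mem' := fun {f g} hf hg x hx => by
    change f.1 x + g.1 x = 0
    rw [hf x hx, hg x hx, add_zero]
  smul_mem' := fun c f hf x hx => by
    change c * f.1 x = 0
    rw [hf x hx, mul_zero]

/-- Every function is the sum of a function supported in the big cell and of functions pulled back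
from the partial flag varieties. -/
theorem exists_cellFns (f : CcInf (Flag K bB) R) :
    ∃ f' ∈ cellFns K R, f - f' ∈ steinbergRel K R := by
  have hf : IsLocallyConstant f.1 := mem_ccInf.1 f.2
  have := compactSpace_flag (borel_le_12 K)
  -- The constant term of `eq_parts`, the value at the fixed flag, is put into the pullback from the
  -- space of points.
  let c : R := pairVal f.1 ![0, 0, 1] ![1, 0, 0]
  have hu : (fun x => ofPoint (pointPart f.1) x + c) ∈ CcInf (Flag K b12) R :=
    add_mem (ofPoint_mem (pointPart_smul f.1) fun p hp => eventually_pointPart hf hp)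
      (mem_ccInf.2 (IsLocallyConstant.const c))
  have hv : ofLine (linePart f.1) ∈ CcInf (Flag K b21) R :=
    ofLine_mem (linePart_smul f.1) fun p hp => eventually_linePart hf hp
  have pb : ∀ {b : Fin 3 → ℕ} (hb : parabolic K bB ≤ parabolic K b) (u : Flag K b → R)
      (_ : u ∈ CcInf (Flag K b) R), IsLocallyConstant fun x => u (Subgroup.quotientMapOfLE hb x) :=
    fun hb u hu => hu.1.comp_continuous
      ((QuotientGroup.isQuotientMap_mk _).continuous_iff.2 QuotientGroup.continuous_mk)
  let f1 : CcInf (Flag K bB) R := ⟨_, mem_ccInf.2 (pb (borel_le_12 K) _ hu)⟩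
  let f2 : CcInf (Flag K bB) R := ⟨_, mem_ccInf.2 (pb (borel_le_21 K) _ hv)⟩
  refine ⟨f - (f2 + f1), ?_, ?_⟩
  · intro x hx
    induction x using QuotientGroup.induction_on with
    | H g =>
      have hp := isPoint_col g
      have hr := isLine_row g
      rw [flag_mem_cell hp hr, not_and_or, not_not, not_not] at hx
      have h1 := eq_parts (f := f.1) hp.ne_zero hr.1 (hp.dotProduct_eq_zero hr) hx
      rw [pairVal_eq f.1 hp hr] at h1
      change f.1 (flag bB g) - (ofLine (linePart f.1) (flag b21 g) +
        (ofPoint (pointPart f.1) (flag b12 g) + c)) = 0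
      rw [h1, ofPoint_flag (pointPart_smul f.1) hp, ofLine_flag (linePart_smul f.1) hr]
      ring
  · rw [sub_sub_cancel]
    exact Submodule.add_mem_sup ⟨_, hv, rfl⟩ ⟨_, hu, rfl⟩

/-- A function supported in the big cell is determined by its class in the Steinberg module. -/
theorem eq_zero_of_mem_cellFns {f : CcInf (Flag K bB) R} (h : f ∈ cellFns K R)
    (h' : f ∈ steinbergRel K R) : f = 0 := by
  obtain ⟨f1, ⟨v, hv, hv'⟩, f2, ⟨u, hu, hu'⟩, hf⟩ := Submodule.mem_sup.1 h'
  have hval : ∀ g, f.1 (flag bB g) = v (flag b21 g) + u (flag b12 g) := by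
    intro g
    rw [← hf]
    change f1.1 _ + f2.1 _ = _
    rw [show v (flag b21 g) = f1.1 (flag bB g) from congrFun hv' (flag bB g),
      show u (flag b12 g) = f2.1 (flag bB g) from congrFun hu' (flag bB g)]
  have hzero : ∀ {g : GL (Fin 3) K} {p r : Fin 3 → K}, IsPoint g p → IsLine g r →
      (p 0 = 0 ∨ r 2 = 0) → v (flag b21 g) + u (flag b12 g) = 0 := by
    intro g p r hp hr hD
    rw [← hval]
    refine h _ ?_
    rw [flag_mem_cell hp hr, not_and_or, not_not, not_not]
    exact hD
  obtain ⟨g0, hp0, hr0⟩ := exists_isPoint_isLine (K := K) vec_ne_zero_two vec_ne_zero_zero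
    (by simp)
  have h0 := hzero hp0 hr0 (Or.inl (by simp))
  -- The joining line of a point p and the fixed point z gives two flags off the cell, with points p
  -- and z and the same line. Subtracting the two relations v + u = 0 gives u(p) = u(z), so u is
  -- constant; dually for v. The fixed flag then shows that the constants cancel.
  have hU : ∀ g : GL (Fin 3) K, u (flag b12 g) = u (flag b12 g0) := by
    intro g
    have hp := isPoint_col g
    by_cases hpp : g.1.col 0 0 = 0 ∧ g.1.col 0 1 = 0
    · have h2 : g.1.col 0 2 ≠ 0 := fun h2 =>
        hp.ne_zero (by rw [vec_eq_smul_two hpp.1 hpp.2, h2, zero_smul])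
      have h3 : IsPoint g0 (g.1.col 0) := by
        rw [vec_eq_smul_two hpp.1 hpp.2]; exact hp0.smul h2
      rw [hp.flag_eq h3]
    · obtain ⟨g1, hp1, hr1⟩ := exists_isPoint_isLine hp.ne_zero (lineThrough_ne_zero hpp)
        (by simp [dotProduct, Fin.sum_univ_three]; ring)
      obtain ⟨g2, hp2, hr2⟩ := exists_isPoint_isLine (K := K) vec_ne_zero_two
        (lineThrough_ne_zero hpp) (by simp)
      have e1 := hzero hp1 hr1 (Or.inr (by simp))
      have e2 := hzero hp2 hr2 (Or.inr (by simp))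
      rw [hp.flag_eq hp1, ← hp2.flag_eq hp0]
      rw [hr1.flag_eq hr2] at e1
      linear_combination e1 - e2
  have hV : ∀ g : GL (Fin 3) K, v (flag b21 g) = v (flag b21 g0) := by
    intro g
    have hr := isLine_row g
    by_cases hpp : (g⁻¹).1.row 2 1 = 0 ∧ (g⁻¹).1.row 2 2 = 0
    · have h2 : (g⁻¹).1.row 2 0 ≠ 0 := fun h2 =>
        hr.1 (by rw [vec_eq_smul_zero hpp.1 hpp.2, h2, zero_smul])
      have h3 : IsLine g0 ((g⁻¹).1.row 2) := by
        rw [vec_eq_smul_zero hpp.1 hpp.2]; exact hr0.smul h2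
      rw [hr.flag_eq h3]
    · obtain ⟨g1, hp1, hr1⟩ := exists_isPoint_isLine (pointOn_ne_zero hpp) hr.1
        (by simp [dotProduct, Fin.sum_univ_three]; ring)
      obtain ⟨g2, hp2, hr2⟩ := exists_isPoint_isLine (K := K) (pointOn_ne_zero hpp)
        vec_ne_zero_zero (by simp)
      have e1 := hzero hp1 hr1 (Or.inl (by simp))
      have e2 := hzero hp2 hr2 (Or.inl (by simp))
      rw [hr.flag_eq hr1, ← hr2.flag_eq hr0]
      rw [hp1.flag_eq hp2] at e1
      linear_combination e1 - e2
  refine Subtype.ext (funext fun x => ?_)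
  induction x using QuotientGroup.induction_on with
  | H g =>
    change f.1 (flag bB g) = 0
    rw [hval, hU, hV, h0]

/-- The restriction to the big cell, in coordinates. -/
theorem comp_cellMap_mem {f : CcInf (Flag K bB) R} (h : f ∈ cellFns K R) :
    (fun x => f.1 (cellMap x)) ∈ CcInf (Fin 3 → K) R := by
  have hf : IsLocallyConstant f.1 := f.2.1
  refine ⟨hf.comp_continuous continuous_cellMap, ?_⟩
  have hK : IsCompact {x | f.1 x ≠ 0} :=
    (hf.isOpen_fiber 0).isClosed_compl.isCompact
  have hK2 := isInducing_cellMap.isCompact_preimage' hK fun x hx => by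
    have hxc : x ∈ cell K := by
      by_contra hc
      exact hx (h x hc)
    exact ⟨_, cellMap_cellCoord hxc⟩
  exact HasCompactSupport.intro hK2 fun x hx => by simpa using hx

/-- The normalization 1 ≤ B allows B ≤ B * B and ε / B ≤ ε in later estimates. -/
theorem exists_bound {f : (Fin 3 → K) → R} (hf : HasCompactSupport f) :
    ∃ B : ℝ, 1 ≤ B ∧ ∀ x, f x ≠ 0 → ∀ i, LocalNorm.v (x i) ≤ B := by
  have h1 : ∀ i, ∃ B : ℝ, ∀ x ∈ tsupport f, LocalNorm.v (x i) ≤ B := by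
    intro i
    have hcov : tsupport f ⊆ ⋃ n : ℕ, {x | LocalNorm.v (x i) < n} := by
      intro x _
      obtain ⟨n, hn⟩ := exists_nat_gt (LocalNorm.v (x i))
      exact Set.mem_iUnion.2 ⟨n, hn⟩
    have hopen : ∀ n : ℕ, IsOpen {x : Fin 3 → K | LocalNorm.v (x i) < n} := by
      intro n
      rw [isOpen_iff_mem_nhds]
      intro x hx
      have hx : LocalNorm.v (x i) < n := hx
      have hn : (0 : ℝ) < n := (LocalNorm.v.nonneg _).trans_lt hx
      filter_upwards [(continuous_apply i).continuousAt.eventually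
        (LocalNorm.eventually_le (x i) (half_pos hn))] with y hy
      have h2 := LocalNorm.add_le_max (y i - x i) (x i)
      rw [sub_add_cancel] at h2
      exact h2.trans_lt (max_lt (by linarith) hx)
    obtain ⟨t, ht⟩ := hf.isCompact.elim_finite_subcover _ hopen hcov
    refine ⟨∑ n ∈ t, (n : ℝ), fun x hx => ?_⟩
    obtain ⟨n, hn, hxn⟩ := Set.mem_iUnion₂.1 (ht hx)
    exact (le_of_lt hxn).trans
      (Finset.single_le_sum (f := fun n : ℕ => (n : ℝ)) (fun _ _ => Nat.cast_nonneg _) hn)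
  choose B hB using h1
  refine ⟨max 1 (max (B 0) (max (B 1) (B 2))), le_max_left _ _, fun x hx i => ?_⟩
  refine (hB i x (subset_tsupport f hx)).trans ?_
  fin_cases i <;> simp

theorem eventually_lt_div {X : Type*} [TopologicalSpace X] {a b : X → K} {x : X}
    (ha : ContinuousAt a x) (hb : ContinuousAt b x) (hax : a x ≠ 0) (hbx : b x = 0) (B : ℝ) :
    ∀ᶠ y in 𝓝 x, b y ≠ 0 → B < LocalNorm.v (a y / b y) := by
  have hB : 0 < |B| + 1 := by positivity
  have hpos := LocalNorm.v.pos hax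
  have e2 := hb.eventually (LocalNorm.eventually_le (b x)
    (show 0 < LocalNorm.v (a x) / (|B| + 1) by positivity))
  filter_upwards [ha.eventually (LocalNorm.eventually_eq hax), e2] with y h1 h2 h3
  rw [hbx, sub_zero] at h2
  have hb' := LocalNorm.v.pos h3
  rw [map_div₀, h1, lt_div_iff₀ hb']
  rw [le_div_iff₀ hB] at h2
  calc B * LocalNorm.v (b y) < (|B| + 1) * LocalNorm.v (b y) := by
        refine mul_lt_mul_of_pos_right ?_ hb'
        linarith [le_abs_self B]
    _ ≤ _ := by rwa [mul_comm]

/-- Extension by zero from the big cell. -/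
def extendZero (h : (Fin 3 → K) → R) (x : Flag K bB) : R :=
  open Classical in if x ∈ cell K then h (cellCoord x) else 0

theorem extendZero_cellMap (h : (Fin 3 → K) → R) (x : Fin 3 → K) :
    extendZero h (cellMap x) = h x := by
  rw [extendZero, if_pos (cellMap_mem x), cellCoord_cellMap]

theorem extendZero_of_notMem (h : (Fin 3 → K) → R) {x : Flag K bB} (hx : x ∉ cell K) :
    extendZero h x = 0 := if_neg hx

theorem extendZero_mem {h : (Fin 3 → K) → R} (hh : h ∈ CcInf (Fin 3 → K) R) :
    extendZero h ∈ CcInf (Flag K bB) R := by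
  refine mem_ccInf.2 ((IsLocallyConstant.iff_eventually_eq _).2 fun x => ?_)
  by_cases hx : x ∈ cell K
  · filter_upwards [isOpen_cell.mem_nhds hx,
      (continuousAt_cellCoord hx).eventually (hh.1.eventually_eq _)] with y hy hy'
    rw [extendZero, extendZero, if_pos hx, if_pos hy, hy']
  · rw [extendZero_of_notMem h hx]
    obtain ⟨B, hB1, hB⟩ := exists_bound hh.2
    induction x using QuotientGroup.induction_on with
    | H g =>
      rw [QuotientGroup.nhds_eq, eventually_map]
      have hp := isPoint_col g
      have hr := isLine_row g
      -- Some coordinate exceeds the bound B on the support of h at every flag of the cell that is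
      -- close to a flag outside it. Hence the extension vanishes near the boundary.
      have key : ∀ᶠ y in 𝓝 g, flag bB y ∈ cell K →
          ∃ i, B < LocalNorm.v (cellCoord (flag bB y) i) := by
        rw [flag_mem_cell hp hr, not_and_or, not_not, not_not] at hx
        rcases hx with h0 | h0
        · by_cases h1 : g.1 1 0 = 0
          · have h2 : g.1 2 0 ≠ 0 := fun h2 => hp.ne_zero (by
              rw [vec_eq_smul_two h0 h1, show g.1.col 0 2 = 0 from h2, zero_smul])
            filter_upwards [eventually_lt_div (continuous_coe_elem 2 0).continuousAt
              (continuous_coe_elem 0 0).continuousAt h2 h0 B] with y hy hyc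
            refine ⟨2, ?_⟩
            rw [cellCoord_flag']
            exact hy ((flag_mem_cell' y).1 hyc).1
          · filter_upwards [eventually_lt_div (continuous_coe_elem 1 0).continuousAt
              (continuous_coe_elem 0 0).continuousAt h1 h0 B] with y hy hyc
            refine ⟨0, ?_⟩
            rw [cellCoord_flag']
            exact hy ((flag_mem_cell' y).1 hyc).1
        · by_cases h1 : (g⁻¹).1 2 1 = 0
          · have h2 : (g⁻¹).1 2 0 ≠ 0 := fun h2 => hr.1 (by
              rw [vec_eq_smul_zero (p := (g⁻¹).1.row 2) h1 h0,
                show (g⁻¹).1.row 2 0 = 0 from h2, zero_smul])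
            -- Only r₀ / r₂ is known to grow here. In coordinates it is x₀ x₁ - x₂, so a bound B on
            -- all three coordinates would bound it by B * B.
            filter_upwards [eventually_lt_div (continuous_inv_elem 2 0).continuousAt
              (continuous_inv_elem 2 2).continuousAt h2 h0 (B * B)] with y hy hyc
            by_contra! hcon
            obtain ⟨hy1, hy2⟩ := (flag_mem_cell' y).1 hyc
            have h3 := hy hy2
            have h4 := (isPoint_col y).dotProduct_eq_zero (isLine_row y)
            rw [dotProduct, Fin.sum_univ_three] at h4
            have h5 : (y⁻¹).1 2 0 / (y⁻¹).1 2 2 =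
                cellCoord (flag bB y) 0 * cellCoord (flag bB y) 1 - cellCoord (flag bB y) 2 := by
              rw [cellCoord_flag']
              change _ = y.1 1 0 / y.1 0 0 * (-(y⁻¹).1 2 1 / (y⁻¹).1 2 2) - y.1 2 0 / y.1 0 0
              have h4' : (y⁻¹).1 2 0 * y.1 0 0 + (y⁻¹).1 2 1 * y.1 1 0 +
                (y⁻¹).1 2 2 * y.1 2 0 = 0 := h4
              generalize (y⁻¹).1 2 0 = a0 at *
              generalize (y⁻¹).1 2 1 = a1 at *
              generalize (y⁻¹).1 2 2 = a2 at *
              field_simp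
              linear_combination h4'
            rw [h5] at h3
            have h6 := LocalNorm.sub_le_max
              (cellCoord (flag bB y) 0 * cellCoord (flag bB y) 1) (cellCoord (flag bB y) 2)
            rw [map_mul] at h6
            have h7 : LocalNorm.v (cellCoord (flag bB y) 0) * LocalNorm.v (cellCoord (flag bB y) 1)
                ≤ B * B :=
              mul_le_mul (hcon 0) (hcon 1) (LocalNorm.v.nonneg _) (by linarith)
            have h8 : LocalNorm.v (cellCoord (flag bB y) 2) ≤ B * B :=
              (hcon 2).trans (by nlinarith)
            exact absurd (h3.trans_le h6) (not_lt.2 (max_le h7 h8))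
          · filter_upwards [eventually_lt_div (continuous_inv_elem 2 1).neg.continuousAt
              (continuous_inv_elem 2 2).continuousAt (neg_ne_zero.2 h1) h0 B] with y hy hyc
            refine ⟨1, ?_⟩
            rw [cellCoord_flag']
            exact hy ((flag_mem_cell' y).1 hyc).2
      filter_upwards [key] with y hy
      by_cases hyc : flag bB y ∈ cell K
      · obtain ⟨i, hi⟩ := hy hyc
        change extendZero h (flag bB y) = 0
        rw [extendZero, if_pos hyc]
        by_contra hne
        exact absurd (hB _ hne i) (not_le.2 hi)
      · exact extendZero_of_notMem h hyc

theorem extendZero_mem_cellFns {h : (Fin 3 → K) → R} (hh : h ∈ CcInf (Fin 3 → K) R) :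
    (⟨extendZero h, extendZero_mem hh⟩ : CcInf (Flag K bB) R) ∈ cellFns K R :=
  fun _ hx => extendZero_of_notMem h hx

end CellTopology

/-! ### Functoriality of the Steinberg module -/

section CellSection

variable {K : Type*} [Field K] [TopologicalSpace K] [IsTopologicalRing K] [LocalNorm K]
  {R : Type*} [CommRing R]

/-- Together with `eq_of_mk_eq` this replaces classes by unique functions on the cell, on which the
later arguments about Steinberg modules are carried out. -/
theorem exists_cellFns_mk (v : Steinberg K R) :
    ∃ f ∈ cellFns K R, (Submodule.Quotient.mk f : Steinberg K R) = v := by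
  induction v using Submodule.Quotient.induction_on with
  | H f =>
    obtain ⟨f', hf', h⟩ := exists_cellFns f
    exact ⟨f', hf', ((Submodule.Quotient.eq _).2 h).symm⟩

theorem eq_of_mk_eq {f g : CcInf (Flag K bB) R} (hf : f ∈ cellFns K R) (hg : g ∈ cellFns K R)
    (h : (Submodule.Quotient.mk f : Steinberg K R) = Submodule.Quotient.mk g) : f = g :=
  sub_eq_zero.1 (eq_zero_of_mem_cellFns (sub_mem hf hg) ((Submodule.Quotient.eq _).1 h))

end CellSection

/-! ### Restriction from flags over E to flags over F. -/

section Restriction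

variable (F E : Type*) [Field F] [Field E] [Algebra F E]

/-- The map of flag varieties given by an extension of fields. -/
def flagMap (b : Fin 3 → ℕ) : Flag F b → Flag E b :=
  Quotient.map' (GeneralLinearGroup.map (algebraMap F E)) <| by
    intro g h hgh
    rw [QuotientGroup.leftRel_apply] at hgh ⊢
    rw [← map_inv, ← map_mul]
    intro i j hij
    rw [GeneralLinearGroup.map_apply, hgh hij, map_zero]

theorem flagMap_smul {b : Fin 3 → ℕ} (g : GL (Fin 3) F) (x : Flag F b) :
    flagMap F E b (g • x) = GeneralLinearGroup.map (algebraMap F E) g • flagMap F E b x := by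
  induction x using QuotientGroup.induction_on with
  | H x => exact congrArg QuotientGroup.mk (map_mul _ g x)

theorem flagMap_mem_cell {x : Flag F bB} : flagMap F E bB x ∈ cell E ↔ x ∈ cell F := by
  induction x using QuotientGroup.induction_on with
  | H g =>
    have h1 : flagMap F E bB (flag bB g) = flag bB (GeneralLinearGroup.map (algebraMap F E) g) :=
      rfl
    change flagMap F E bB (flag bB g) ∈ cell E ↔ flag bB g ∈ cell F
    rw [h1, flag_mem_cell (p := (GeneralLinearGroup.map (algebraMap F E) g).1.col 0)
      (r := ((GeneralLinearGroup.map (algebraMap F E) g)⁻¹).1.row 2) (isPoint_col _) (isLine_row _),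
      flag_mem_cell (p := g.1.col 0) (r := (g⁻¹).1.row 2) (isPoint_col _) (isLine_row _),
      ← map_inv]
    exact and_congr (map_ne_zero (algebraMap F E)) (map_ne_zero (algebraMap F E))

theorem flagMap_cellMap (x : Fin 3 → F) :
    flagMap F E bB (cellMap x) = cellMap fun i => algebraMap F E (x i) := by
  refine congrArg QuotientGroup.mk ?_
  ext i j
  fin_cases i <;> fin_cases j <;> simp [lowerUnip]

variable [TopologicalSpace F] [IsTopologicalRing F] [LocalNorm F]
  [TopologicalSpace E] [IsTopologicalRing E] [ContinuousSMul F E]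

theorem continuous_flagMap (b : Fin 3 → ℕ) : Continuous (flagMap F E b) := by
  have hσ : Continuous (algebraMap F E) := continuous_algebraMap F E
  refine Continuous.quotient_map' ?_ _
  refine Units.continuous_iff.2 ⟨?_, ?_⟩
  · exact Units.continuous_val.matrix_map hσ
  · exact Units.continuous_coe_inv.matrix_map hσ

variable {R S : Type*} [CommRing R] [CommRing S] (φ : R →+* S)

/-- Restriction of functions along an extension of fields, combined with a change of
coefficients. -/
def ccMap (b : Fin 3 → ℕ) [CompactSpace (Flag F b)] :
    CcInf (Flag E b) R →ₛₗ[φ] CcInf (Flag F b) S where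
  toFun f := ⟨fun x => φ (f.1 (flagMap F E b x)),
    mem_ccInf.2 ((f.2.1.comp_continuous (continuous_flagMap F E b)).comp φ)⟩
  map_add' f g := by ext x; exact map_add φ _ _
  map_smul' c f := by ext x; exact map_mul φ _ _

theorem ccMap_mem_pulledBack {b : Fin 3 → ℕ} (hE : parabolic E bB ≤ parabolic E b)
    (hF : parabolic F bB ≤ parabolic F b) {f : CcInf (Flag E bB) R}
    (hf : f ∈ pulledBack E R hE) : ccMap F E φ bB f ∈ pulledBack F S hF := by
  have := compactSpace_flag hF
  obtain ⟨u, hu, huf⟩ := hf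
  refine ⟨ccMap F E φ b ⟨u, hu⟩, Subtype.property _, ?_⟩
  funext x
  induction x using QuotientGroup.induction_on with
  | H x => exact congrArg φ (congrFun huf (flagMap F E bB (flag bB x)))

/-- The restriction of Steinberg modules along an extension of fields, combined with a change of
coefficients. -/
def steinbergMap : Steinberg E R →ₛₗ[φ] Steinberg F S :=
  (steinbergRel E R).liftQ ((steinbergRel F S).mkQ.comp (ccMap F E φ bB)) <| by
    refine sup_le ?_ ?_
    · intro f hf
      exact (Submodule.Quotient.mk_eq_zero _).2
        ((le_sup_left : _ ≤ steinbergRel F S) (ccMap_mem_pulledBack F E φ _ _ hf))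
    · intro f hf
      exact (Submodule.Quotient.mk_eq_zero _).2
        ((le_sup_right : _ ≤ steinbergRel F S) (ccMap_mem_pulledBack F E φ _ _ hf))

theorem steinbergMap_mk (f : CcInf (Flag E bB) R) :
    steinbergMap F E φ (Submodule.Quotient.mk f) = Submodule.Quotient.mk (ccMap F E φ bB f) :=
  rfl

theorem steinbergMap_rep (g : GL (Fin 3) F) (v : Steinberg E R) :
    steinbergMap F E φ (steinbergRep E R (GeneralLinearGroup.map (algebraMap F E) g) v) =
      steinbergRep F S g (steinbergMap F E φ v) := by
  induction v using Submodule.Quotient.induction_on with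
  | H f =>
    refine congrArg (Submodule.Quotient.mk (p := steinbergRel F S)) ?_
    ext x
    refine congrArg (fun y => φ (f.1 y)) ?_
    change (GeneralLinearGroup.map (algebraMap F E) g)⁻¹ • flagMap F E bB x =
      flagMap F E bB (g⁻¹ • x)
    rw [flagMap_smul, map_inv]

/-- The Galois group fixes the F-rational flags. -/
theorem steinbergMap_gal [IsModuleTopology F E] (σ : E ≃ₐ[F] E) (v : Steinberg E R) :
    steinbergMap F E φ (steinbergGal F E R σ v) = steinbergMap F E φ v := by
  induction v using Submodule.Quotient.induction_on with
  | H f =>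
    refine congrArg (Submodule.Quotient.mk (p := steinbergRel F S)) ?_
    ext x
    refine congrArg (fun y => φ (f.1 y)) ?_
    change galFlag F E bB σ⁻¹ (flagMap F E bB x) = flagMap F E bB x
    induction x using QuotientGroup.induction_on with
    | H x =>
      refine congrArg QuotientGroup.mk ?_
      ext i j
      exact (σ⁻¹).commutes _

theorem ccMap_mem_cellFns [LocalNorm E] {f : CcInf (Flag E bB) R} (hf : f ∈ cellFns E R) :
    ccMap F E φ bB f ∈ cellFns F S := by
  intro x hx
  change φ (f.1 (flagMap F E bB x)) = 0
  rw [hf _ (fun h => hx ((flagMap_mem_cell F E).1 h)), map_zero]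

end Restriction

/-! ### The lattice -/

section Lattice

variable (K : Type*) [Field K] [TopologicalSpace K] [IsTopologicalRing K] [LocalNorm K]

/-- Change of coefficients preserves support in the cell, where a function is determined by its
class; so the question is about values only. -/
theorem steinbergCoeff_injective {R S : Type*} [CommRing R] [CommRing S] [Algebra R S]
    (h : Function.Injective (algebraMap R S)) : Function.Injective (steinbergCoeff K R S) := by
  refine (injective_iff_map_eq_zero _).2 fun v hv => ?_
  obtain ⟨f, hf, rfl⟩ := exists_cellFns_mk v
  have h1 : ccCoeff (Flag K bB) R S f ∈ cellFns K S := fun x hx => by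
    change algebraMap R S (f.1 x) = 0
    rw [hf x hx, map_zero]
  have h2 := eq_zero_of_mem_cellFns h1 ((Submodule.Quotient.mk_eq_zero _).1 hv)
  have h3 : f = 0 := by
    refine Subtype.ext (funext fun x => ?_)
    have h4 : algebraMap R S (f.1 x) = 0 := congrFun (congrArg Subtype.val h2) x
    exact (injective_iff_map_eq_zero _).1 h _ h4
  rw [h3]
  rfl

theorem steinbergCoeff_rep {R S : Type*} [CommRing R] [CommRing S] [Algebra R S]
    (g : GL (Fin 3) K) (v : Steinberg K R) :
    steinbergCoeff K R S (steinbergRep K R g v) = steinbergRep K S g (steinbergCoeff K R S v) := by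
  induction v using Submodule.Quotient.induction_on with
  | H f => rfl

theorem steinbergCoeff_gal {F : Type*} [Field F] [Algebra F K] [TopologicalSpace F]
    [IsTopologicalRing F] [IsModuleTopology F K] {R S : Type*} [CommRing R] [CommRing S]
    [Algebra R S] (σ : K ≃ₐ[F] K) (v : Steinberg K R) :
    steinbergCoeff K R S (steinbergGal F K R σ v) =
      steinbergGal F K S σ (steinbergCoeff K R S v) := by
  induction v using Submodule.Quotient.induction_on with
  | H f => rfl

variable (l : ℕ) [Fact l.Prime]

theorem norm_natCast_lt_one : ‖((l : ℕ) : Qbar l)‖ < 1 := by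
  have h2 : ((l : ℕ) : Qbar l) = algebraMap ℚ_[l] (Qbar l) (l : ℚ_[l]) := by simp
  rw [h2, PadicAlgCl.norm_extends, Padic.norm_p]
  exact inv_lt_one_of_one_lt₀ (by exact_mod_cast (Fact.out : l.Prime).one_lt)

/-- Every element of `Qbar l` becomes integral after multiplication by a power of `l`. -/
theorem exists_pow_mul_mem (x : Qbar l) : ∃ n : ℕ, ∀ m, n ≤ m → (l : Qbar l) ^ m * x ∈ Zbar l := by
  have h : Tendsto (fun n : ℕ => ‖(l : Qbar l)‖ ^ n * ‖x‖) atTop (𝓝 (0 * ‖x‖)) :=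
    (tendsto_pow_atTop_nhds_zero_of_lt_one (norm_nonneg _) (norm_natCast_lt_one l)).mul_const _
  rw [zero_mul] at h
  obtain ⟨n, hn⟩ := eventually_atTop.1 (h.eventually_le_const one_pos)
  refine ⟨n, fun m hm => ?_⟩
  refine (isIntegral_iff_norm_le_one l _).2 ?_
  rw [norm_mul, norm_pow]
  exact hn m hm

theorem natCast_ne_zero : ((l : ℕ) : Qbar l) ≠ 0 := by
  exact_mod_cast (Fact.out : l.Prime).ne_zero

/-- A locally constant function on the compact flag variety has finitely many values, so a single
power of l makes all of them integral. -/
theorem exists_pow_smul_mem_range (v : Steinberg K (Qbar l)) :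
    ∃ n : ℕ, ((l : Qbar l) ^ n) • v ∈ LinearMap.range (steinbergCoeff K (Zbar l) (Qbar l)) := by
  induction v using Submodule.Quotient.induction_on with
  | H f =>
    have hfin := f.2.1.range_finite
    choose N hN using exists_pow_mul_mem l
    refine ⟨∑ y ∈ hfin.toFinset, N y, ?_⟩
    have hintegral : ∀ x, (l : Qbar l) ^ (∑ y ∈ hfin.toFinset, N y) * f.1 x ∈ Zbar l := fun x =>
      hN _ _ (Finset.single_le_sum (f := N) (fun _ _ => Nat.zero_le _)
        (hfin.mem_toFinset.2 ⟨x, rfl⟩))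
    have hloc : IsLocallyConstant (fun x => (⟨_, hintegral x⟩ : Zbar l)) := by
      intro s
      have := f.2.1 {y | ∃ h : (l : Qbar l) ^ (∑ y ∈ hfin.toFinset, N y) * y ∈ Zbar l,
        (⟨_, h⟩ : Zbar l) ∈ s}
      convert this using 1
      ext x
      exact ⟨fun h => ⟨hintegral x, h⟩, fun ⟨_, h⟩ => h⟩
    exact ⟨Submodule.Quotient.mk ⟨_, mem_ccInf.2 hloc⟩, rfl⟩

theorem isStableLattice_range {F : Type*} [Field F] [Algebra F K] [TopologicalSpace F]
    [IsTopologicalRing F] [IsModuleTopology F K] :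
    IsStableLattice (steinbergRep K (Qbar l)) (steinbergGal F K (Qbar l))
      (LinearMap.range (steinbergCoeff K (Zbar l) (Qbar l))) where
  span_eq_top := by
    refine eq_top_iff.2 fun v _ => ?_
    obtain ⟨n, hn⟩ := exists_pow_smul_mem_range K l v
    have h := Submodule.smul_mem _ ((l : Qbar l) ^ n)⁻¹ (Submodule.subset_span (R := Qbar l) hn)
    rwa [smul_smul, inv_mul_cancel₀ (pow_ne_zero _ (natCast_ne_zero l)), one_smul] at h
  stable_left := by
    rintro g _ ⟨v, rfl⟩
    exact ⟨_, steinbergCoeff_rep K g v⟩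
  stable_right := by
    rintro σ _ ⟨v, rfl⟩
    exact ⟨_, steinbergCoeff_gal K σ v⟩

end Lattice

/-! ### Functions on affine space -/

section Box

variable {K : Type*} [Field K] [TopologicalSpace K] [LocalNorm K]

theorem exists_box_subset {s : Set (Fin 3 → K)} (hs : s ∈ 𝓝 (0 : Fin 3 → K)) :
    ∃ ε : ℝ, 0 < ε ∧ ∀ d : Fin 3 → K, (∀ i, LocalNorm.v (d i) ≤ ε) → d ∈ s := by
  rw [nhds_pi, Filter.mem_pi] at hs
  obtain ⟨I, -, t, ht, hts⟩ := hs
  choose ε hε hεt using fun i => LocalNorm.hasBasis.mem_iff.1 (ht i)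
  refine ⟨min (ε 0) (min (ε 1) (ε 2)), lt_min (hε 0) (lt_min (hε 1) (hε 2)), fun d hd => ?_⟩
  refine hts fun i _ => hεt i ((hd i).trans ?_)
  fin_cases i <;> simp

variable [IsTopologicalRing K] {R : Type*} [CommRing R]

/-- Compactness gives a common radius for x in the support. If only x + d lies in the support, apply
the same bound to x + d and -d. -/
theorem exists_uniform {f : (Fin 3 → K) → R} (hf : f ∈ CcInf (Fin 3 → K) R) :
    ∃ ε : ℝ, 0 < ε ∧ ∀ x d : Fin 3 → K, (∀ i, LocalNorm.v (d i) ≤ ε) → f (x + d) = f x := by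
  have h := hf.2.isCompact.eventually_forall_of_forall_eventually
    (x₀ := (0 : Fin 3 → K)) (P := fun d x => f (x + d) = f x) ?_
  · obtain ⟨ε, hε, H⟩ := exists_box_subset h
    refine ⟨ε, hε, fun x d hd => ?_⟩
    by_cases hx : x ∈ tsupport f
    · exact H d hd x hx
    by_cases hx' : x + d ∈ tsupport f
    · have h1 := H (-d) (fun i => by simpa using hd i) _ hx'
      rwa [add_neg_cancel_right, eq_comm] at h1
    · rw [image_eq_zero_of_notMem_tsupport hx, image_eq_zero_of_notMem_tsupport hx']
  · intro x _
    have h1 : Continuous fun z : (Fin 3 → K) × (Fin 3 → K) => z.2 + z.1 := by fun_prop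
    have h2 := (hf.1.comp_continuous h1).eventually_eq (0, x)
    have h3 := (hf.1.comp_continuous (continuous_snd (X := Fin 3 → K))).eventually_eq (0, x)
    filter_upwards [h2, h3] with z hz hz'
    simp only [Function.comp_apply, add_zero] at hz hz'
    rw [hz, hz']

theorem mem_ccInf_of_uniform {f : (Fin 3 → K) → R} {ε B : ℝ} (hε : 0 < ε)
    (hf : ∀ x d : Fin 3 → K, (∀ i, LocalNorm.v (d i) ≤ ε) → f (x + d) = f x)
    (hB : ∀ x, f x ≠ 0 → ∀ i, LocalNorm.v (x i) ≤ B) : f ∈ CcInf (Fin 3 → K) R := by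
  constructor
  · refine (IsLocallyConstant.iff_eventually_eq _).2 fun x => ?_
    have h : ∀ᶠ y in 𝓝 x, ∀ i, LocalNorm.v (y i - x i) ≤ ε := by
      rw [eventually_all]
      intro i
      exact (continuous_apply i).continuousAt.eventually (LocalNorm.eventually_le (x i) hε)
    filter_upwards [h] with y hy
    have := hf x (y - x) hy
    rwa [add_sub_cancel] at this
  · refine HasCompactSupport.intro
      (isCompact_univ_pi fun _ : Fin 3 => LocalNorm.isCompact_ball (K := K) B) fun x hx => ?_
    by_contra h
    exact hx fun i _ => hB x h i

variable (K) in
/-- The box of radius `ε` in affine space. -/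
def box (ε : ℝ) (hε : 0 ≤ ε) : AddSubgroup (Fin 3 → K) :=
  AddSubgroup.pi Set.univ fun _ => LocalNorm.ball K ε hε

theorem mem_box {ε : ℝ} {hε : 0 ≤ ε} {x : Fin 3 → K} :
    x ∈ box K ε hε ↔ ∀ i, LocalNorm.v (x i) ≤ ε :=
  ⟨fun h i => h i trivial, fun h i _ => h i⟩

end Box

/-! ### Orbits of a cyclic group of prime order -/

/-- A set of orbit representatives works: l is prime, so a point that is not fixed has exact period
l and meets its representative once among the first l iterates. -/
theorem exists_orbit_reps {Q : Type*} (π : Q → Q) {l : ℕ} (hl : l.Prime)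
    (hπ : ∀ q, π^[l] q = q) :
    ∃ T : Set Q, ∀ q, π q ≠ q → ∃ i < l, ∀ j < l, π^[j] q ∈ T ↔ j = i := by
  have hmod : ∀ (n : ℕ) (q : Q), π^[n] q = π^[n % l] q := by
    intro n q
    have h1 : ∀ m, π^[l * m] q = q := by
      intro m
      induction m with
      | zero => rfl
      | succ m ih => rw [mul_add, mul_one, Function.iterate_add_apply, hπ, ih]
    conv_lhs => rw [← Nat.mod_add_div n l, Function.iterate_add_apply, h1]
  let s : Setoid Q :=
    { r := fun q q' => ∃ n : ℕ, π^[n] q = q'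
      iseqv :=
        { refl := fun q => ⟨0, rfl⟩
          symm := by
            rintro q _ ⟨n, rfl⟩
            refine ⟨l - n % l, ?_⟩
            rw [hmod n, ← Function.iterate_add_apply,
              Nat.sub_add_cancel (Nat.mod_lt _ hl.pos).le, hπ]
          trans := by
            rintro q _ _ ⟨n, rfl⟩ ⟨m, rfl⟩
            exact ⟨m + n, Function.iterate_add_apply _ _ _ _⟩ } }
  refine ⟨{q | (Quotient.mk s q).out = q}, fun q hq => ?_⟩
  obtain ⟨n, hn⟩ := Quotient.exact (Quotient.out_eq (Quotient.mk s q)).symm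
  have hcls : ∀ j, Quotient.mk s (π^[j] q) = Quotient.mk s q := fun j =>
    Quotient.sound (Setoid.symm' s ⟨j, rfl⟩)
  refine ⟨n % l, Nat.mod_lt _ hl.pos, fun j hj => ?_⟩
  rw [Set.mem_ofPred_eq, hcls, ← hn, hmod n]
  constructor
  · intro h
    have hmp : Function.minimalPeriod π q = l := by
      rcases (Nat.dvd_prime hl).1 (Function.IsPeriodicPt.minimalPeriod_dvd (hπ q)) with h1 | h1
      · exact absurd (Function.minimalPeriod_eq_one_iff_isFixedPt.1 h1) hq
      · exact h1
    have := (Function.iterate_eq_iterate_iff_of_lt_minimalPeriod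
      (by rw [hmp]; exact Nat.mod_lt _ hl.pos) (by rw [hmp]; exact hj)).1 h
    exact this.symm
  · rintro rfl
    rfl

/-! ### Cyclic extensions of prime degree -/

/-- A cyclic extension of local fields, of a degree `l` prime to the residue characteristic. -/
structure IsCyclicLocal {F E : Type*} [Field F] [Field E] [Algebra F E] [TopologicalSpace F]
    [TopologicalSpace E] [LocalNorm F] [LocalNorm E] (γ : E ≃ₐ[F] E) (l : ℕ) : Prop where
  prime : l.Prime
  pow_eq_one : γ ^ l = 1
  v_algebraMap : ∀ x : F, LocalNorm.v (algebraMap F E x) = LocalNorm.v x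
  v_gal : ∀ x : E, LocalNorm.v (γ x) = LocalNorm.v x
  v_natCast : LocalNorm.v (l : E) = 1
  exists_of_fixed : ∀ x : E, γ x = x → ∃ y : F, algebraMap F E y = x

namespace IsCyclicLocal

variable {F E : Type*} [Field F] [Field E] [Algebra F E] [TopologicalSpace F]
    [TopologicalSpace E] [LocalNorm F] [LocalNorm E] {γ : E ≃ₐ[F] E} {l : ℕ}

theorem natCast_ne_zero_left (h : IsCyclicLocal γ l) : (l : E) ≠ 0 := by
  rw [← LocalNorm.v.ne_zero_iff, h.v_natCast]
  exact one_ne_zero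

theorem iterate_eq (h : IsCyclicLocal γ l) (x : E) : γ^[l] x = x := by
  have h1 : (γ ^ l) x = x := by rw [h.pow_eq_one]; rfl
  rwa [AlgEquiv.coe_pow] at h1

theorem exists_avg (h : IsCyclicLocal γ l) (x : E) :
    ∃ y : F, algebraMap F E y = (l : E)⁻¹ * ∑ i ∈ Finset.range l, γ^[i] x := by
  refine h.exists_of_fixed _ ?_
  rw [map_mul, map_inv₀, map_natCast, map_sum]
  congr 1
  simp only [← Function.iterate_succ_apply' γ]
  have h1 := Finset.sum_range_succ' (fun i => γ^[i] x) l
  rw [Finset.sum_range_succ, h.iterate_eq] at h1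
  exact (add_right_cancel h1).symm

/-- The projection of `E` to `F` given by the average over the Galois group. -/
def avg (h : IsCyclicLocal γ l) (x : E) : F := (h.exists_avg x).choose

theorem algebraMap_avg (h : IsCyclicLocal γ l) (x : E) :
    algebraMap F E (h.avg x) = (l : E)⁻¹ * ∑ i ∈ Finset.range l, γ^[i] x :=
  (h.exists_avg x).choose_spec

theorem iterate_add (n : ℕ) (x y : E) : γ^[n] (x + y) = γ^[n] x + γ^[n] y := by
  induction n with
  | zero => rfl
  | succ n ih => simp only [Function.iterate_succ_apply', ih, map_add]

theorem iterate_sub (n : ℕ) (x y : E) : γ^[n] (x - y) = γ^[n] x - γ^[n] y := by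
  have := iterate_add (γ := γ) n (x - y) y
  rw [sub_add_cancel] at this
  exact (sub_eq_of_eq_add this).symm

theorem iterate_algebraMap_mul (n : ℕ) (a : F) (x : E) :
    γ^[n] (algebraMap F E a * x) = algebraMap F E a * γ^[n] x := by
  induction n with
  | zero => rfl
  | succ n ih => simp only [Function.iterate_succ_apply', ih, map_mul, γ.commutes]

theorem avg_add (h : IsCyclicLocal γ l) (x y : E) : h.avg (x + y) = h.avg x + h.avg y := by
  refine (algebraMap F E).injective ?_
  rw [map_add, h.algebraMap_avg, h.algebraMap_avg, h.algebraMap_avg, ← mul_add,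
    ← Finset.sum_add_distrib]
  simp only [iterate_add]

theorem avg_algebraMap_mul (h : IsCyclicLocal γ l) (a : F) (x : E) :
    h.avg (algebraMap F E a * x) = a * h.avg x := by
  refine (algebraMap F E).injective ?_
  rw [map_mul, h.algebraMap_avg, h.algebraMap_avg]
  simp only [iterate_algebraMap_mul, ← Finset.mul_sum]
  ring

theorem avg_one (h : IsCyclicLocal γ l) : h.avg 1 = 1 := by
  refine (algebraMap F E).injective ?_
  have h1 : ∀ i : ℕ, γ^[i] (1 : E) = 1 := fun i => Function.iterate_fixed (map_one γ) i
  rw [h.algebraMap_avg, map_one]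
  simp [h1, h.natCast_ne_zero_left]

theorem avg_algebraMap (h : IsCyclicLocal γ l) (a : F) : h.avg (algebraMap F E a) = a := by
  have := h.avg_algebraMap_mul a 1
  rwa [mul_one, h.avg_one, mul_one] at this

theorem avg_gal (h : IsCyclicLocal γ l) (x : E) : h.avg (γ x) = h.avg x := by
  refine (algebraMap F E).injective ?_
  rw [h.algebraMap_avg, h.algebraMap_avg]
  congr 1
  have h1 := Finset.sum_range_succ' (fun i => γ^[i] x) l
  rw [Finset.sum_range_succ, h.iterate_eq] at h1
  exact (add_right_cancel h1).symm

theorem v_iterate (h : IsCyclicLocal γ l) (n : ℕ) (x : E) :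
    LocalNorm.v (γ^[n] x) = LocalNorm.v x := by
  induction n with
  | zero => rfl
  | succ n ih => rw [Function.iterate_succ_apply', h.v_gal, ih]

theorem v_sum_le {ι : Type*} (s : Finset ι) (f : ι → E) {r : ℝ} (hr : 0 ≤ r)
    (hf : ∀ i ∈ s, LocalNorm.v (f i) ≤ r) : LocalNorm.v (∑ i ∈ s, f i) ≤ r :=
  sum_mem (S := LocalNorm.ball E r hr) hf

theorem v_avg_le (h : IsCyclicLocal γ l) (x : E) : LocalNorm.v (h.avg x) ≤ LocalNorm.v x := by
  rw [← h.v_algebraMap, h.algebraMap_avg, map_mul, map_inv₀, h.v_natCast, inv_one, one_mul]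
  exact v_sum_le _ _ (LocalNorm.v.nonneg _) fun i _ => (h.v_iterate i x).le

/-- A point almost fixed by γ is equally close to F: x minus its average is the mean of the
differences x - γⁱ x, each a sum of terms of norm at most r, and dividing by l costs nothing since l
has norm 1. -/
theorem v_sub_avg_le (h : IsCyclicLocal γ l) {x : E} {r : ℝ} (hr : 0 ≤ r)
    (hx : LocalNorm.v (γ x - x) ≤ r) :
    LocalNorm.v (x - algebraMap F E (h.avg x)) ≤ r := by
  have hi : ∀ i : ℕ, LocalNorm.v (x - γ^[i] x) ≤ r := by
    intro i
    induction i with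
    | zero => simpa using hr
    | succ i ih =>
      have h1 : x - γ^[i + 1] x = (x - γ^[i] x) - γ^[i] (γ x - x) := by
        rw [iterate_sub, Function.iterate_succ_apply]
        ring
      rw [h1]
      refine (LocalNorm.sub_le_max _ _).trans (max_le ih ?_)
      rwa [h.v_iterate]
  have h2 : x - algebraMap F E (h.avg x) = (l : E)⁻¹ * ∑ i ∈ Finset.range l, (x - γ^[i] x) := by
    rw [h.algebraMap_avg, Finset.sum_sub_distrib, mul_sub, Finset.sum_const, Finset.card_range,
      nsmul_eq_mul, inv_mul_cancel_left₀ h.natCast_ne_zero_left]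
  rw [h2, map_mul, map_inv₀, h.v_natCast, inv_one, one_mul]
  exact v_sum_le _ _ hr fun i _ => hi i

end IsCyclicLocal

/-! ### The Galois action on the big cell -/

section GalCell

variable {F E : Type*} [Field F] [Field E] [Algebra F E]

theorem galFlag_mem_cell (σ : E ≃ₐ[F] E) {x : Flag E bB} :
    galFlag F E bB σ x ∈ cell E ↔ x ∈ cell E := by
  induction x using QuotientGroup.induction_on with
  | H g =>
    have h1 : galFlag F E bB σ (flag bB g) =
      flag bB (GeneralLinearGroup.map (σ : E →+* E) g) := rfl
    change galFlag F E bB σ (flag bB g) ∈ cell E ↔ flag bB g ∈ cell E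
    rw [h1, flag_mem_cell (p := (GeneralLinearGroup.map (σ : E →+* E) g).1.col 0)
      (r := ((GeneralLinearGroup.map (σ : E →+* E) g)⁻¹).1.row 2) (isPoint_col _) (isLine_row _),
      flag_mem_cell (p := g.1.col 0) (r := (g⁻¹).1.row 2) (isPoint_col _) (isLine_row _),
      ← map_inv]
    exact and_congr (map_ne_zero (σ : E →+* E)) (map_ne_zero (σ : E →+* E))

theorem galFlag_cellMap (σ : E ≃ₐ[F] E) (x : Fin 3 → E) :
    galFlag F E bB σ (cellMap x) = cellMap fun i => σ (x i) := by
  refine congrArg QuotientGroup.mk ?_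
  ext i j
  fin_cases i <;> fin_cases j <;> simp [lowerUnip]

variable [TopologicalSpace F] [IsTopologicalRing F] [TopologicalSpace E] [IsTopologicalRing E]
  [IsModuleTopology F E] [LocalNorm E] {R : Type*} [CommRing R]

theorem ccRep_gal_mem_cellFns (σ : E ≃ₐ[F] E) {f : CcInf (Flag E bB) R} (hf : f ∈ cellFns E R) :
    ccRep R (galAction F E bB) σ f ∈ cellFns E R := by
  intro x hx
  change f.1 (galFlag F E bB σ⁻¹ x) = 0
  exact hf _ fun h => hx ((galFlag_mem_cell σ⁻¹).1 h)

theorem steinbergGal_mk (σ : E ≃ₐ[F] E) (f : CcInf (Flag E bB) R) :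
    steinbergGal F E R σ (Submodule.Quotient.mk f) =
      Submodule.Quotient.mk (ccRep R (galAction F E bB) σ f) := rfl

theorem ccRep_gal_pow_mk (σ : E ≃ₐ[F] E) (n : ℕ) (f : CcInf (Flag E bB) R) :
    (steinbergGal F E R σ ^ n) (Submodule.Quotient.mk f) =
      Submodule.Quotient.mk (ccRep R (galAction F E bB) (σ ^ n) f) := by
  rw [← map_pow, steinbergGal_mk]

theorem ccRep_gal_cellMap (σ : E ≃ₐ[F] E) (f : CcInf (Flag E bB) R) (x : Fin 3 → E) :
    (ccRep R (galAction F E bB) σ f).1 (cellMap x) = f.1 (cellMap fun i => σ⁻¹ (x i)) := by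
  change f.1 (galFlag F E bB σ⁻¹ (cellMap x)) = _
  rw [galFlag_cellMap]

theorem ext_cellFns {f g : CcInf (Flag E bB) R} (hf : f ∈ cellFns E R) (hg : g ∈ cellFns E R)
    (h : ∀ x, f.1 (cellMap x) = g.1 (cellMap x)) : f = g := by
  refine Subtype.ext (funext fun x => ?_)
  by_cases hx : x ∈ cell E
  · rw [← cellMap_cellCoord hx, h]
  · rw [hf x hx, hg x hx]

/-- The function supported in the big cell with given values. -/
def cellFn (h : (Fin 3 → E) → R) (hh : h ∈ CcInf (Fin 3 → E) R) : CcInf (Flag E bB) R :=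
  ⟨extendZero h, extendZero_mem hh⟩

theorem cellFn_mem (h : (Fin 3 → E) → R) (hh : h ∈ CcInf (Fin 3 → E) R) :
    cellFn h hh ∈ cellFns E R := extendZero_mem_cellFns hh

theorem cellFn_cellMap (h : (Fin 3 → E) → R) (hh : h ∈ CcInf (Fin 3 → E) R) (x : Fin 3 → E) :
    (cellFn h hh).1 (cellMap x) = h x := extendZero_cellMap h x

end GalCell

/-! ### Computation of Ĥ⁰ by restriction to F-rational flags. -/

section TateZero

variable {F E : Type*} [Field F] [Field E] [Algebra F E]
  [TopologicalSpace F] [IsTopologicalRing F] [TopologicalSpace E] [IsTopologicalRing E]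
  [IsModuleTopology F E] [LocalNorm F] [LocalNorm E] {γ : E ≃ₐ[F] E} {l : ℕ}
  {R S : Type*} [CommRing R] [CommRing S] (φ : R →+* S)

/-- A Galois invariant function which is divisible by `l` at the `F`-rational points is a norm. -/
theorem exists_norm_eq (h : IsCyclicLocal γ l) {f : (Fin 3 → E) → R} (hf : f ∈ CcInf (Fin 3 → E) R)
    (hinv : ∀ x, f (fun i => γ (x i)) = f x)
    (hdiv : ∀ y : Fin 3 → F, ∃ c, (l : R) * c = f fun i => algebraMap F E (y i)) :
    ∃ g ∈ CcInf (Fin 3 → E) R,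
      ∀ x, ∑ j ∈ Finset.range l, g (fun i => γ^[j] (x i)) = f x := by
  classical
  obtain ⟨ε, hε, hunif⟩ := exists_uniform hf
  obtain ⟨B, -, hB⟩ := exists_bound hf.2
  -- f factors through Q, and γ induces on Q a map π with π^l = 1.
  let Q := (Fin 3 → E) ⧸ box E ε hε.le
  let Γ : (Fin 3 → E) →+ (Fin 3 → E) := AddMonoidHom.pi fun i =>
    (γ : E →+ E).comp (Pi.evalAddMonoidHom _ i)
  have hΓ : box E ε hε.le ≤ (box E ε hε.le).comap Γ := fun x hx => by
    refine mem_box.2 fun i => ?_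
    change LocalNorm.v (γ (x i)) ≤ ε
    rw [h.v_gal]
    exact mem_box.1 hx i
  let π : Q → Q := QuotientAddGroup.map _ _ Γ hΓ
  have hπmk : ∀ (j : ℕ) (x : Fin 3 → E),
      π^[j] (x : Q) = ((fun i => γ^[j] (x i) : Fin 3 → E) : Q) := by
    intro j
    induction j with
    | zero => intro x; rfl
    | succ j ih =>
      intro x
      rw [Function.iterate_succ_apply', ih]
      change ((Γ (fun i => γ^[j] (x i)) : Fin 3 → E) : Q) = _
      congr 1
      funext i
      exact (Function.iterate_succ_apply' γ j (x i)).symm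
  have hπ : ∀ q, π^[l] q = q := by
    intro q
    induction q using QuotientAddGroup.induction_on with
    | H x =>
      rw [hπmk]
      simp only [h.iterate_eq]
  obtain ⟨T, hT⟩ := exists_orbit_reps π h.prime hπ
  -- A choice of division by l. It sends 0 to 0, so that g below is supported where f is.
  let s : R → R := fun r => if hr : r ≠ 0 ∧ ∃ c, (l : R) * c = r then hr.2.choose else 0
  have hs : ∀ r, (∃ c, (l : R) * c = r) → (l : R) * s r = r := by
    intro r hr
    by_cases h0 : r = 0
    · simp [s, h0]
    · have h1 : r ≠ 0 ∧ ∃ c, (l : R) * c = r := ⟨h0, hr⟩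
      simp only [s, dif_pos h1]
      exact h1.2.choose_spec
  have hs0 : s 0 = 0 := by simp [s]
  -- On a free orbit g keeps the value of f at one representative only; on a fixed class it is f
  -- divided by l. Either way the l translates add up to f.
  let g : (Fin 3 → E) → R := fun x =>
    if π (x : Q) = x then s (f x) else if (x : Q) ∈ T then f x else 0
  have hfit : ∀ (j : ℕ) (x : Fin 3 → E), f (fun i => γ^[j] (x i)) = f x := by
    intro j
    induction j with
    | zero => intro x; rfl
    | succ j ih =>
      intro x
      have h1 := hinv fun i => γ^[j] (x i)
      simp only [← Function.iterate_succ_apply' γ] at h1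
      rw [h1, ih]
  refine ⟨g, mem_ccInf_of_uniform hε (B := B) ?_ ?_, fun x => ?_⟩
  · intro x d hd
    have h1 : ((x + d : Fin 3 → E) : Q) = x := by
      refine QuotientAddGroup.eq.2 ?_
      rw [neg_add_rev, neg_add_cancel_right]
      exact neg_mem (mem_box.2 hd)
    simp only [g]
    rw [h1, hunif x d hd]
  · intro x hx
    refine hB x fun h0 => hx ?_
    simp only [g, h0, hs0, ite_self]
  · by_cases hfix : π (x : Q) = x
    · have hfix' : ∀ j : ℕ, π^[j] (x : Q) = x := fun j => Function.iterate_fixed hfix j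
      have h1 : ∀ j ∈ Finset.range l, g (fun i => γ^[j] (x i)) = s (f x) := by
        intro j _
        simp only [g]
        rw [← hπmk, hfix' j, hfix, if_pos rfl, hfit]
      rw [Finset.sum_congr rfl h1, Finset.sum_const, Finset.card_range, nsmul_eq_mul]
      refine hs _ ?_
      -- A fixed class contains the F-rational point obtained by averaging x, where f is divisible
      -- by l by hypothesis.
      have h2 := QuotientAddGroup.eq.1 hfix
      have h3 : ∀ i, LocalNorm.v (γ (x i) - x i) ≤ ε := by
        intro i
        have := mem_box.1 h2 i
        change LocalNorm.v (-γ (x i) + x i) ≤ ε at this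
        rwa [neg_add_eq_sub, LocalNorm.v.map_sub] at this
      have h4 := hunif x (fun i => -(x i - algebraMap F E (h.avg (x i)))) fun i => by
        rw [LocalNorm.v.map_neg]
        exact h.v_sub_avg_le hε.le (h3 i)
      rw [← h4]
      obtain ⟨c, hc⟩ := hdiv fun i => h.avg (x i)
      refine ⟨c, hc.trans (congrArg f ?_)⟩
      funext i
      simp
    · obtain ⟨i0, hi0, hT'⟩ := hT x hfix
      have h1 : ∀ j ∈ Finset.range l,
          g (fun i => γ^[j] (x i)) = if j = i0 then f x else 0 := by
        intro j hj
        have hnf : π (π^[j] (x : Q)) ≠ π^[j] (x : Q) := by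
          intro h2
          have h3 : π^[l - j] (π^[j] (x : Q)) = π^[j] (x : Q) := Function.iterate_fixed h2 _
          rw [← Function.iterate_add_apply, Nat.sub_add_cancel (Finset.mem_range.1 hj).le, hπ] at h3
          rw [← h3] at h2
          exact hfix h2
        simp only [g]
        rw [← hπmk, if_neg hnf, hfit]
        simp only [hT' j (Finset.mem_range.1 hj)]
      rw [Finset.sum_congr rfl h1, Finset.sum_ite_eq' _ _ fun _ => f x,
        if_pos (Finset.mem_range.2 hi0)]

/-- A function on the `F`-rational points extends to a Galois invariant function. -/
theorem exists_invariant_lift (h : IsCyclicLocal γ l) {f : (Fin 3 → F) → S}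
    (hf : f ∈ CcInf (Fin 3 → F) S)
    (hφ : Function.Surjective φ) :
    ∃ g ∈ CcInf (Fin 3 → E) R, (∀ x, g (fun i => γ (x i)) = g x) ∧
      ∀ y : Fin 3 → F, φ (g fun i => algebraMap F E (y i)) = f y := by
  classical
  obtain ⟨ε, hε, hunif⟩ := exists_uniform hf
  obtain ⟨B, hB1, hB⟩ := exists_bound hf.2
  let s : S → R := fun c => if c = 0 then 0 else (hφ c).choose
  have hs : ∀ c, φ (s c) = c := by
    intro c
    by_cases h0 : c = 0
    · simp [s, h0]
    · simp only [s, if_neg h0]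
      exact (hφ c).choose_spec
  have hs0 : s 0 = 0 := by simp [s]
  -- The lift is f composed with the average. The cutoff to distance 1 from F³ is Galois invariant
  -- and keeps the support bounded.
  let near : (Fin 3 → E) → Prop := fun x =>
    ∀ i, LocalNorm.v (x i - algebraMap F E (h.avg (x i))) ≤ 1
  let g : (Fin 3 → E) → R := fun x => if near x then s (f fun i => h.avg (x i)) else 0
  refine ⟨g, mem_ccInf_of_uniform (ε := min ε 1) (B := B) (lt_min hε one_pos) ?_ ?_, ?_, ?_⟩
  · intro x d hd
    have h1 : (fun i => h.avg ((x + d) i)) = (fun i => h.avg (x i)) + fun i => h.avg (d i) :=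
      funext fun i => h.avg_add _ _
    have h2 : f (fun i => h.avg ((x + d) i)) = f fun i => h.avg (x i) := by
      rw [h1]
      exact hunif _ _ fun i => (h.v_avg_le _).trans ((hd i).trans (min_le_left _ _))
    have h4 : ∀ i, LocalNorm.v (d i - algebraMap F E (h.avg (d i))) ≤ 1 := fun i =>
      ((LocalNorm.sub_le_max _ _).trans (max_le le_rfl (by
        rw [h.v_algebraMap]; exact h.v_avg_le _))).trans ((hd i).trans (min_le_right _ _))
    have h5 : ∀ i, (x + d) i - algebraMap F E (h.avg ((x + d) i)) =
        (x i - algebraMap F E (h.avg (x i))) + (d i - algebraMap F E (h.avg (d i))) := by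
      intro i
      rw [Pi.add_apply, h.avg_add, map_add]
      ring
    have h3 : near (x + d) ↔ near x := by
      refine forall_congr' fun i => ?_
      rw [h5]
      constructor
      · intro h6
        have h7 := LocalNorm.sub_le_max ((x i - algebraMap F E (h.avg (x i))) +
          (d i - algebraMap F E (h.avg (d i)))) (d i - algebraMap F E (h.avg (d i)))
        rw [add_sub_cancel_right] at h7
        exact h7.trans (max_le h6 (h4 i))
      · exact fun h6 => (LocalNorm.add_le_max _ _).trans (max_le h6 (h4 i))
    simp only [g, h3, h2]
  · intro x hx i
    have hn : near x := by
      by_contra hn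
      exact hx (if_neg hn)
    have hfx : f (fun i => h.avg (x i)) ≠ 0 := by
      intro h0
      refine hx ?_
      simp only [g, h0, hs0, ite_self]
    have h1 := LocalNorm.add_le_max (x i - algebraMap F E (h.avg (x i)))
      (algebraMap F E (h.avg (x i)))
    rw [sub_add_cancel, h.v_algebraMap] at h1
    exact h1.trans (max_le ((hn i).trans hB1) (hB _ hfx i))
  · intro x
    have h1 : near (fun i => γ (x i)) ↔ near x := by
      refine forall_congr' fun i => ?_
      have h2 : γ (x i) - algebraMap F E (h.avg (γ (x i))) =
          γ (x i - algebraMap F E (h.avg (x i))) := by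
        rw [map_sub, γ.commutes, h.avg_gal]
      rw [h2, h.v_gal]
    simp only [g, h1, h.avg_gal]
  · intro y
    have h1 : near fun i => algebraMap F E (y i) := fun i => by simp [h.avg_algebraMap]
    simp only [g, if_pos h1, h.avg_algebraMap, hs]

theorem mem_ker_iff {f : CcInf (Flag E bB) R} (hf : f ∈ cellFns E R) :
    (Submodule.Quotient.mk f : Steinberg E R) ∈ LinearMap.ker (1 - steinbergGal F E R γ) ↔
      ∀ x, f.1 (cellMap fun i => γ (x i)) = f.1 (cellMap x) := by
  rw [LinearMap.mem_ker, LinearMap.sub_apply, Module.End.one_apply, sub_eq_zero, steinbergGal_mk]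
  constructor
  · intro h1 x
    have h2 := eq_of_mk_eq hf (ccRep_gal_mem_cellFns γ hf) h1
    rw [h2, ccRep_gal_cellMap, ← h2]
    exact congrArg (fun y => f.1 (cellMap y)) (funext fun i => γ.symm_apply_apply _)
  · intro h1
    congr 1
    refine ext_cellFns hf (ccRep_gal_mem_cellFns γ hf) fun x => ?_
    rw [ccRep_gal_cellMap, ← h1 fun i => γ⁻¹ (x i)]
    exact congrArg (fun y => f.1 (cellMap y)) (funext fun i => (γ.apply_symm_apply _).symm)

/-- The kernel of the restriction map on invariants consists of norms. -/
theorem mem_range_norm (h : IsCyclicLocal γ l)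
    (hker : ∀ r, φ r = 0 → ∃ c, (l : R) * c = r) {v : Steinberg E R}
    (hv : v ∈ LinearMap.ker (1 - steinbergGal F E R γ)) (hv0 : steinbergMap F E φ v = 0) :
    v ∈ LinearMap.range (tateNorm (steinbergGal F E R γ) l) := by
  obtain ⟨f, hf, rfl⟩ := exists_cellFns_mk v
  rw [mem_ker_iff hf] at hv
  have h0 : ccMap F E φ bB f = 0 := eq_zero_of_mem_cellFns (ccMap_mem_cellFns F E φ hf)
    ((Submodule.Quotient.mk_eq_zero _).1 hv0)
  obtain ⟨g, hg, hgf⟩ := exists_norm_eq h (comp_cellMap_mem hf) hv fun y => by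
    refine hker _ ?_
    have h1 : φ (f.1 (flagMap F E bB (cellMap y))) = 0 :=
      congrFun (congrArg Subtype.val h0) (cellMap y)
    rwa [flagMap_cellMap] at h1
  refine ⟨Submodule.Quotient.mk (cellFn g hg), ?_⟩
  have h1 : tateNorm (steinbergGal F E R γ) l (Submodule.Quotient.mk (cellFn g hg)) =
      Submodule.Quotient.mk (∑ j ∈ Finset.range l,
        ccRep R (galAction F E bB) (γ ^ j) (cellFn g hg)) := by
    rw [tateNorm, LinearMap.sum_apply]
    simp only [ccRep_gal_pow_mk]
    exact (map_sum (Submodule.mkQ (steinbergRel E R)) _ _).symm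
  rw [h1]
  congr 1
  -- The operators act through inverses, so the sum involves γ^(l - j). Splitting off one γ, which
  -- is harmless as f is invariant, turns it into a reflected sum over `range l`.
  have hγ : ∀ j < l, ∀ x : E, (γ ^ j)⁻¹ x = γ^[l - 1 - j] (γ x) := by
    intro j hj x
    refine (γ ^ j).injective ?_
    have h2 : (γ ^ j) ((γ ^ j)⁻¹ x) = x := (γ ^ j).apply_symm_apply x
    rw [h2, AlgEquiv.coe_pow, ← Function.iterate_succ_apply, ← Function.iterate_add_apply,
      show j + (l - 1 - j).succ = l by omega, h.iterate_eq]
  refine ext_cellFns (sum_mem fun j _ => ccRep_gal_mem_cellFns _ (cellFn_mem g hg)) hf fun x => ?_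
  have h2 : (∑ j ∈ Finset.range l, ccRep R (galAction F E bB) (γ ^ j) (cellFn g hg)).1 (cellMap x)
      = ∑ j ∈ Finset.range l, g (fun i => (γ ^ j)⁻¹ (x i)) := by
    rw [AddSubmonoidClass.coe_finsetSum, Finset.sum_apply]
    refine Finset.sum_congr rfl fun j _ => ?_
    rw [ccRep_gal_cellMap, cellFn_cellMap]
  rw [h2, ← hv, ← hgf,
    ← Finset.sum_range_reflect (fun j => g fun i => γ^[j] (γ (x i)))]
  refine Finset.sum_congr rfl fun j hj => congrArg g (funext fun i => ?_)
  exact hγ j (Finset.mem_range.1 hj) (x i)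

/-- The restriction map on `Ĥ⁰`. -/
def tateZeroMap (hl : (l : S) = 0) :
    TateH0 (steinbergGal F E R γ) l →ₛₗ[φ] Steinberg F S :=
  Submodule.liftQ _ ((steinbergMap F E φ).comp
    (LinearMap.ker (1 - steinbergGal F E R γ)).subtype) <| by
    rintro ⟨v, hv⟩ ⟨w, hw⟩
    rw [LinearMap.mem_ker]
    change steinbergMap F E φ v = 0
    have hw' : tateNorm (steinbergGal F E R γ) l w = v := hw
    -- All Galois translates of w have the same restriction, so the norm of w restricts to l times
    -- it, which is 0.
    have h1 : ∀ j : ℕ, steinbergMap F E φ ((steinbergGal F E R γ ^ j) w) = steinbergMap F E φ w :=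
      fun j => by rw [← map_pow, steinbergMap_gal]
    rw [← hw', tateNorm, LinearMap.sum_apply, map_sum]
    simp only [h1]
    rw [Finset.sum_const, Finset.card_range, ← Nat.cast_smul_eq_nsmul S, hl, zero_smul]

/-- An invariant function whose restriction to F-points vanishes modulo l is a norm, and every
function on F-points has an invariant lift. -/
theorem tateZeroMap_bijective (h : IsCyclicLocal γ l)
    (hl : (l : S) = 0) (hφ : Function.Surjective φ)
    (hker : ∀ r, φ r = 0 → ∃ c, (l : R) * c = r) :
    Function.Bijective (tateZeroMap (F := F) (γ := γ) φ hl) := by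
  constructor
  · refine (injective_iff_map_eq_zero _).2 fun v hv => ?_
    induction v using Submodule.Quotient.induction_on with
    | H v => exact (Submodule.Quotient.mk_eq_zero _).2 (mem_range_norm φ h hker v.2 hv)
  · intro w
    obtain ⟨f, hf, rfl⟩ := exists_cellFns_mk w
    obtain ⟨g, hg, hinv, hgf⟩ := exists_invariant_lift φ h (comp_cellMap_mem hf) hφ
    have hv : (Submodule.Quotient.mk (cellFn g hg) : Steinberg E R) ∈
        LinearMap.ker (1 - steinbergGal F E R γ) := by
      rw [mem_ker_iff (cellFn_mem g hg)]
      intro x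
      rw [cellFn_cellMap, cellFn_cellMap, hinv]
    refine ⟨Submodule.Quotient.mk ⟨_, hv⟩, ?_⟩
    change steinbergMap F E φ (Submodule.Quotient.mk (cellFn g hg)) = _
    rw [steinbergMap_mk]
    congr 1
    refine ext_cellFns (ccMap_mem_cellFns F E φ (cellFn_mem g hg)) hf fun y => ?_
    change φ ((cellFn g hg).1 (flagMap F E bB (cellMap y))) = _
    rw [flagMap_cellMap, cellFn_cellMap, hgf]

theorem tateZeroMap_rep (hl : (l : S) = 0) (g : GL (Fin 3) F)
    (v : TateH0 (steinbergGal F E R γ) l) :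
    tateZeroMap φ hl (steinbergTateH0Rep F E R γ l g v) =
      steinbergRep F S g (tateZeroMap φ hl v) := by
  induction v using Submodule.Quotient.induction_on with
  | H v => exact steinbergMap_rep F E φ g v.1

end TateZero

/-! ### Reduction to the residue field -/

/-- Decomposition into level sets. The coefficients are values of f, so a function with values in an
ideal has all its coefficients in that ideal. -/
theorem exists_sum_indicator {X R : Type*} [TopologicalSpace X] [CompactSpace X] [CommRing R]
    (f : CcInf X R) : ∃ (s : Finset R) (ind : R → CcInf X R),
      f = ∑ c ∈ s, c • ind c ∧ ∀ c ∈ s, ∃ x, f.1 x = c := by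
  classical
  have hfin := f.2.1.range_finite
  refine ⟨hfin.toFinset, fun c => ⟨fun x => if f.1 x = c then 1 else 0,
    mem_ccInf.2 (f.2.1.comp fun y => if y = c then (1 : R) else 0)⟩, ?_,
    fun c hc => (hfin.mem_toFinset.1 hc)⟩
  refine Subtype.ext (funext fun x => ?_)
  rw [AddSubmonoidClass.coe_finsetSum, Finset.sum_apply]
  change f.1 x = ∑ c ∈ hfin.toFinset, c * (if f.1 x = c then 1 else 0)
  simp only [mul_ite, mul_one, mul_zero]
  rw [Finset.sum_ite_eq, if_pos (hfin.mem_toFinset.2 ⟨x, rfl⟩)]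

/-! ### Change of coefficients, as restriction in the case E = F. -/

section SelfMap

variable {F : Type*} [Field F]

theorem flagMap_self {b : Fin 3 → ℕ} (x : Flag F b) : flagMap F F b x = x := by
  induction x using QuotientGroup.induction_on with
  | H g => exact congrArg QuotientGroup.mk (by ext i j; rfl)

variable [TopologicalSpace F] [IsTopologicalRing F] [LocalNorm F]
  {R S : Type*} [CommRing R] [CommRing S] (φ : R →+* S)

theorem steinbergMap_self_rep (g : GL (Fin 3) F) (v : Steinberg F R) :
    steinbergMap F F φ (steinbergRep F R g v) = steinbergRep F S g (steinbergMap F F φ v) := by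
  have h := steinbergMap_rep F F φ g v
  rwa [show GeneralLinearGroup.map (algebraMap F F) g = g by ext i j; rfl] at h

theorem steinbergMap_self_surjective (hφ : Function.Surjective φ) :
    Function.Surjective (steinbergMap F F φ) := by
  intro w
  induction w using Submodule.Quotient.induction_on with
  | H f =>
    refine ⟨Submodule.Quotient.mk ⟨fun x => Function.surjInv hφ (f.1 x),
      mem_ccInf.2 (f.2.1.comp (Function.surjInv hφ))⟩, ?_⟩
    rw [steinbergMap_mk]
    congr 1
    refine Subtype.ext (funext fun x => ?_)
    change φ (Function.surjInv hφ (f.1 (flagMap F F bB x))) = f.1 x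
    rw [Function.surjInv_eq hφ, flagMap_self]

/-- The representative supported in the cell reduces to a representative of zero, hence to zero, so
its values lie in the kernel of φ. -/
theorem exists_sum_of_steinbergMap_eq_zero {v : Steinberg F R} (hv : steinbergMap F F φ v = 0) :
    ∃ (s : Finset R) (w : R → Steinberg F R), v = ∑ c ∈ s, c • w c ∧ ∀ c ∈ s, φ c = 0 := by
  obtain ⟨f, hf, rfl⟩ := exists_cellFns_mk v
  have h0 : ccMap F F φ bB f = 0 := eq_zero_of_mem_cellFns (ccMap_mem_cellFns F F φ hf)
    ((Submodule.Quotient.mk_eq_zero _).1 hv)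
  obtain ⟨s, ind, hs, hs'⟩ := exists_sum_indicator f
  refine ⟨s, fun c => Submodule.Quotient.mk (ind c), ?_, fun c hc => ?_⟩
  · conv_lhs => rw [hs]
    exact map_sum (Submodule.mkQ (steinbergRel F R)) _ _
  · obtain ⟨x, rfl⟩ := hs' c hc
    have h1 : φ (f.1 (flagMap F F bB x)) = 0 := congrFun (congrArg Subtype.val h0) x
    rwa [flagMap_self] at h1

end SelfMap

/-- Since A → k is surjective, every tensor has the form 1 ⊗ m. -/
theorem liftBaseChange_bijective {A k M N : Type*} [CommRing A] [CommRing k] [Algebra A k]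
    [AddCommGroup M] [Module A M] [AddCommGroup N] [Module A N] [Module k N] [IsScalarTower A k N]
    (hk : Function.Surjective (algebraMap A k)) (g : M →ₗ[A] N) (hg : Function.Surjective g)
    (hker : ∀ m, g m = 0 → (1 : k) ⊗ₜ[A] m = 0) : Function.Bijective (g.liftBaseChange k) := by
  have key : ∀ t : k ⊗[A] M, ∃ m, t = (1 : k) ⊗ₜ[A] m := by
    intro t
    induction t using TensorProduct.induction_on with
    | zero => exact ⟨0, (TensorProduct.tmul_zero _ _).symm⟩
    | tmul c m =>
      obtain ⟨a, rfl⟩ := hk c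
      exact ⟨a • m, by rw [← TensorProduct.smul_tmul, Algebra.smul_def, mul_one]⟩
    | add x y hx hy =>
      obtain ⟨m, rfl⟩ := hx
      obtain ⟨n, rfl⟩ := hy
      exact ⟨m + n, (TensorProduct.tmul_add _ _ _).symm⟩
  constructor
  · refine (injective_iff_map_eq_zero _).2 fun t ht => ?_
    obtain ⟨m, rfl⟩ := key t
    rw [LinearMap.liftBaseChange_tmul, one_smul] at ht
    exact hker m ht
  · intro n
    obtain ⟨m, rfl⟩ := hg n
    exact ⟨1 ⊗ₜ m, by rw [LinearMap.liftBaseChange_tmul, one_smul]⟩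

/-- An intertwining map that becomes bijective after base change is an equivalence there. -/
def equivOfLiftBaseChange {A k M N G : Type*} [CommRing A] [CommRing k] [Algebra A k]
    [AddCommGroup M] [Module A M] [AddCommGroup N] [Module A N] [Module k N] [IsScalarTower A k N]
    [Group G] (ρ : Representation A G M) (τ : Representation k G N) (g : M →ₗ[A] N)
    (hg : Function.Bijective (g.liftBaseChange k)) (h : ∀ x m, g (ρ x m) = τ x (g m)) :
    (baseChangeRep k ρ).Equiv τ :=
  Representation.Equiv.mk (LinearEquiv.ofBijective _ hg) fun x => by
    refine LinearMap.ext fun t => ?_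
    induction t using TensorProduct.induction_on with
    | zero => simp
    | add y z hy hz => rw [map_add, map_add, hy, hz]
    | tmul c m =>
      change g.liftBaseChange k (c ⊗ₜ[A] ρ x m) = τ x (g.liftBaseChange k (c ⊗ₜ m))
      rw [LinearMap.liftBaseChange_tmul, LinearMap.liftBaseChange_tmul, map_smul, h]

/-! ### The Frobenius twist over the residue field. -/

section Frobenius

variable (l : ℕ) [Fact l.Prime]

theorem residue_natCast : IsLocalRing.residue (Zbar l) (l : Zbar l) = 0 := by
  rw [map_natCast]
  exact CharP.cast_eq_zero (Fbar l) l

/-- The reduction `Zbar l / l → Fbar l`, followed by the inverse of Frobenius. -/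
def frobReduction : ZbarMod l →+* Fbar l :=
  ((frobeniusEquiv (Fbar l) l).symm : Fbar l →+* Fbar l).comp
    (Ideal.Quotient.lift _ (IsLocalRing.residue (Zbar l)) fun a ha => by
      obtain ⟨b, rfl⟩ := Ideal.mem_span_singleton.1 ha
      rw [map_mul, residue_natCast, zero_mul])

theorem frobReduction_mk (a : Zbar l) :
    frobReduction l (algebraMap (Zbar l) (ZbarMod l) a) =
      (frobeniusEquiv (Fbar l) l).symm (algebraMap (Zbar l) (Fbar l) a) := rfl

theorem frobReduction_surjective : Function.Surjective (frobReduction l) := by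
  intro c
  obtain ⟨a, ha⟩ := IsLocalRing.residue_surjective (frobeniusEquiv (Fbar l) l c)
  refine ⟨algebraMap (Zbar l) (ZbarMod l) a, ?_⟩
  rw [frobReduction_mk]
  exact (congrArg _ ha).trans (RingEquiv.symm_apply_apply _ _)

/-- A `Zbar l`-linear form of the Steinberg module over `Zbar l / l` becomes, over `Fbar l`, the
Frobenius twist of the Steinberg representation. -/
theorem nonempty_equiv_frobTwist {F : Type*} [Field F] [TopologicalSpace F] [IsTopologicalRing F]
    [LocalNorm F] {M : Type*} [AddCommGroup M] [Module (Zbar l) M]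
    (ρ : Representation (Zbar l) (GL (Fin 3) F) M) (e : M ≃+ Steinberg F (ZbarMod l))
    (he : ∀ (c : Zbar l) v, e (c • v) = algebraMap (Zbar l) (ZbarMod l) c • e v)
    (heg : ∀ g v, e (ρ g v) = steinbergRep F (ZbarMod l) g (e v)) :
    Nonempty ((baseChangeRep (Fbar l) ρ).Equiv
      (frobTwistRep (Fbar l) l (steinbergRep F (Fbar l)))) := by
  let N := FrobTwist (Fbar l) l (Steinberg F (Fbar l))
  let _ : Module (Zbar l) N := Module.compHom N (algebraMap (Zbar l) (Fbar l))
  have : IsScalarTower (Zbar l) (Fbar l) N := IsScalarTower.of_algebraMap_smul fun _ _ => rfl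
  -- Scalars act on the twist through the inverse of Frobenius. The same inverse is built into
  -- `frobReduction`, and this makes g linear.
  let g : M →ₗ[Zbar l] N :=
    { toFun := fun m => steinbergMap F F (frobReduction l) (e m)
      map_add' := fun m n => by
        rw [map_add, map_add]
        rfl
      map_smul' := fun c m => by
        rw [he, LinearMap.map_smulₛₗ, frobReduction_mk]
        rfl }
  have hbij : Function.Bijective (g.liftBaseChange (Fbar l)) := by
    refine liftBaseChange_bijective IsLocalRing.residue_surjective g ?_ ?_
    · exact (steinbergMap_self_surjective _ (frobReduction_surjective l)).comp e.surjective
    · intro m hm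
      obtain ⟨s, w, hw, hs⟩ := exists_sum_of_steinbergMap_eq_zero (frobReduction l) hm
      have hsum : m = ∑ c ∈ s, e.symm (c • w c) := by
        rw [← map_sum, ← hw, e.symm_apply_apply]
      rw [hsum, TensorProduct.tmul_sum]
      refine Finset.sum_eq_zero fun c hc => ?_
      obtain ⟨a, rfl⟩ : ∃ a, algebraMap (Zbar l) (ZbarMod l) a = c :=
        Ideal.Quotient.mk_surjective c
      have h1 : ∀ u, e.symm (algebraMap (Zbar l) (ZbarMod l) a • u) = a • e.symm u := fun u => by
        refine e.injective ?_
        rw [he, e.apply_symm_apply, e.apply_symm_apply]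
      have h2 : algebraMap (Zbar l) (Fbar l) a = 0 := by
        have h3 : (frobeniusEquiv (Fbar l) l).symm (algebraMap (Zbar l) (Fbar l) a) = 0 := hs _ hc
        exact (map_eq_zero_iff _ (RingEquiv.injective _)).1 h3
      rw [h1, ← TensorProduct.smul_tmul, Algebra.smul_def, h2, zero_mul, TensorProduct.zero_tmul]
  exact ⟨equivOfLiftBaseChange ρ _ g hbij fun x m =>
    (congrArg (steinbergMap F F (frobReduction l)) (heg x m)).trans
      (steinbergMap_self_rep (frobReduction l) x (e m))⟩

end Frobenius

/-! ### Quotients of balls -/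

section BallQuot

variable (K : Type*) [Field K] [TopologicalSpace K] [IsTopologicalRing K] [LocalNorm K]

/-- The quotient of the ball of radius `r` by the ball of radius `ε`. -/
def BallQuot {r ε : ℝ} (hr : 0 ≤ r) (hε : 0 < ε) : Type _ :=
  LocalNorm.ball K r hr ⧸ (LocalNorm.ball K ε hε.le).addSubgroupOf (LocalNorm.ball K r hr)

variable {K} {r ε : ℝ} {hr : 0 ≤ r} {hε : 0 < ε}

instance : AddCommGroup (BallQuot K hr hε) :=
  inferInstanceAs (AddCommGroup (_ ⧸ (LocalNorm.ball K ε hε.le).addSubgroupOf _))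

instance : Finite (BallQuot K hr hε) := by
  have : CompactSpace (LocalNorm.ball K r hr) :=
    isCompact_iff_compactSpace.1 (LocalNorm.isCompact_ball (K := K) r)
  refine AddSubgroup.quotient_finite_of_isOpen _ ?_
  refine IsOpen.preimage (t := (LocalNorm.ball K ε hε.le : Set K)) continuous_subtype_val ?_
  refine AddSubgroup.isOpen_of_mem_nhds _ (g := 0) ?_
  exact LocalNorm.hasBasis.mem_of_mem hε

instance : Fintype (BallQuot K hr hε) := Fintype.ofFinite _

namespace BallQuot

variable (hr hε) in
/-- The class of an element of the ball. -/
def mk : LocalNorm.ball K r hr →+ BallQuot K hr hε := QuotientAddGroup.mk' _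

/-- A representative of a class. -/
def rep (q : BallQuot K hr hε) : K := (Quotient.out q : LocalNorm.ball K r hr)

theorem v_rep (q : BallQuot K hr hε) : LocalNorm.v q.rep ≤ r := (Quotient.out q).2

theorem mk_eq {x y : LocalNorm.ball K r hr} :
    mk hr hε x = mk hr hε y ↔ LocalNorm.v ((y : K) - x) ≤ ε := by
  refine QuotientAddGroup.eq.trans ?_
  rw [neg_add_eq_sub]
  exact Iff.rfl

theorem mk_eq_zero {x : LocalNorm.ball K r hr} : mk hr hε x = 0 ↔ LocalNorm.v (x : K) ≤ ε := by
  rw [eq_comm, ← map_zero (mk hr hε), mk_eq, ZeroMemClass.coe_zero, sub_zero]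

theorem mk_rep (q : BallQuot K hr hε) : mk hr hε ⟨q.rep, q.v_rep⟩ = q :=
  QuotientAddGroup.out_eq' q

theorem v_sub_rep (x : LocalNorm.ball K r hr) : LocalNorm.v ((x : K) - (mk hr hε x).rep) ≤ ε :=
  mk_eq.1 (mk_rep (mk hr hε x))

theorem apply_rep_mk {X : Type*} {f : K → X} (hf : ∀ x d, LocalNorm.v d ≤ ε → f (x + d) = f x)
    (x : LocalNorm.ball K r hr) : f (mk hr hε x).rep = f x := by
  have h := hf (mk hr hε x).rep _ (v_sub_rep (hε := hε) x)
  rw [← h, add_sub_cancel]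

variable (hr hε) in
theorem sum_rep_add {X : Type*} [AddCommMonoid X] (f : K → X)
    (hf : ∀ x d, LocalNorm.v d ≤ ε → f (x + d) = f x) {y : K} (hy : LocalNorm.v y ≤ r) :
    ∑ q : BallQuot K hr hε, f (q.rep + y) = ∑ q : BallQuot K hr hε, f q.rep := by
  rw [← Equiv.sum_comp (Equiv.addRight (mk hr hε ⟨y, hy⟩)) fun q => f q.rep]
  refine Finset.sum_congr rfl fun q _ => ?_
  have h : Equiv.addRight (mk hr hε ⟨y, hy⟩) q = mk hr hε (⟨q.rep, q.v_rep⟩ + ⟨y, hy⟩) := by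
    rw [map_add, mk_rep]
    rfl
  rw [h, apply_rep_mk hf]
  rfl

variable (K hr hε) in
-- Otherwise Cauchy's theorem gives a class of order l; but multiplication by l preserves norms, so
-- it is injective on the quotient.
theorem not_dvd_card {l : ℕ} (hl : l.Prime) (hv : LocalNorm.v (l : K) = 1) :
    ¬ l ∣ Nat.card (BallQuot K hr hε) := by
  intro h
  have : Fact l.Prime := ⟨hl⟩
  obtain ⟨q, hq⟩ := exists_prime_addOrderOf_dvd_card' l h
  have h0 : l • q = 0 := by rw [← hq, addOrderOf_nsmul_eq_zero]
  have h1 : q = 0 := by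
    rw [← mk_rep q, ← map_nsmul, mk_eq_zero] at h0
    rw [← mk_rep q, mk_eq_zero]
    simpa [hv] using h0
  rw [h1, addOrderOf_zero] at hq
  exact hl.one_lt.ne hq

theorem isUnit_card {R : Type*} [CommRing R] {l : ℕ} (hl : l.Prime)
    (hR : ∀ n : ℕ, ¬ l ∣ n → IsUnit (n : R)) (hv : LocalNorm.v (l : K) = 1)
    (H : AddSubgroup (BallQuot K hr hε)) : IsUnit (Nat.card H : R) :=
  hR _ fun h => not_dvd_card K hr hε hl hv (h.trans (AddSubgroup.card_addSubgroup_dvd_card H))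

/-- The image of a subgroup of `K`. -/
def image (A : AddSubgroup K) : AddSubgroup (BallQuot K hr hε) :=
  (A.comap (LocalNorm.ball K r hr).subtype).map (mk hr hε)

theorem mem_image {A : AddSubgroup K} (hA : LocalNorm.ball K ε hε.le ≤ A) {q : BallQuot K hr hε} :
    q ∈ image A ↔ q.rep ∈ A := by
  constructor
  · rintro ⟨x, hx, rfl⟩
    have h := A.sub_mem hx (hA (v_sub_rep (hε := hε) x))
    rwa [AddSubgroup.coe_subtype, sub_sub_cancel] at h
  · intro h
    exact ⟨⟨q.rep, q.v_rep⟩, h, mk_rep q⟩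

/-- A character of `K` that is trivial on the ball of radius `ε` gives a character of the
quotient. -/
def char {R : Type*} [CommRing R] (χ : AddChar K R) (hχ : ∀ d, LocalNorm.v d ≤ ε → χ d = 1) :
    AddChar (BallQuot K hr hε) R where
  toFun q := χ q.rep
  map_zero_eq_one' := by
    have h := apply_rep_mk (hε := hε) (f := χ) (fun x d hd => by
      rw [AddChar.map_add_eq_mul, hχ d hd, mul_one]) (0 : LocalNorm.ball K r hr)
    rwa [map_zero, ZeroMemClass.coe_zero, AddChar.map_zero_eq_one] at h
  map_add_eq_mul' a b := by
    have h := apply_rep_mk (hε := hε) (f := χ) (fun x d hd => by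
      rw [AddChar.map_add_eq_mul, hχ d hd, mul_one])
      ((⟨a.rep, a.v_rep⟩ : LocalNorm.ball K r hr) + ⟨b.rep, b.v_rep⟩)
    rw [map_add, mk_rep, mk_rep] at h
    rw [h]
    exact AddChar.map_add_eq_mul χ _ _

variable (hr hε) in
theorem sum_char_eq_zero {R : Type*} [CommRing R] [IsDomain R] {χ : AddChar K R}
    (hχ : ∀ d, LocalNorm.v d ≤ ε → χ d = 1) {y : K} (hy : LocalNorm.v y ≤ r) (hy' : χ y ≠ 1) :
    ∑ q : BallQuot K hr hε, χ q.rep = 0 := by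
  classical
  have h := AddChar.sum_eq_ite (char (hr := hr) (hε := hε) χ hχ)
  refine h.trans (if_neg fun h0 => hy' ?_)
  have h1 : char χ hχ (mk hr hε ⟨y, hy⟩) = 1 := by rw [h0, AddChar.zero_apply]
  have h2 := apply_rep_mk (hε := hε) (f := χ) (fun x d hd => by
      rw [AddChar.map_add_eq_mul, hχ d hd, mul_one]) (⟨y, hy⟩ : LocalNorm.ball K r hr)
  exact h2.symm.trans h1

end BallQuot

end BallQuot

/-! ### Twisted coinvariants of additive groups -/

section Coinvariants

variable {K : Type*} [Field K] [TopologicalSpace K] [IsTopologicalRing K] [LocalNorm K]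
  {R M : Type*} [CommRing R] [AddCommGroup M] [Module R M]

/-- A smooth linear action of the additive group of a local field. -/
structure IsSmoothAction (u : K → Module.End R M) : Prop where
  map_zero : u 0 = 1
  map_add : ∀ x y, u (x + y) = u x * u y
  smooth : ∀ m, ∃ ε : ℝ, 0 < ε ∧ ∀ x, LocalNorm.v x ≤ ε → u x m = m

/-- The kernel of the projection to the coinvariants twisted by `χ`. -/
def twistRel (u : K → Module.End R M) (χ : AddChar K R) : Submodule R M :=
  Submodule.span R {n | ∃ x m, n = u x m - χ x • m}

/-- The part of `twistRel` that comes from the ball of radius `r` and from vectors fixed by the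
ball of radius `ε`. -/
def twistRelBall (u : K → Module.End R M) (χ : AddChar K R) (r ε : ℝ) : Submodule R M :=
  Submodule.span R {n | ∃ x m, LocalNorm.v x ≤ r ∧ (∀ d, LocalNorm.v d ≤ ε → u d m = m) ∧
    n = u x m - χ x • m}

theorem sub_mem_twistRel (u : K → Module.End R M) (χ : AddChar K R) (x : K) (m : M) :
    u x m - χ x • m ∈ twistRel u χ :=
  Submodule.subset_span ⟨x, m, rfl⟩

theorem sub_mem_twistRel' (u : K → Module.End R M) (χ : AddChar K R) (x : K) (m : M) :
    χ (-x) • u x m - m ∈ twistRel u χ := by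
  have h := (twistRel u χ).smul_mem (χ (-x)) (sub_mem_twistRel u χ x m)
  rwa [smul_sub, smul_smul, ← AddChar.map_add_eq_mul, neg_add_cancel, AddChar.map_zero_eq_one,
    one_smul] at h

theorem twistRel_le_comap (u : K → Module.End R M) (χ : AddChar K R) {A : Module.End R M}
    (hA : ∀ x, Commute A (u x)) : twistRel u χ ≤ (twistRel u χ).comap A := by
  refine Submodule.span_le.2 ?_
  rintro _ ⟨x, m, rfl⟩
  refine Submodule.subset_span ⟨x, A m, ?_⟩
  rw [map_sub, map_smul, ← Module.End.mul_apply, (hA x).eq, Module.End.mul_apply]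

theorem twistRelBall_mono (u : K → Module.End R M) (χ : AddChar K R) {r r' ε ε' : ℝ} (hr : r ≤ r')
    (hε : ε' ≤ ε) : twistRelBall u χ r ε ≤ twistRelBall u χ r' ε' := by
  refine Submodule.span_mono ?_
  rintro _ ⟨x, m, hx, hm, rfl⟩
  exact ⟨x, m, hx.trans hr, fun d hd => hm d (hd.trans hε), rfl⟩

theorem twistRelBall_congr (u : K → Module.End R M) {χ χ' : AddChar K R} {r : ℝ}
    (h : ∀ x, LocalNorm.v x ≤ r → χ x = χ' x) (ε : ℝ) :
    twistRelBall u χ r ε = twistRelBall u χ' r ε := by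
  refine congrArg (Submodule.span R) (Set.ext fun n => ?_)
  constructor
  · rintro ⟨x, m, hx, hm, rfl⟩
    exact ⟨x, m, hx, hm, by rw [h x hx]⟩
  · rintro ⟨x, m, hx, hm, rfl⟩
    exact ⟨x, m, hx, hm, by rw [h x hx]⟩

/-- An element of the span involves finitely many translations and finitely many smooth vectors, so
a bounded ball and a common fixing radius suffice. -/
theorem exists_mem_twistRelBall {u : K → Module.End R M} (hu : IsSmoothAction u) (χ : AddChar K R)
    {S : Submodule R M} {w : M} (hw : w ∈ S ⊔ twistRel u χ) :
    ∃ r ε : ℝ, 0 ≤ r ∧ 0 < ε ∧ w ∈ S ⊔ twistRelBall u χ r ε := by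
  obtain ⟨s, hs, t, ht, rfl⟩ := Submodule.mem_sup.1 hw
  suffices h : ∃ r ε : ℝ, 0 ≤ r ∧ 0 < ε ∧ t ∈ twistRelBall u χ r ε by
    obtain ⟨r, ε, hr, hε, h⟩ := h
    exact ⟨r, ε, hr, hε, Submodule.add_mem_sup hs h⟩
  clear hs hw
  induction ht using Submodule.span_induction with
  | mem x hx =>
    obtain ⟨x, m, rfl⟩ := hx
    obtain ⟨ε, hε, h⟩ := hu.smooth m
    exact ⟨LocalNorm.v x, ε, LocalNorm.v.nonneg x, hε,
      Submodule.subset_span ⟨x, m, le_rfl, h, rfl⟩⟩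
  | zero => exact ⟨0, 1, le_rfl, one_pos, Submodule.zero_mem _⟩
  | smul c x _ h =>
    obtain ⟨r, ε, hr, hε, h⟩ := h
    exact ⟨r, ε, hr, hε, Submodule.smul_mem _ c h⟩
  | add x y _ _ hx hy =>
    obtain ⟨r, ε, hr, hε, h⟩ := hx
    obtain ⟨r', ε', hr', hε', h'⟩ := hy
    exact ⟨max r r', min ε ε', hr.trans (le_max_left _ _), lt_min hε hε', Submodule.add_mem _
      (twistRelBall_mono u χ (le_max_left _ _) (min_le_left _ _) h)
      (twistRelBall_mono u χ (le_max_right _ _) (min_le_right _ _) h')⟩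

/-- The sum of the `χ`-twisted action over representatives of a quotient of balls. -/
def ballSum (u : K → Module.End R M) (χ : AddChar K R) {r ε : ℝ} (hr : 0 ≤ r) (hε : 0 < ε) :
    Module.End R M :=
  ∑ q : BallQuot K hr hε, χ (-q.rep) • u q.rep

theorem ballSum_apply (u : K → Module.End R M) (χ : AddChar K R) {r ε : ℝ} (hr : 0 ≤ r)
    (hε : 0 < ε) (m : M) :
    ballSum u χ hr hε m = ∑ q : BallQuot K hr hε, χ (-q.rep) • u q.rep m := by
  simp [ballSum, LinearMap.sum_apply]

theorem twist_add_eq {u : K → Module.End R M} (hu : IsSmoothAction u) {χ : AddChar K R}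
    {ε : ℝ} (hχ : ∀ d, LocalNorm.v d ≤ ε → χ d = 1) {m : M}
    (hm : ∀ d, LocalNorm.v d ≤ ε → u d m = m) (x d : K) (hd : LocalNorm.v d ≤ ε) :
    χ (-(x + d)) • u (x + d) m = χ (-x) • u x m := by
  rw [hu.map_add, Module.End.mul_apply, hm d hd, neg_add, AddChar.map_add_eq_mul,
    hχ (-d) (by rwa [LocalNorm.v.map_neg]), mul_one]

/-- Translation by y permutes the classes of the ball and multiplies the twisted sum by χ y. -/
theorem ballSum_sub_eq_zero {u : K → Module.End R M} (hu : IsSmoothAction u) {χ : AddChar K R}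
    {r ε : ℝ} (hr : 0 ≤ r) (hε : 0 < ε) (hχ : ∀ d, LocalNorm.v d ≤ ε → χ d = 1) {m : M}
    (hm : ∀ d, LocalNorm.v d ≤ ε → u d m = m) {y : K} (hy : LocalNorm.v y ≤ r) :
    ballSum u χ hr hε (u y m - χ y • m) = 0 := by
  have h := BallQuot.sum_rep_add hr hε (fun x => χ (-x) • u x m) (twist_add_eq hu hχ hm) hy
  rw [map_sub, map_smul, ballSum_apply, ballSum_apply, ← h, Finset.smul_sum, sub_eq_zero]
  refine Finset.sum_congr rfl fun q _ => ?_
  rw [smul_smul, ← AddChar.map_add_eq_mul, hu.map_add, Module.End.mul_apply]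
  congr 2
  abel

/-- Averaging kills the twisted relations. -/
theorem ballSum_mem {u : K → Module.End R M} (hu : IsSmoothAction u) {χ : AddChar K R}
    {r ε : ℝ} (hr : 0 ≤ r) (hε : 0 < ε) (hχ : ∀ d, LocalNorm.v d ≤ ε → χ d = 1)
    {S : Submodule R M} (hS : ∀ x, ∀ s ∈ S, u x s ∈ S) {w : M}
    (hw : w ∈ S ⊔ twistRelBall u χ r ε) : ballSum u χ hr hε w ∈ S := by
  suffices h : S ⊔ twistRelBall u χ r ε ≤ S.comap (ballSum u χ hr hε) from h hw
  refine sup_le (fun s hs => ?_) (Submodule.span_le.2 ?_)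
  · rw [Submodule.mem_comap, ballSum_apply]
    exact sum_mem fun q _ => S.smul_mem _ (hS _ _ hs)
  · rintro _ ⟨x, m, hx, hm, rfl⟩
    rw [SetLike.mem_coe, Submodule.mem_comap, ballSum_sub_eq_zero hu hr hε hχ hm hx]
    exact S.zero_mem

theorem ballSum_sub_mem (u : K → Module.End R M) (χ : AddChar K R) {r ε : ℝ} (hr : 0 ≤ r)
    (hε : 0 < ε) (m : M) :
    ballSum u χ hr hε m - (Nat.card (BallQuot K hr hε) : R) • m ∈ twistRel u χ := by
  have h : ballSum u χ hr hε m - (Nat.card (BallQuot K hr hε) : R) • m =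
      ∑ q : BallQuot K hr hε, (χ (-q.rep) • u q.rep m - m) := by
    rw [ballSum_apply, Finset.sum_sub_distrib, Finset.sum_const, Finset.card_univ,
      Nat.card_eq_fintype_card, Nat.cast_smul_eq_nsmul]
  rw [h]
  exact sum_mem fun q _ => sub_mem_twistRel' u χ _ _

theorem mem_of_isUnit_smul_mem {S : Submodule R M} {c : R} (hc : IsUnit c) {m : M}
    (h : c • m ∈ S) : m ∈ S := by
  obtain ⟨c, rfl⟩ := hc
  have := S.smul_mem ((c⁻¹ : Rˣ) : R) h
  rwa [smul_smul, Units.inv_mul, one_smul] at this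

/-- Passing to twisted coinvariants does not create `l`-torsion. -/
theorem saturated_sup_twistRel {u : K → Module.End R M} (hu : IsSmoothAction u) {χ : AddChar K R}
    {δ : ℝ} (hδ : 0 < δ) (hχ : ∀ d, LocalNorm.v d ≤ δ → χ d = 1) {l : ℕ} (hl : l.Prime)
    (hR : ∀ n : ℕ, ¬ l ∣ n → IsUnit (n : R)) (hv : LocalNorm.v (l : K) = 1)
    {S : Submodule R M} (hS : ∀ x, ∀ s ∈ S, u x s ∈ S) (hsat : ∀ m, l • m ∈ S → m ∈ S) {m : M}
    (hm : l • m ∈ S ⊔ twistRel u χ) : m ∈ S ⊔ twistRel u χ := by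
  obtain ⟨r, ε, hr, hε, h⟩ := exists_mem_twistRelBall hu χ hm
  have hε' : 0 < min ε δ := lt_min hε hδ
  -- The twisted sum sends the relations used for l • m into S, while on m it equals the order of
  -- the quotient times m up to relations. That order is prime to l, hence a unit.
  have h1 := ballSum_mem hu hr hε' (fun d hd => hχ d (hd.trans (min_le_right _ _))) hS
    (sup_le_sup_left (twistRelBall_mono u χ le_rfl (min_le_left _ _)) S h)
  rw [map_nsmul] at h1
  have h2 := hsat _ h1
  have h3 := Submodule.sub_mem _ (Submodule.mem_sup_left (T := twistRel u χ) h2)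
    (Submodule.mem_sup_right (S := S) (ballSum_sub_mem u χ hr hε' m))
  rw [sub_sub_cancel] at h3
  exact mem_of_isUnit_smul_mem (hR _ (BallQuot.not_dvd_card K hr hε' hl hv)) h3

end Coinvariants

/-! ### Detecting vectors in twisted coinvariants -/

section Detection

variable {K : Type*} [Field K] [TopologicalSpace K] [IsTopologicalRing K] [LocalNorm K]
  {R M : Type*} [CommRing R] [IsDomain R] [AddCommGroup M] [Module R M]

theorem exists_mulShift_eq_one {ψ : AddChar K R} {δ : ℝ} (hδ : 0 < δ)
    (hψ : ∀ d, LocalNorm.v d ≤ δ → ψ d = 1) (a : K) :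
    ∃ δ' : ℝ, 0 < δ' ∧ ∀ d, LocalNorm.v d ≤ δ' → ψ.mulShift a d = 1 := by
  have ha := LocalNorm.v.nonneg a
  refine ⟨δ / (LocalNorm.v a + 1), div_pos hδ (by linarith), fun d hd => ?_⟩
  rw [AddChar.mulShift_apply]
  refine hψ _ ?_
  rw [le_div_iff₀ (by linarith)] at hd
  rw [map_mul]
  nlinarith [LocalNorm.v.nonneg d]

/-- On a ball of radius r the character ψ(a ·) does not change under small changes of a. Compactness
of the ball of frequencies a thus leaves finitely many cases and yields common radii. The bound C *
ε ≤ δ makes all these characters trivial on the ball of radius ε. -/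
theorem exists_bounds {u : K → Module.End R M} (hu : IsSmoothAction u) (ψ : AddChar K R) {δ : ℝ}
    (hδ : 0 < δ) (hψ : ∀ d, LocalNorm.v d ≤ δ → ψ d = 1) {S : Submodule R M} {m : M}
    (H : ∀ a, m ∈ S ⊔ twistRel u (ψ.mulShift a)) {C : ℝ} (hC : 0 < C) :
    ∃ r ε : ℝ, 0 ≤ r ∧ 0 < ε ∧ C * ε ≤ δ ∧
      ∀ a, LocalNorm.v a ≤ C → m ∈ S ⊔ twistRelBall u (ψ.mulShift a) r ε := by
  choose r e hr he hmem using fun a => exists_mem_twistRelBall hu _ (H a)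
  have hpos : ∀ a, 0 < δ / (r a + 1) := fun a => div_pos hδ (by linarith [hr a])
  obtain ⟨t, -, ht⟩ := (LocalNorm.isCompact_ball (K := K) C).elim_nhds_subcover
    (fun a => {a' | LocalNorm.v (a' - a) ≤ δ / (r a + 1)})
    (fun a _ => LocalNorm.eventually_le a (hpos a))
  have h1 : ∀ᶠ ε in 𝓝[>] (0 : ℝ), ∀ a ∈ t, ε ≤ e a :=
    (Finset.eventually_all t).2 fun a _ => by
      filter_upwards [Ioc_mem_nhdsGT (he a)] with ε hε using hε.2
  obtain ⟨ε, ⟨hε, hε'⟩, hε0⟩ := ((h1.and (Ioc_mem_nhdsGT (div_pos hδ hC))).and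
    self_mem_nhdsWithin).exists
  refine ⟨∑ a ∈ t, r a, ε, Finset.sum_nonneg fun a _ => hr a, hε0, ?_, fun a ha => ?_⟩
  · have := hε'.2
    rwa [le_div_iff₀ hC, mul_comm] at this
  · obtain ⟨a', ha't, ha'⟩ := Set.mem_iUnion₂.1 (ht ha)
    have h2 : r a' ≤ ∑ a ∈ t, r a := Finset.single_le_sum (fun a _ => hr a) ha't
    refine sup_le_sup_left (twistRelBall_mono u _ h2 (hε a' ha't)) S ?_
    rw [twistRelBall_congr u (χ' := ψ.mulShift a')]
    · exact hmem a'
    · intro x hx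
      rw [AddChar.mulShift_apply, AddChar.mulShift_apply,
        show a * x = a' * x + (a - a') * x by ring, AddChar.map_add_eq_mul, hψ ((a - a') * x),
        mul_one]
      rw [map_mul]
      have h3 : LocalNorm.v (a - a') ≤ δ / (r a' + 1) := ha'
      rw [le_div_iff₀ (by linarith [hr a'])] at h3
      exact (mul_le_mul_of_nonneg_left (by linarith) (LocalNorm.v.nonneg _)).trans h3

/-- A vector outside a stable submodule stays outside after passing to suitable twisted
coinvariants. -/
theorem exists_notMem_sup_twistRel {u : K → Module.End R M} (hu : IsSmoothAction u)
    (ψ : AddChar K R) {δ : ℝ} (hδ : 0 < δ) (hψ : ∀ d, LocalNorm.v d ≤ δ → ψ d = 1) {x₀ : K}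
    (hx₀ : ψ x₀ ≠ 1) {l : ℕ} (hl : l.Prime) (hR : ∀ n : ℕ, ¬ l ∣ n → IsUnit (n : R))
    (hv : LocalNorm.v (l : K) = 1) {S : Submodule R M} (hS : ∀ x, ∀ s ∈ S, u x s ∈ S) {m : M}
    (hm : m ∉ S) : ∃ a, m ∉ S ⊔ twistRel u (ψ.mulShift a) := by
  by_contra! H
  obtain ⟨ε₀, hε₀, hmε⟩ := hu.smooth m
  have hx : 0 < LocalNorm.v x₀ := LocalNorm.v.pos fun h => hx₀ (by
    rw [h, AddChar.map_zero_eq_one])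
  -- With this C, an x for which ψ(y x) = 1 whenever |y| ≤ C must satisfy |x| ≤ ε₀ and so fix m:
  -- otherwise y = x₀ / x is allowed and gives ψ(x₀) = 1.
  set C : ℝ := LocalNorm.v x₀ / ε₀ with hCdef
  have hC : 0 < C := div_pos hx hε₀
  obtain ⟨r, ε, hr, hε, hCε, hmem⟩ := exists_bounds hu ψ hδ hψ H hC
  have hsmall : ∀ {a d : K}, LocalNorm.v a ≤ C → LocalNorm.v d ≤ ε → ψ (a * d) = 1 := by
    intro a d ha hd
    refine hψ _ ?_
    rw [map_mul]
    exact (mul_le_mul ha hd (LocalNorm.v.nonneg _) hC.le).trans hCε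
  -- Frequencies that differ by at most δ / (r + 1) give the same character on the ball of radius r,
  -- so the sum over frequencies is finite.
  have hc : 0 < δ / (r + 1) := div_pos hδ (by linarith)
  have hsmall' : ∀ {a d : K}, LocalNorm.v a ≤ r → LocalNorm.v d ≤ δ / (r + 1) →
      ψ (a * d) = 1 := by
    intro a d ha hd
    refine hψ _ ?_
    rw [map_mul]
    rw [le_div_iff₀ (by linarith)] at hd
    nlinarith [LocalNorm.v.nonneg d]
  -- If m died in the coinvariants for every frequency, each twisted average of m would lie in S,
  -- and so would their sum.
  have h1 : ∑ a : BallQuot K hC.le hc, ballSum u (ψ.mulShift a.rep) hr hε m ∈ S :=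
    sum_mem fun a _ => ballSum_mem hu hr hε (fun d hd => hsmall a.v_rep hd) hS
      (hmem _ a.v_rep)
  let A : AddSubgroup K :=
    { carrier := {x | ∀ y, LocalNorm.v y ≤ C → ψ (y * x) = 1}
      zero_mem' := fun y _ => by rw [mul_zero, AddChar.map_zero_eq_one]
      add_mem' := fun {a b} ha hb y hy => by
        rw [mul_add, AddChar.map_add_eq_mul, ha y hy, hb y hy, mul_one]
      neg_mem' := fun {a} ha y hy => by
        rw [mul_neg, ← neg_mul]
        exact ha _ (by rwa [LocalNorm.v.map_neg]) }
  have hA : LocalNorm.ball K ε hε.le ≤ A := fun d hd y hy => hsmall hy hd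
  have hAε : ∀ x ∈ A, LocalNorm.v x ≤ ε₀ := by
    intro x hxA
    by_contra! hlt
    have hx0 : x ≠ 0 := by
      rintro rfl
      rw [map_zero] at hlt
      exact hlt.not_gt hε₀
    refine hx₀ ?_
    have := hxA (x₀ / x) (by
      rw [map_div₀, hCdef]
      exact div_le_div_of_nonneg_left hx.le hε₀ hlt.le)
    rwa [div_mul_cancel₀ _ hx0] at this
  -- Fourier inversion: by orthogonality only the classes in A survive the sum over frequencies, and
  -- these fix m. What remains is a unit times m.
  have h2 : ∑ a : BallQuot K hC.le hc, ballSum u (ψ.mulShift a.rep) hr hε m =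
      ((Nat.card (BallQuot K hC.le hc) : R) *
        (Nat.card (BallQuot.image A : AddSubgroup (BallQuot K hr hε)) : R)) • m := by
    classical
    simp only [ballSum_apply, AddChar.mulShift_apply]
    rw [Finset.sum_comm]
    have h3 : ∀ q : BallQuot K hr hε,
        ∑ a : BallQuot K hC.le hc, ψ (a.rep * -q.rep) • u q.rep m =
          if q ∈ BallQuot.image A then (Nat.card (BallQuot K hC.le hc) : R) • m else 0 := by
      intro q
      rw [← Finset.sum_smul]
      split_ifs with hq
      · rw [BallQuot.mem_image hA] at hq
        rw [hmε _ (hAε _ hq)]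
        congr 1
        rw [Finset.sum_congr rfl fun a _ => A.neg_mem hq _ a.v_rep, Finset.sum_const,
          Finset.card_univ, Nat.card_eq_fintype_card, nsmul_eq_mul, mul_one]
      · have h4 : ∃ y, LocalNorm.v y ≤ C ∧ ψ (y * -q.rep) ≠ 1 := by
          by_contra! h5
          refine hq ((BallQuot.mem_image hA).2 ?_)
          have : -q.rep ∈ A := h5
          exact neg_mem_iff.1 this
        obtain ⟨y, hy, hy'⟩ := h4
        have h5 := BallQuot.sum_char_eq_zero hC.le hc (χ := ψ.mulShift (-q.rep)) (y := y)
          (fun d hd => hsmall' (by rw [LocalNorm.v.map_neg]; exact q.v_rep) hd) hy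
          (by rwa [AddChar.mulShift_apply, mul_comm])
        simp only [AddChar.mulShift_apply, mul_comm (-q.rep)] at h5
        rw [h5, zero_smul]
    rw [Finset.sum_congr rfl fun q _ => h3 q, ← Finset.sum_filter, Finset.sum_const,
      ← Nat.cast_smul_eq_nsmul R, smul_smul, mul_comm]
    congr 3
    rw [Nat.card_eq_fintype_card, Fintype.card_subtype]
  rw [h2] at h1
  exact hm (mem_of_isUnit_smul_mem ((hR _ (BallQuot.not_dvd_card K _ _ hl hv)).mul
    (BallQuot.isUnit_card hl hR hv _)) h1)

end Detection

/-! ### Comparison of twisted coinvariants along a cyclic extension -/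

/-- The nonfixed points fall into orbits of exact length l. Each such q has exactly one j < l with
π^j q in the set t of representatives; inserting this indicator and reindexing collects the sum into
orbit sums. -/
theorem sum_mem_of_orbit_sum_mem {R M Q : Type*} [Ring R] [AddCommGroup M] [Module R M]
    [Fintype Q] [DecidableEq Q] (π : Q → Q) {l : ℕ} (hl : l.Prime) (hπ : ∀ q, π^[l] q = q)
    (f : Q → M) (S : Submodule R M) (h : ∀ q, ∑ j ∈ Finset.range l, f (π^[j] q) ∈ S) :
    ∑ q with π q ≠ q, f q ∈ S := by
  classical
  obtain ⟨t, ht⟩ := exists_orbit_reps π hl hπ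
  have hfix : ∀ j q, π (π^[j] q) = π^[j] q → π q = q ∨ l < j := by
    intro j q hq
    by_cases hj : l < j
    · exact Or.inr hj
    · left
      have h1 : ∀ n, π^[n] (π^[j] q) = π^[j] q := fun n => Function.iterate_fixed hq n
      have h2 : q = π^[j] q := by
        rw [← h1 (l - j), ← Function.iterate_add_apply, Nat.sub_add_cancel (not_lt.1 hj), hπ]
      rw [h2, hq]
  have h1 : ∑ q with π q ≠ q, f q = ∑ j ∈ Finset.range l, ∑ q with π q ≠ q,
      if π^[j] q ∈ t then f q else 0 := by
    rw [Finset.sum_comm]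
    refine Finset.sum_congr rfl fun q hq => ?_
    obtain ⟨i, hi, hij⟩ := ht q (Finset.mem_filter.1 hq).2
    rw [Finset.sum_eq_single_of_mem i (Finset.mem_range.2 hi), if_pos ((hij i hi).2 rfl)]
    intro j hj hji
    exact if_neg fun h => hji ((hij j (Finset.mem_range.1 hj)).1 h)
  have h2 : ∀ j ∈ Finset.range l, (∑ q with π q ≠ q, if π^[j] q ∈ t then f q else 0) =
      ∑ q with π q ≠ q, if q ∈ t then f (π^[l - j] q) else 0 := by
    intro j hj
    have hj' := (Finset.mem_range.1 hj).le
    have e1 : ∀ q, π^[l - j] (π^[j] q) = q := fun q => by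
      rw [← Function.iterate_add_apply, Nat.sub_add_cancel hj', hπ]
    have e2 : ∀ q, π^[j] (π^[l - j] q) = q := fun q => by
      rw [← Function.iterate_add_apply, Nat.add_sub_cancel' hj', hπ]
    refine Finset.sum_nbij' (fun q => π^[j] q) (fun q => π^[l - j] q) ?_ ?_
      (fun q _ => e1 q) (fun q _ => e2 q) fun q _ => by simp only [e1]
    · intro q hq
      rw [Finset.mem_filter] at hq ⊢
      exact ⟨Finset.mem_univ _, fun h => (hfix j q h).elim hq.2 hj'.not_gt⟩
    · intro q hq
      rw [Finset.mem_filter] at hq ⊢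
      exact ⟨Finset.mem_univ _, fun h => (hfix (l - j) q h).elim hq.2 (Nat.sub_le l j).not_gt⟩
  rw [h1, Finset.sum_congr rfl h2, Finset.sum_comm]
  refine sum_mem fun q _ => ?_
  by_cases hq : q ∈ t
  · simp only [if_pos hq]
    rw [← Finset.sum_range_reflect]
    have h3 := h (π q)
    convert h3 using 2 with j hj
    have hj' := Finset.mem_range.1 hj
    rw [← Function.iterate_succ_apply]
    congr 2
    lia
  · simp only [if_neg hq, Finset.sum_const_zero]
    exact S.zero_mem

namespace IsCyclicLocal

variable {F E : Type*} [Field F] [Field E] [Algebra F E] [TopologicalSpace F] [TopologicalSpace E]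
  [IsTopologicalRing F] [IsTopologicalRing E] [LocalNorm F] [LocalNorm E] {γ : E ≃ₐ[F] E} {l : ℕ}
  {R M : Type*} [CommRing R] [AddCommGroup M] [Module R M]

/-- The pullback to `E` of a character of `F` along the averaging projection. -/
def pullChar (h : IsCyclicLocal γ l) (χ : AddChar F R) : AddChar E R where
  toFun x := χ (h.avg x)
  map_zero_eq_one' := by
    have h0 : h.avg 0 = 0 := by simpa using h.avg_algebraMap 0
    rw [h0, AddChar.map_zero_eq_one]
  map_add_eq_mul' x y := by rw [h.avg_add, AddChar.map_add_eq_mul]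

theorem pullChar_apply (h : IsCyclicLocal γ l) (χ : AddChar F R) (x : E) :
    h.pullChar χ x = χ (h.avg x) := rfl

theorem pullChar_algebraMap (h : IsCyclicLocal γ l) (χ : AddChar F R) (x : F) :
    h.pullChar χ (algebraMap F E x) = χ x := by rw [pullChar_apply, h.avg_algebraMap]

theorem pullChar_gal (h : IsCyclicLocal γ l) (χ : AddChar F R) (x : E) :
    h.pullChar χ (γ x) = h.pullChar χ x := by rw [pullChar_apply, h.avg_gal, pullChar_apply]

theorem pullChar_eq_one (h : IsCyclicLocal γ l) {χ : AddChar F R} {δ : ℝ}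
    (hχ : ∀ d, LocalNorm.v d ≤ δ → χ d = 1) {d : E} (hd : LocalNorm.v d ≤ δ) :
    h.pullChar χ d = 1 := hχ _ ((h.v_avg_le d).trans hd)

theorem v_natCast_base (h : IsCyclicLocal γ l) : LocalNorm.v (l : F) = 1 := by
  rw [← h.v_algebraMap, map_natCast, h.v_natCast]

theorem _root_.SteinbergTate.IsSmoothAction.comp_algebraMap (h : IsCyclicLocal γ l)
    {u : E → Module.End R M} (hu : IsSmoothAction u) :
    IsSmoothAction fun x : F => u (algebraMap F E x) where
  map_zero := by rw [_root_.map_zero, hu.map_zero]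
  map_add x y := by rw [_root_.map_add, hu.map_add]
  smooth m := by
    obtain ⟨ε, hε, hm⟩ := hu.smooth m
    exact ⟨ε, hε, fun x hx => hm _ (by rwa [h.v_algebraMap])⟩

theorem pow_mul_apply {u : E → Module.End R M} {T : Module.End R M}
    (hT : ∀ x, T * u x = u (γ x) * T) (j : ℕ) (x : E) : T ^ j * u x = u (γ^[j] x) * T ^ j := by
  induction j with
  | zero => rw [pow_zero, one_mul, mul_one, Function.iterate_zero_apply]
  | succ j ih =>
    rw [pow_succ', mul_assoc, ih, ← mul_assoc, hT, Function.iterate_succ_apply', mul_assoc]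

theorem pow_sub_mem (T : Module.End R M) (j : ℕ) (m : M) :
    (T ^ j) m - m ∈ LinearMap.range (1 - T) := by
  induction j with
  | zero => simp
  | succ j ih =>
    have h : (T ^ (j + 1)) m - m = ((T ^ j) m - m) - (1 - T) ((T ^ j) m) := by
      rw [pow_succ', Module.End.mul_apply, LinearMap.sub_apply, Module.End.one_apply]
      abel
    rw [h]
    exact Submodule.sub_mem _ ih ⟨_, rfl⟩

theorem sub_tateNorm_mem_range (T : Module.End R M) (l : ℕ) (m : M) :
    l • m - tateNorm T l m ∈ LinearMap.range (1 - T) := by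
  have h1 : l • m - tateNorm T l m = ∑ i ∈ Finset.range l, (m - (T ^ i) m) := by
    rw [Finset.sum_sub_distrib, Finset.sum_const, Finset.card_range, tateNorm,
      LinearMap.sum_apply]
  rw [h1]
  refine sum_mem fun i _ => ?_
  have h2 := Submodule.neg_mem _ (pow_sub_mem T i m)
  rwa [neg_sub] at h2

/-- Since u(γ^j x) = T^j u(x) T^(-j) and T is trivial modulo im(1 - T), the sum is congruent to u(x)
applied to the norm of m, which lies in S. -/
theorem sum_iterate_mem {u : E → Module.End R M} {T : Module.End R M}
    (hT : ∀ x, T * u x = u (γ x) * T) (hTl : T ^ l = 1) {S : Submodule R M}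
    (hS : ∀ x, ∀ s ∈ S, u x s ∈ S) {m : M} (hm : tateNorm T l m ∈ S) (x : E) :
    ∑ j ∈ Finset.range l, u (γ^[j] x) m ∈ S ⊔ LinearMap.range (1 - T) := by
  have h1 : ∀ j ∈ Finset.range l, u (γ^[j] x) m = (T ^ j) (u x ((T ^ (l - j)) m)) := by
    intro j hj
    rw [← Module.End.mul_apply, pow_mul_apply hT, Module.End.mul_apply,
      ← Module.End.mul_apply (T ^ j), ← pow_add, Nat.add_sub_cancel' (Finset.mem_range.1 hj).le,
      hTl, Module.End.one_apply]
  have h2 : ∑ j ∈ Finset.range l, (T ^ (l - j)) m = tateNorm T l m := by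
    have h3 := Finset.sum_range_succ (fun j => (T ^ (l - j)) m) l
    have h4 := Finset.sum_range_reflect (fun j => (T ^ j) m) (l + 1)
    have h5 := Finset.sum_range_succ (fun j => (T ^ j) m) l
    simp only [Nat.add_sub_cancel, Nat.sub_self, pow_zero, hTl] at h3 h4 h5
    rw [tateNorm, LinearMap.sum_apply]
    exact add_right_cancel (h3.symm.trans (h4.trans h5))
  have h6 : ∑ j ∈ Finset.range l, u (γ^[j] x) m = u x (tateNorm T l m) +
      ∑ j ∈ Finset.range l, ((T ^ j) (u x ((T ^ (l - j)) m)) - u x ((T ^ (l - j)) m)) := by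
    rw [Finset.sum_sub_distrib, ← map_sum, h2, add_sub_cancel]
    exact Finset.sum_congr rfl h1
  rw [h6]
  exact Submodule.add_mem_sup (hS _ _ hm) (sum_mem fun j _ => pow_sub_mem T j _)

/-- A vector of norm zero that dies in the twisted coinvariants over `E` already dies in the
coinvariants of the Galois group and those over `F`. -/
theorem mem_sup_twistRel_base (h : IsCyclicLocal γ l) (hR : ∀ n : ℕ, ¬ l ∣ n → IsUnit (n : R))
    {u : E → Module.End R M} (hu : IsSmoothAction u) {T : Module.End R M}
    (hT : ∀ x, T * u x = u (γ x) * T) (hTl : T ^ l = 1) {χ : AddChar F R} {δ : ℝ} (hδ : 0 < δ)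
    (hχ : ∀ d, LocalNorm.v d ≤ δ → χ d = 1) {S : Submodule R M}
    (hS : ∀ x, ∀ s ∈ S, u x s ∈ S) {m : M} (hm : tateNorm T l m ∈ S)
    (hmem : m ∈ S ⊔ twistRel u (h.pullChar χ)) :
    m ∈ S ⊔ LinearMap.range (1 - T) ⊔ twistRel (fun x : F => u (algebraMap F E x)) χ := by
  classical
  obtain ⟨r, ε₁, hr, hε₁, hmem⟩ := exists_mem_twistRelBall hu _ hmem
  obtain ⟨ε₂, hε₂, hmε⟩ := hu.smooth m
  obtain ⟨ε, hε, hε1, hε2, hε3⟩ : ∃ ε : ℝ, 0 < ε ∧ ε ≤ ε₁ ∧ ε ≤ ε₂ ∧ ε ≤ δ :=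
    ⟨min ε₁ (min ε₂ δ), lt_min hε₁ (lt_min hε₂ hδ), min_le_left _ _,
      (min_le_right _ _).trans (min_le_left _ _), (min_le_right _ _).trans (min_le_right _ _)⟩
  have hχE : ∀ d : E, LocalNorm.v d ≤ ε → h.pullChar χ d = 1 := fun d hd =>
    h.pullChar_eq_one hχ (hd.trans hε3)
  -- The sum of f over all classes of the ball in E lies in S. Below it is split into the classes
  -- moved by γ and those fixed by γ.
  have hP := ballSum_mem hu hr hε hχE hS
    (sup_le_sup_left (twistRelBall_mono u _ le_rfl hε1) S hmem)
  let f : E → M := fun x => h.pullChar χ (-x) • u x m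
  have hf : ∀ x d, LocalNorm.v d ≤ ε → f (x + d) = f x :=
    twist_add_eq hu hχE fun d hd => hmε d (hd.trans hε2)
  let g : LocalNorm.ball E r hr → LocalNorm.ball E r hr := fun x =>
    ⟨γ x, (h.v_gal _).le.trans x.2⟩
  let π : BallQuot E hr hε → BallQuot E hr hε := fun q =>
    BallQuot.mk hr hε (g ⟨q.rep, q.v_rep⟩)
  have hπmk : ∀ x, π (BallQuot.mk hr hε x) = BallQuot.mk hr hε (g x) := by
    intro x
    refine BallQuot.mk_eq.2 ?_
    change LocalNorm.v (γ x - γ _) ≤ ε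
    rw [← map_sub, h.v_gal]
    exact BallQuot.v_sub_rep x
  have hπit : ∀ j x, π^[j] (BallQuot.mk hr hε x) = BallQuot.mk hr hε (g^[j] x) := by
    intro j
    induction j with
    | zero => intro x; rfl
    | succ j ih => intro x; rw [Function.iterate_succ_apply, hπmk, ih]; rfl
  have hgit : ∀ j x, ((g^[j] x : LocalNorm.ball E r hr) : E) = γ^[j] x := by
    intro j
    induction j with
    | zero => intro x; rfl
    | succ j ih => intro x; rw [Function.iterate_succ_apply, ih]; rfl
  have hπl : ∀ q, π^[l] q = q := by
    intro q
    conv_lhs => rw [← BallQuot.mk_rep q]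
    conv_rhs => rw [← BallQuot.mk_rep q]
    rw [hπit]
    exact congrArg _ (Subtype.ext ((hgit _ _).trans (h.iterate_eq _)))
  -- The coefficient of f is constant along γ-orbits, so `sum_iterate_mem` applies to each orbit.
  have h1 : ∑ q with π q ≠ q, f q.rep ∈ S ⊔ LinearMap.range (1 - T) := by
    refine sum_mem_of_orbit_sum_mem π h.prime hπl (fun q => f q.rep) _ fun q => ?_
    have h2 : ∀ j, f (π^[j] q).rep = h.pullChar χ (-q.rep) • u (γ^[j] q.rep) m := by
      intro j
      conv_lhs => rw [← BallQuot.mk_rep q]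
      rw [hπit, BallQuot.apply_rep_mk hf, hgit]
      have h3 : h.pullChar χ (-γ^[j] q.rep) = h.pullChar χ (-q.rep) := by
        induction j with
        | zero => rfl
        | succ j ih => rw [Function.iterate_succ_apply', ← map_neg, h.pullChar_gal, ih]
      change h.pullChar χ (-γ^[j] q.rep) • u (γ^[j] q.rep) m = _
      rw [h3]
    rw [Finset.sum_congr rfl fun j _ => h2 j, ← Finset.smul_sum]
    exact Submodule.smul_mem _ _ (sum_iterate_mem hT hTl hS hm _)
  let A : AddSubgroup E :=
    { carrier := {x | LocalNorm.v (γ x - x) ≤ ε}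
      zero_mem' := by simpa using hε.le
      add_mem' := fun {a b} ha hb => by
        have h2 : γ (a + b) - (a + b) = (γ a - a) + (γ b - b) := by rw [map_add]; ring
        change LocalNorm.v (γ (a + b) - (a + b)) ≤ ε
        rw [h2]
        exact (LocalNorm.ball E ε hε.le).add_mem ha hb
      neg_mem' := fun {a} ha => by
        have h2 : γ (-a) - (-a) = -(γ a - a) := by rw [map_neg]; ring
        change LocalNorm.v (γ (-a) - (-a)) ≤ ε
        rw [h2]
        exact (LocalNorm.ball E ε hε.le).neg_mem ha }
  have hA : LocalNorm.ball E ε hε.le ≤ A := fun d hd =>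
    (LocalNorm.ball E ε hε.le).sub_mem (show LocalNorm.v (γ d) ≤ ε by rwa [h.v_gal]) hd
  have hmemA : ∀ q : BallQuot E hr hε, q ∈ BallQuot.image A ↔ π q = q := by
    intro q
    rw [BallQuot.mem_image hA]
    conv_rhs => rw [eq_comm, ← BallQuot.mk_rep q, hπmk, BallQuot.mk_eq]
    rfl
  -- A fixed class has an F-rational representative, so its term is m up to a relation over F. The
  -- number of fixed classes is the order of the subgroup `BallQuot.image A`, a unit in R.
  have h4 : ∑ q with π q = q, f q.rep -
      (Nat.card (BallQuot.image A : AddSubgroup (BallQuot E hr hε)) : R) • m ∈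
        twistRel (fun x : F => u (algebraMap F E x)) χ := by
    have h5 : Nat.card (BallQuot.image A : AddSubgroup (BallQuot E hr hε)) =
        (Finset.univ.filter fun q => π q = q).card := by
      rw [Nat.card_eq_fintype_card, Fintype.card_subtype]
      exact congrArg Finset.card (Finset.filter_congr fun q _ => hmemA q)
    rw [h5, Nat.cast_smul_eq_nsmul, ← Finset.sum_const, ← Finset.sum_sub_distrib]
    refine sum_mem fun q hq => ?_
    have hq' : LocalNorm.v (γ q.rep - q.rep) ≤ ε :=
      (BallQuot.mem_image hA).1 ((hmemA q).2 (Finset.mem_filter.1 hq).2)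
    have h6 := hf (algebraMap F E (h.avg q.rep)) _ (h.v_sub_avg_le hε.le hq')
    rw [add_sub_cancel] at h6
    have h7 : f (algebraMap F E (h.avg q.rep)) =
        χ (-h.avg q.rep) • u (algebraMap F E (h.avg q.rep)) m := by
      change h.pullChar χ (-_) • _ = _
      rw [← map_neg, h.pullChar_algebraMap]
    rw [h6, h7]
    exact sub_mem_twistRel' (fun x : F => u (algebraMap F E x)) χ _ m
  rw [ballSum_apply] at hP
  have h8 := Finset.sum_filter_add_sum_filter_not Finset.univ
    (fun q : BallQuot E hr hε => π q = q) fun q => f q.rep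
  refine mem_of_isUnit_smul_mem (BallQuot.isUnit_card h.prime hR h.v_natCast
    (BallQuot.image A : AddSubgroup (BallQuot E hr hε))) ?_
  have h9 : ∑ q with π q = q, f q.rep ∈ S ⊔ LinearMap.range (1 - T) := by
    have h10 : ∑ q with π q = q, f q.rep = (∑ q : BallQuot E hr hε, f q.rep) -
        ∑ q with π q ≠ q, f q.rep := eq_sub_of_add_eq h8
    rw [h10]
    exact Submodule.sub_mem _ (Submodule.mem_sup_left hP) h1
  have h11 := Submodule.sub_mem _
    (Submodule.mem_sup_left (T := twistRel (fun x : F => u (algebraMap F E x)) χ) h9)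
    (Submodule.mem_sup_right (S := S ⊔ LinearMap.range (1 - T)) h4)
  rwa [sub_sub_cancel] at h11

/-- A vector of norm zero that is nonzero in the coinvariants of the Galois group stays nonzero in
suitable twisted coinvariants over `E`. -/
theorem exists_notMem_sup_twistRel (h : IsCyclicLocal γ l) [IsDomain R]
    (hR : ∀ n : ℕ, ¬ l ∣ n → IsUnit (n : R))
    {u : E → Module.End R M} (hu : IsSmoothAction u) {T : Module.End R M}
    (hT : ∀ x, T * u x = u (γ x) * T) (hTl : T ^ l = 1) (ψ : AddChar F R) {δ : ℝ} (hδ : 0 < δ)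
    (hψ : ∀ d, LocalNorm.v d ≤ δ → ψ d = 1) {x₀ : F} (hx₀ : ψ x₀ ≠ 1) {S : Submodule R M}
    (hS : ∀ x, ∀ s ∈ S, u x s ∈ S) {m : M} (hm : tateNorm T l m ∈ S)
    (hmem : m ∉ S ⊔ LinearMap.range (1 - T)) :
    ∃ a : F, m ∉ S ⊔ twistRel u (h.pullChar (ψ.mulShift a)) ⊔ LinearMap.range (1 - T) := by
  have hS' : ∀ x : F, ∀ s ∈ S ⊔ LinearMap.range (1 - T),
      u (algebraMap F E x) s ∈ S ⊔ LinearMap.range (1 - T) := by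
    intro x s hs
    obtain ⟨s, hs', _, ⟨w, rfl⟩, rfl⟩ := Submodule.mem_sup.1 hs
    rw [_root_.map_add]
    refine Submodule.add_mem_sup (hS _ _ hs') ⟨u (algebraMap F E x) w, ?_⟩
    have h1 := hT (algebraMap F E x)
    rw [γ.commutes] at h1
    simp only [LinearMap.sub_apply, Module.End.one_apply, map_sub]
    rw [← Module.End.mul_apply, h1, Module.End.mul_apply]
  obtain ⟨a, ha⟩ := SteinbergTate.exists_notMem_sup_twistRel (hu.comp_algebraMap h) ψ hδ hψ hx₀
    h.prime hR h.v_natCast_base hS' hmem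
  refine ⟨a, fun hmem' => ha ?_⟩
  -- Write m = w + d with d in im(1 - T). Then d has norm 0, so the norm of w is that of m and lies
  -- in S; `mem_sup_twistRel_base` applied to w contradicts the choice of a.
  obtain ⟨w, hw, d, hd, rfl⟩ := Submodule.mem_sup.1 hmem'
  refine Submodule.add_mem _ ?_ (Submodule.mem_sup_left (Submodule.mem_sup_right hd))
  have hN : tateNorm T l d = 0 := by
    obtain ⟨e, rfl⟩ := hd
    have h2 : tateNorm T l * (1 - T) = 0 := by
      rw [tateNorm, geom_sum_mul_neg, hTl, sub_self]
    exact LinearMap.congr_fun h2 e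
  rw [_root_.map_add, hN, add_zero] at hm
  obtain ⟨δ', hδ', hψ'⟩ := exists_mulShift_eq_one hδ hψ a
  exact h.mem_sup_twistRel_base hR hu hT hTl hδ' hψ' hS hm hw

end IsCyclicLocal

/-! ### The lower unipotent group -/

section LowerUnip

variable {K : Type*} [Field K]

theorem lowerUnip_mul (x y : Fin 3 → K) : lowerUnip x * lowerUnip y =
    lowerUnip ![x 0 + y 0, x 1 + y 1, x 2 + y 2 + x 1 * y 0] := by
  ext i j
  fin_cases i <;> fin_cases j <;>
    simp [lowerUnip, Matrix.mul_apply, Fin.sum_univ_three, add_comm, add_left_comm]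

theorem lowerUnip_zero : lowerUnip (0 : Fin 3 → K) = 1 := by
  ext i j
  fin_cases i <;> fin_cases j <;> simp [lowerUnip]

theorem map_lowerUnip {L : Type*} [Field L] (σ : K →+* L) (x : Fin 3 → K) :
    GeneralLinearGroup.map σ (lowerUnip x) = lowerUnip fun i => σ (x i) := by
  ext i j
  rw [GeneralLinearGroup.map_apply]
  fin_cases i <;> fin_cases j <;> simp [lowerUnip]

theorem lowerUnip_single_mul (i : Fin 3) (s t : K) :
    lowerUnip (Pi.single i s) * lowerUnip (Pi.single i t) = lowerUnip (Pi.single i (s + t)) := by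
  rw [lowerUnip_mul]
  congr 1
  ext j
  fin_cases i <;> fin_cases j <;> simp

theorem lowerUnip_single_two_mul (i : Fin 3) (s t : K) :
    lowerUnip (Pi.single 2 s) * lowerUnip (Pi.single i t) =
      lowerUnip (Pi.single i t) * lowerUnip (Pi.single 2 s) := by
  rw [lowerUnip_mul, lowerUnip_mul]
  congr 1
  ext j
  fin_cases i <;> fin_cases j <;> simp [add_comm]

theorem lowerUnip_single_zero_mul_single_one (s t : K) :
    lowerUnip (Pi.single 0 s) * lowerUnip (Pi.single 1 t) =
      lowerUnip (Pi.single 2 (-(t * s))) * lowerUnip (Pi.single 1 t) *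
        lowerUnip (Pi.single 0 s) := by
  rw [lowerUnip_mul, lowerUnip_mul, lowerUnip_mul]
  congr 1
  ext j
  fin_cases j <;> simp

theorem lowerUnip_eq_mul (c : Fin 3 → K) : lowerUnip c =
    lowerUnip (Pi.single 0 (c 0)) * lowerUnip (Pi.single 1 (c 1)) *
      lowerUnip (Pi.single 2 (c 2)) := by
  rw [lowerUnip_mul, lowerUnip_mul]
  congr 1
  ext j
  fin_cases j <;> simp

/-- An element of `GL₂ ⊂ GL₃` that moves the vector `(a, b)` to `(0, a)`. -/
def rotation (a b : K) (ha : a ≠ 0) : GL (Fin 3) K where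
  val := !![b, -a, 0; 1, 0, 0; 0, 0, 1]
  inv := !![0, 1, 0; -a⁻¹, b * a⁻¹, 0; 0, 0, 1]
  val_inv := by
    ext i j
    fin_cases i <;> fin_cases j <;> simp [Matrix.mul_apply, Fin.sum_univ_three, ha] <;>
      (field_simp; ring)
  inv_val := by
    ext i j
    fin_cases i <;> fin_cases j <;> simp [Matrix.mul_apply, Fin.sum_univ_three, ha] <;>
      (field_simp; ring)

/-- Coordinates 2 and 1 are the entries of the last row, which GL₂ transforms linearly by right
multiplication. A pair of characters on them can therefore be moved as a vector. -/
theorem conj_rotation_single_two {F : Type*} [Field F] [Algebra F K] {a b : F} (ha : a ≠ 0)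
    (t : K) :
    (GeneralLinearGroup.map (algebraMap F K) (rotation a b ha))⁻¹ * lowerUnip (Pi.single 2 t) *
      GeneralLinearGroup.map (algebraMap F K) (rotation a b ha) =
    lowerUnip (Pi.single 1 (-(t * algebraMap F K a))) *
      lowerUnip (Pi.single 2 (t * algebraMap F K b)) := by
  rw [mul_assoc, inv_mul_eq_iff_eq_mul, lowerUnip_mul]
  ext i j
  fin_cases i <;> fin_cases j <;>
    simp [lowerUnip, rotation, Matrix.mul_apply, Fin.sum_univ_three]

theorem conj_rotation_single_one {F : Type*} [Field F] [Algebra F K] {a b : F} (ha : a ≠ 0)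
    (t : K) :
    (GeneralLinearGroup.map (algebraMap F K) (rotation a b ha))⁻¹ * lowerUnip (Pi.single 1 t) *
      GeneralLinearGroup.map (algebraMap F K) (rotation a b ha) =
    lowerUnip (Pi.single 2 t) := by
  rw [mul_assoc, inv_mul_eq_iff_eq_mul]
  ext i j
  fin_cases i <;> fin_cases j <;>
    simp [lowerUnip, rotation, Matrix.mul_apply, Fin.sum_univ_three]

end LowerUnip

/-! ### Vanishing of the first Tate cohomology -/

section Vanishing

variable {F E : Type*} [Field F] [Field E] [Algebra F E] [TopologicalSpace F] [TopologicalSpace E]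
  [IsTopologicalRing F] [IsTopologicalRing E] [LocalNorm F] [LocalNorm E] {γ : E ≃ₐ[F] E} {l : ℕ}
  {R M : Type*} [CommRing R] [AddCommGroup M] [Module R M]

/-- The action of a coordinate of the lower unipotent group. -/
def unipAction (ρ : GL (Fin 3) E →* Module.End R M) (i : Fin 3) (t : E) : Module.End R M :=
  ρ (lowerUnip (Pi.single i t))

/-- A smooth action of `GL₃(E) ⋊ ⟨γ⟩` on an `l`-torsion free module that is generated, up to powers
of `l`, by translates of `γ`-fixed vectors under the lower unipotent group. -/
structure IsUnipGenerated (γ : E ≃ₐ[F] E) (l : ℕ) (ρ : GL (Fin 3) E →* Module.End R M)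
    (T : Module.End R M) : Prop where
  smooth : ∀ m, ∀ᶠ g in 𝓝 (1 : GL (Fin 3) E), ρ g m = m
  gal : ∀ g, T * ρ g = ρ (GeneralLinearGroup.map (γ : E →+* E) g) * T
  pow_eq_one : T ^ l = 1
  torsionFree : ∀ m : M, l • m = 0 → m = 0
  span : ∀ m, ∃ k : ℕ, l ^ k • m ∈
    Submodule.span R {n | ∃ c w, T w = w ∧ n = ρ (lowerUnip c) w}

namespace IsUnipGenerated

variable {ρ : GL (Fin 3) E →* Module.End R M} {T : Module.End R M}

theorem isSmoothAction (hρ : IsUnipGenerated γ l ρ T) (i : Fin 3) :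
    IsSmoothAction (unipAction ρ i) where
  map_zero := by rw [unipAction, Pi.single_zero, lowerUnip_zero, map_one]
  map_add x y := by rw [unipAction, unipAction, unipAction, ← map_mul, lowerUnip_single_mul]
  smooth m := by
    have h1 : Tendsto (fun t : E => lowerUnip (Pi.single i t)) (𝓝 0) (𝓝 1) := by
      have h2 : Continuous fun t : E => lowerUnip (Pi.single i t : Fin 3 → E) :=
        continuous_lowerUnip.comp (continuous_single (A := fun _ => E) i)
      have h3 := h2.tendsto 0
      rwa [Pi.single_zero, lowerUnip_zero] at h3
    obtain ⟨ε, hε, h⟩ := LocalNorm.hasBasis.mem_iff.1 (h1.eventually (hρ.smooth m))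
    exact ⟨ε, hε, fun x hx => h hx⟩

theorem gal_unipAction (hρ : IsUnipGenerated γ l ρ T) (i : Fin 3) (x : E) :
    T * unipAction ρ i x = unipAction ρ i (γ x) * T := by
  rw [unipAction, hρ.gal, map_lowerUnip, unipAction]
  congr 3
  ext j
  by_cases h : j = i
  · subst h
    simp
  · simp [h]

/-- An F-rational matrix is fixed by γ, so its action commutes with T and carries γ-fixed vectors to
γ-fixed vectors. -/
theorem conj (hρ : IsUnipGenerated γ l ρ T) (g : GL (Fin 3) F) :
    IsUnipGenerated γ l
      (ρ.comp (MulAut.conj (GeneralLinearGroup.map (algebraMap F E) g)⁻¹).toMonoidHom) T := by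
  set g' := GeneralLinearGroup.map (algebraMap F E) g with hg'
  have hγ : GeneralLinearGroup.map (γ : E →+* E) g' = g' := by
    ext i j
    exact γ.commutes _
  have happ : ∀ x, (ρ.comp (MulAut.conj g'⁻¹).toMonoidHom) x = ρ (g'⁻¹ * x * g') := fun x => by
    simp
  refine ⟨fun m => ?_, fun x => ?_, hρ.pow_eq_one, hρ.torsionFree, fun m => ?_⟩
  · have h1 : Tendsto (fun x => g'⁻¹ * x * g') (𝓝 1) (𝓝 1) := by
      have h2 : Continuous fun x : GL (Fin 3) E => g'⁻¹ * x * g' := by fun_prop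
      have h3 := h2.tendsto 1
      rwa [mul_one, inv_mul_cancel] at h3
    filter_upwards [h1.eventually (hρ.smooth m)] with x hx
    rwa [happ]
  · have h1 : GeneralLinearGroup.map (γ : E →+* E) (g'⁻¹ * x * g') =
        g'⁻¹ * GeneralLinearGroup.map (γ : E →+* E) x * g' := by
      rw [map_mul, map_mul, map_inv, hγ]
    rw [happ, happ, hρ.gal, h1]
  · obtain ⟨k, hk⟩ := hρ.span (ρ g' m)
    refine ⟨k, ?_⟩
    have h1 := Submodule.mem_map_of_mem (f := ρ g'⁻¹) hk
    rw [map_nsmul, ← Module.End.mul_apply, ← map_mul, inv_mul_cancel, map_one,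
      Module.End.one_apply, Submodule.map_span] at h1
    refine Submodule.span_mono ?_ h1
    rintro _ ⟨_, ⟨c, w, hw, rfl⟩, rfl⟩
    refine ⟨c, ρ g'⁻¹ w, ?_, ?_⟩
    · rw [← Module.End.mul_apply, hρ.gal, map_inv, hγ, Module.End.mul_apply, hw]
    · rw [happ, ← Module.End.mul_apply, ← Module.End.mul_apply, ← map_mul, ← map_mul,
        mul_assoc, mul_inv_cancel, mul_one]

end IsUnipGenerated

variable {ρ : GL (Fin 3) E →* Module.End R M} {T : Module.End R M}

theorem commute_unipAction_two (ρ : GL (Fin 3) E →* Module.End R M) (i : Fin 3) (s t : E) :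
    Commute (unipAction ρ i t) (unipAction ρ 2 s) := by
  rw [unipAction, unipAction, Commute, SemiconjBy, ← map_mul, ← map_mul,
    lowerUnip_single_two_mul]

theorem unipAction_two_mem (ρ : GL (Fin 3) E →* Module.End R M) (χ : AddChar E R) (i : Fin 3)
    (t : E) {s : M} (hs : s ∈ twistRel (unipAction ρ 2) χ) :
    unipAction ρ i t s ∈ twistRel (unipAction ρ 2) χ :=
  twistRel_le_comap _ χ (fun x => commute_unipAction_two ρ i x t) hs

/-- Commutators of coordinates 0 and 1 lie in the center, coordinate 2. Where the center acts
trivially, coordinate 0 commutes with coordinate 1. -/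
theorem unipAction_zero_mem (ρ : GL (Fin 3) E →* Module.End R M) {χ₂ χ₁ : AddChar E R}
    (hχ : ∀ x, χ₂ x = 1) (t : E) {s : M}
    (hs : s ∈ twistRel (unipAction ρ 2) χ₂ ⊔ twistRel (unipAction ρ 1) χ₁) :
    unipAction ρ 0 t s ∈ twistRel (unipAction ρ 2) χ₂ ⊔ twistRel (unipAction ρ 1) χ₁ := by
  suffices h : twistRel (unipAction ρ 2) χ₂ ⊔ twistRel (unipAction ρ 1) χ₁ ≤
      (twistRel (unipAction ρ 2) χ₂ ⊔ twistRel (unipAction ρ 1) χ₁).comap (unipAction ρ 0 t) from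
    h hs
  refine sup_le (fun s hs => Submodule.mem_sup_left (unipAction_two_mem ρ χ₂ 0 t hs))
    (Submodule.span_le.2 ?_)
  rintro _ ⟨x, m, rfl⟩
  have h1 : unipAction ρ 0 t * unipAction ρ 1 x =
      unipAction ρ 2 (-(x * t)) * unipAction ρ 1 x * unipAction ρ 0 t := by
    simp only [unipAction, ← map_mul, lowerUnip_single_zero_mul_single_one]
  have h2 : unipAction ρ 0 t (unipAction ρ 1 x m - χ₁ x • m) =
      (unipAction ρ 2 (-(x * t)) (unipAction ρ 1 x (unipAction ρ 0 t m)) -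
        χ₂ (-(x * t)) • unipAction ρ 1 x (unipAction ρ 0 t m)) +
      (unipAction ρ 1 x (unipAction ρ 0 t m) - χ₁ x • unipAction ρ 0 t m) := by
    rw [map_sub, map_smul, ← Module.End.mul_apply, h1, hχ, one_smul, Module.End.mul_apply,
      Module.End.mul_apply]
    abel
  rw [SetLike.mem_coe, Submodule.mem_comap, h2]
  exact Submodule.add_mem_sup (sub_mem_twistRel _ _ _ _) (sub_mem_twistRel _ _ _ _)

theorem lowerUnip_sub_mem (ρ : GL (Fin 3) E →* Module.End R M) {χ : Fin 3 → AddChar E R}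
    {S : Submodule R M} (hS : ∀ i, twistRel (unipAction ρ i) (χ i) ≤ S) (c : Fin 3 → E) (m : M) :
    ρ (lowerUnip c) m - (χ 0 (c 0) * (χ 1 (c 1) * χ 2 (c 2))) • m ∈ S := by
  have h1 : ρ (lowerUnip c) m = unipAction ρ 0 (c 0) (unipAction ρ 1 (c 1)
      (unipAction ρ 2 (c 2) m)) := by
    rw [lowerUnip_eq_mul, map_mul, map_mul]
    rfl
  have h2 := fun i m => hS i (sub_mem_twistRel (unipAction ρ i) (χ i) (c i) m)
  have h3 := S.add_mem (h2 0 (unipAction ρ 1 (c 1) (unipAction ρ 2 (c 2) m)))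
    (S.smul_mem (χ 0 (c 0)) (S.add_mem (h2 1 (unipAction ρ 2 (c 2) m))
      (S.smul_mem (χ 1 (c 1)) (h2 2 m))))
  rw [h1]
  convert h3 using 1
  simp only [smul_add, smul_sub, smul_smul]
  abel

variable [IsDomain R]

theorem IsCyclicLocal.exists_pullChar_eq_one (h : IsCyclicLocal γ l) {ψ : AddChar F R} {δ : ℝ}
    (hδ : 0 < δ) (hψ : ∀ d, LocalNorm.v d ≤ δ → ψ d = 1) (a : F) :
    ∃ δ' : ℝ, 0 < δ' ∧ ∀ d, LocalNorm.v d ≤ δ' → h.pullChar (ψ.mulShift a) d = 1 := by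
  obtain ⟨δ', hδ', h'⟩ := exists_mulShift_eq_one hδ hψ a
  exact ⟨δ', hδ', fun d hd => h.pullChar_eq_one h' hd⟩

/-- The case in which the center of the unipotent group acts trivially on the coinvariants. -/
theorem mem_sup_range_of_center_trivial (h : IsCyclicLocal γ l)
    (hR : ∀ n : ℕ, ¬ l ∣ n → IsUnit (n : R)) (hρ : IsUnipGenerated γ l ρ T) {ψ : AddChar F R}
    {δ : ℝ} (hδ : 0 < δ) (hψ : ∀ d, LocalNorm.v d ≤ δ → ψ d = 1) {x₀ : F} (hx₀ : ψ x₀ ≠ 1) {m : M}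
    (hm : tateNorm T l m = 0) (b : F) :
    m ∈ twistRel (unipAction ρ 2) (h.pullChar (ψ.mulShift 0)) ⊔
      twistRel (unipAction ρ 1) (h.pullChar (ψ.mulShift b)) ⊔ LinearMap.range (1 - T) := by
  by_contra hmem
  set χ₂ := h.pullChar (ψ.mulShift 0) with hχ₂
  set χ₁ := h.pullChar (ψ.mulShift b) with hχ₁
  have hχ : ∀ x, χ₂ x = 1 := fun x => by
    rw [hχ₂, h.pullChar_apply, AddChar.mulShift_apply, zero_mul, AddChar.map_zero_eq_one]
  set S := twistRel (unipAction ρ 2) χ₂ ⊔ twistRel (unipAction ρ 1) χ₁ with hSdef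
  have hS₀ : ∀ x, ∀ s ∈ S, unipAction ρ 0 x s ∈ S := fun x s hs => unipAction_zero_mem ρ hχ x hs
  obtain ⟨c, hc⟩ := h.exists_notMem_sup_twistRel hR (hρ.isSmoothAction 0) (hρ.gal_unipAction 0)
    hρ.pow_eq_one ψ hδ hψ hx₀ hS₀ (hm ▸ S.zero_mem) hmem
  set χ₀ := h.pullChar (ψ.mulShift c) with hχ₀
  obtain ⟨δ₂, hδ₂, h2⟩ := h.exists_pullChar_eq_one hδ hψ 0
  obtain ⟨δ₁, hδ₁, h1⟩ := h.exists_pullChar_eq_one hδ hψ b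
  obtain ⟨δ₀, hδ₀, h0⟩ := h.exists_pullChar_eq_one hδ hψ c
  -- The quotient stays l-torsion free through three successive passages to twisted coinvariants.
  have hsat₂ : ∀ m, l • m ∈ twistRel (unipAction ρ 2) χ₂ →
      m ∈ twistRel (unipAction ρ 2) χ₂ := by
    intro m hm
    have h3 := saturated_sup_twistRel (hρ.isSmoothAction 2) hδ₂ h2 h.prime hR h.v_natCast
      (S := ⊥)
      (fun x s hs => by rw [(Submodule.mem_bot R).1 hs, map_zero]; exact Submodule.zero_mem _)
      (fun m hm => (Submodule.mem_bot R).2 (hρ.torsionFree m ((Submodule.mem_bot R).1 hm)))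
      (m := m) (by rwa [bot_sup_eq])
    rwa [bot_sup_eq] at h3
  have hsat₁ : ∀ m, l • m ∈ S → m ∈ S := fun m hm =>
    saturated_sup_twistRel (hρ.isSmoothAction 1) hδ₁ h1 h.prime hR h.v_natCast
      (fun x s hs => unipAction_two_mem ρ χ₂ 1 x hs) hsat₂ hm
  have hsat₀ : ∀ m, l • m ∈ S ⊔ twistRel (unipAction ρ 0) χ₀ →
      m ∈ S ⊔ twistRel (unipAction ρ 0) χ₀ := fun m hm =>
    saturated_sup_twistRel (hρ.isSmoothAction 0) hδ₀ h0 h.prime hR h.v_natCast hS₀ hsat₁ hm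
  set S' := S ⊔ twistRel (unipAction ρ 0) χ₀ with hS'
  have hsatpow : ∀ (k : ℕ) m, l ^ k • m ∈ S' → m ∈ S' := by
    intro k
    induction k with
    | zero => intro m hm; simpa using hm
    | succ k ih => intro m hm; exact hsat₀ m (ih _ (by rwa [smul_smul, ← pow_succ]))
  have hle : ∀ i, twistRel (unipAction ρ i) ((![χ₀, χ₁, χ₂] : Fin 3 → AddChar E R) i) ≤ S' := by
    intro i
    fin_cases i
    · exact le_sup_right
    · exact le_sup_right.trans le_sup_left
    · exact le_sup_left.trans le_sup_left
  -- The unipotent group acts modulo S' by γ-invariant scalars, so a translate of a γ-fixed vector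
  -- is γ-fixed modulo S'. Saturation extends this to every vector.
  have hspan : Submodule.span R {n | ∃ c w, T w = w ∧ n = ρ (lowerUnip c) w} ≤
      S'.comap (1 - T) := by
    refine Submodule.span_le.2 ?_
    rintro _ ⟨c, w, hw, rfl⟩
    have h3 : (1 - T) (ρ (lowerUnip c) w) = ρ (lowerUnip c) w -
        ρ (lowerUnip fun i => γ (c i)) w := by
      rw [LinearMap.sub_apply, Module.End.one_apply, ← Module.End.mul_apply, hρ.gal,
        map_lowerUnip, Module.End.mul_apply, hw]
      rfl
    have h4 := S'.sub_mem (lowerUnip_sub_mem ρ hle c w)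
      (lowerUnip_sub_mem ρ hle (fun i => γ (c i)) w)
    simp only [Matrix.cons_val_zero, Matrix.cons_val_one, Matrix.cons_val, hχ₀, hχ₁, hχ₂,
      h.pullChar_gal, sub_sub_sub_cancel_right] at h4
    rw [SetLike.mem_coe, Submodule.mem_comap, h3]
    exact h4
  have hone : ∀ m, (1 - T) m ∈ S' := by
    intro m
    obtain ⟨k, hk⟩ := hρ.span m
    have h3 := hspan hk
    rw [Submodule.mem_comap, map_nsmul] at h3
    exact hsatpow k _ h3
  -- Since T is trivial modulo S', the vector l • m is congruent to the norm of m, which is 0.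
  -- Saturation puts m in S', against the choice of c.
  refine hc (Submodule.mem_sup_left (hsat₀ m ?_))
  have h5 := IsCyclicLocal.sub_tateNorm_mem_range T l m
  rw [hm, sub_zero] at h5
  obtain ⟨w, hw⟩ := h5
  rw [← hw]
  exact hone w

/-- The first Tate cohomology of a unipotently generated representation vanishes. -/
theorem IsUnipGenerated.mem_range (h : IsCyclicLocal γ l)
    (hR : ∀ n : ℕ, ¬ l ∣ n → IsUnit (n : R)) (hρ : IsUnipGenerated γ l ρ T) {ψ : AddChar F R}
    {δ : ℝ} (hδ : 0 < δ) (hψ : ∀ d, LocalNorm.v d ≤ δ → ψ d = 1) {x₀ : F} (hx₀ : ψ x₀ ≠ 1) {m : M}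
    (hm : tateNorm T l m = 0) : m ∈ LinearMap.range (1 - T) := by
  by_contra hmem
  -- The frequencies a and b are found for the center and for coordinate 1, keeping m outside im(1 -
  -- T).
  obtain ⟨a, ha⟩ := h.exists_notMem_sup_twistRel hR (hρ.isSmoothAction 2) (hρ.gal_unipAction 2)
    hρ.pow_eq_one ψ hδ hψ hx₀ (S := ⊥)
    (fun x s hs => by rw [(Submodule.mem_bot R).1 hs, map_zero]; exact Submodule.zero_mem _)
    (hm ▸ Submodule.zero_mem _) (by rwa [bot_sup_eq])
  rw [bot_sup_eq] at ha
  obtain ⟨b, hb⟩ := h.exists_notMem_sup_twistRel hR (hρ.isSmoothAction 1) (hρ.gal_unipAction 1)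
    hρ.pow_eq_one ψ hδ hψ hx₀ (fun x s hs => unipAction_two_mem ρ _ 1 x hs)
    (hm ▸ Submodule.zero_mem _) ha
  by_cases ha0 : a = 0
  · subst ha0
    exact hb (mem_sup_range_of_center_trivial h hR hρ hδ hψ hx₀ hm b)
  -- For a ≠ 0 the rotation turns the frequencies (b, a) of coordinates (1, 2) into (a, 0), so the
  -- case of trivial center applies to the conjugated action. Its relations lie among the original
  -- ones.
  have h1 := mem_sup_range_of_center_trivial h hR (hρ.conj (rotation a b ha0)) hδ hψ hx₀ hm a
  refine hb (SetLike.le_def.1 (sup_le_sup_right (sup_le ?_ ?_) _) h1)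
  · refine Submodule.span_le.2 ?_
    rintro _ ⟨x, m, rfl⟩
    have h2 : unipAction (ρ.comp (MulAut.conj (GeneralLinearGroup.map (algebraMap F E)
        (rotation a b ha0))⁻¹).toMonoidHom) 2 x =
        unipAction ρ 1 (-(x * algebraMap F E a)) * unipAction ρ 2 (x * algebraMap F E b) := by
      rw [unipAction, unipAction, unipAction, ← map_mul, ← conj_rotation_single_two ha0]
      simp
    have h3 : h.pullChar (ψ.mulShift 0) x = 1 := by
      rw [h.pullChar_apply, AddChar.mulShift_apply, zero_mul, AddChar.map_zero_eq_one]
    have h4 : h.pullChar (ψ.mulShift b) (-(x * algebraMap F E a)) *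
        h.pullChar (ψ.mulShift a) (x * algebraMap F E b) = 1 := by
      rw [h.pullChar_apply, h.pullChar_apply, AddChar.mulShift_apply, AddChar.mulShift_apply,
        ← AddChar.map_add_eq_mul, show -(x * algebraMap F E a) = algebraMap F E (-a) * x by
          rw [map_neg]; ring, mul_comm x, h.avg_algebraMap_mul, h.avg_algebraMap_mul,
        show b * (-a * h.avg x) + a * (b * h.avg x) = 0 by ring, AddChar.map_zero_eq_one]
    have h5 := Submodule.add_mem_sup
      (Submodule.smul_mem _ (h.pullChar (ψ.mulShift b) (-(x * algebraMap F E a)))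
        (sub_mem_twistRel (unipAction ρ 2) (h.pullChar (ψ.mulShift a)) (x * algebraMap F E b) m))
      (sub_mem_twistRel (unipAction ρ 1) (h.pullChar (ψ.mulShift b)) (-(x * algebraMap F E a))
        (unipAction ρ 2 (x * algebraMap F E b) m))
    rw [smul_sub, smul_smul, h4] at h5
    rw [SetLike.mem_coe, h2, h3, Module.End.mul_apply]
    convert h5 using 1
    abel
  · refine Submodule.span_le.2 ?_
    rintro _ ⟨x, m, rfl⟩
    have h2 : unipAction (ρ.comp (MulAut.conj (GeneralLinearGroup.map (algebraMap F E)
        (rotation a b ha0))⁻¹).toMonoidHom) 1 x = unipAction ρ 2 x := by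
      rw [unipAction, unipAction, ← conj_rotation_single_one (b := b) ha0]
      simp
    rw [SetLike.mem_coe, h2]
    exact Submodule.mem_sup_left (sub_mem_twistRel _ _ _ _)

end Vanishing

/-! ### Generation of the Steinberg module by unipotent translates -/

section CellTranslate

variable {E : Type*} [Field E]

theorem lowerUnip_smul_cellMap (c x : Fin 3 → E) : lowerUnip c • cellMap x =
    cellMap ![c 0 + x 0, c 1 + x 1, c 2 + x 2 + c 1 * x 0] := by
  change flag bB (lowerUnip c * lowerUnip x) = _
  rw [lowerUnip_mul, cellMap]

theorem inv_lowerUnip_smul_cellMap (c x : Fin 3 → E) : (lowerUnip c)⁻¹ • cellMap x =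
    cellMap ![x 0 - c 0, x 1 - c 1, x 2 - c 2 - c 1 * (x 0 - c 0)] := by
  rw [inv_smul_eq_iff, lowerUnip_smul_cellMap]
  congr 1
  ext j
  fin_cases j
  · simp
  · simp
  · change x 2 = c 2 + (x 2 - c 2 - c 1 * (x 0 - c 0)) + c 1 * (x 0 - c 0)
    ring

variable [TopologicalSpace E] [IsTopologicalRing E] [LocalNorm E] {R : Type*} [CommRing R]

theorem ccRep_lowerUnip_cellMap (c : Fin 3 → E) (f : CcInf (Flag E bB) R) (x : Fin 3 → E) :
    (ccRep R (leftTranslation E bB) (lowerUnip c) f).1 (cellMap x) =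
      f.1 (cellMap ![x 0 - c 0, x 1 - c 1, x 2 - c 2 - c 1 * (x 0 - c 0)]) := by
  change f.1 ((lowerUnip c)⁻¹ • cellMap x) = _
  rw [inv_lowerUnip_smul_cellMap]

theorem ccRep_lowerUnip_mem_cellFns (c : Fin 3 → E) {f : CcInf (Flag E bB) R}
    (hf : f ∈ cellFns E R) :
    ccRep R (leftTranslation E bB) (lowerUnip c) f ∈ cellFns E R := by
  intro x hx
  refine hf ((lowerUnip c)⁻¹ • x) fun h => hx ?_
  have h1 := lowerUnip_smul_cellMap c (cellCoord ((lowerUnip c)⁻¹ • x))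
  rw [cellMap_cellCoord h, smul_inv_smul] at h1
  rw [h1]
  exact cellMap_mem _

/-- The Steinberg module is spanned by unipotent translates of Galois invariant vectors. -/
theorem mem_span_lowerUnip {F : Type*} [Field F] [Algebra F E] [TopologicalSpace F]
    [IsTopologicalRing F] [IsModuleTopology F E] {γ : E ≃ₐ[F] E}
    (hγ : ∀ x, LocalNorm.v (γ x) = LocalNorm.v x) (v : Steinberg E R) :
    v ∈ Submodule.span R {n | ∃ c w, steinbergGal F E R γ w = w ∧
      n = steinbergRep E R (lowerUnip c) w} := by
  classical
  obtain ⟨f, hf, rfl⟩ := exists_cellFns_mk v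
  obtain ⟨ε, hε, hunif⟩ := exists_uniform (comp_cellMap_mem hf)
  obtain ⟨B, hB, hbound⟩ := exists_bound (comp_cellMap_mem hf).2
  have hB0 : 0 < B := by linarith
  have hεB : ε / B ≤ ε := div_le_self hε.le hB
  -- A unipotent translation by c shifts the third coordinate by c₁ (x₀ - c₀). The first side is
  -- shortened to ε / B so that this shift is at most ε and the translated indicator is that of c +
  -- P.
  let P : (Fin 3 → E) → Prop := fun d =>
    LocalNorm.v (d 0) ≤ ε / B ∧ LocalNorm.v (d 1) ≤ ε ∧ LocalNorm.v (d 2) ≤ ε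
  have hPadd : ∀ x d, P d → (P (x + d) ↔ P x) := by
    intro x d hd
    have h1 : ∀ {r : ℝ} (hr : 0 ≤ r) {a b : E}, LocalNorm.v b ≤ r →
        (LocalNorm.v (a + b) ≤ r ↔ LocalNorm.v a ≤ r) := fun {r} hr {a b} hb =>
      (LocalNorm.ball E r hr).add_mem_cancel_right hb
    exact and_congr (h1 (div_pos hε hB0).le hd.1) (and_congr (h1 hε.le hd.2.1) (h1 hε.le hd.2.2))
  have hPneg : ∀ d, P d → P (-d) := fun d hd => by
    simpa [P] using hd
  have hmem : (fun x => if P x then (1 : R) else 0) ∈ CcInf (Fin 3 → E) R := by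
    refine mem_ccInf_of_uniform (div_pos hε hB0) (B := ε) (fun x d hd => ?_) fun x hx i => ?_
    · simp only [hPadd x d ⟨hd 0, (hd 1).trans hεB, (hd 2).trans hεB⟩]
    · have hP : P x := by
        by_contra h
        exact hx (if_neg h)
      fin_cases i
      · exact hP.1.trans hεB
      · exact hP.2.1
      · exact hP.2.2
  let w := cellFn _ hmem
  have hw : steinbergGal F E R γ (Submodule.Quotient.mk w) = Submodule.Quotient.mk w := by
    rw [steinbergGal_mk]
    congr 1
    refine ext_cellFns (ccRep_gal_mem_cellFns γ (cellFn_mem _ _)) (cellFn_mem _ _) fun x => ?_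
    rw [ccRep_gal_cellMap, cellFn_cellMap, cellFn_cellMap]
    have hγ' : ∀ y, LocalNorm.v (γ⁻¹ y) = LocalNorm.v y := fun y => by
      rw [← hγ (γ⁻¹ y)]
      exact congrArg _ (γ.apply_symm_apply y)
    simp only [P, hγ']
  have htrans : ∀ c x : Fin 3 → E, (∀ i, LocalNorm.v (c i) ≤ B) →
      (ccRep R (leftTranslation E bB) (lowerUnip c) w).1 (cellMap x) =
        if P (x - c) then 1 else 0 := by
    intro c x hc
    rw [ccRep_lowerUnip_cellMap, cellFn_cellMap]
    refine if_congr ?_ rfl rfl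
    refine and_congr_right fun h0 => and_congr_right fun _ => ?_
    have h0' : LocalNorm.v (x 0 - c 0) ≤ ε / B := h0
    have h1 : LocalNorm.v (c 1 * (x 0 - c 0)) ≤ ε := by
      rw [map_mul]
      calc _ ≤ B * (ε / B) := mul_le_mul (hc 1) h0' (LocalNorm.v.nonneg _) hB0.le
        _ = ε := by field_simp
    have h2 := (LocalNorm.ball E ε hε.le).add_mem_cancel_right (y := x 2 - c 2)
      ((LocalNorm.ball E ε hε.le).neg_mem h1)
    rw [← sub_eq_add_neg] at h2
    exact h2
  -- A function invariant under P and supported on finitely many translates of P is reduced to zero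
  -- by removing one translate of w at a time. The vector w is γ-invariant because γ preserves
  -- norms.
  have key : ∀ (t : Finset (Fin 3 → E)), (∀ c ∈ t, ∀ i, LocalNorm.v (c i) ≤ B) →
      ∀ f ∈ cellFns E R, (∀ x d, P d → f.1 (cellMap (x + d)) = f.1 (cellMap x)) →
      (∀ x, f.1 (cellMap x) ≠ 0 → ∃ c ∈ t, P (x - c)) →
      (Submodule.Quotient.mk f : Steinberg E R) ∈ Submodule.span R {n | ∃ c w,
        steinbergGal F E R γ w = w ∧ n = steinbergRep E R (lowerUnip c) w} := by
    intro t
    induction t using Finset.induction_on with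
    | empty =>
      intro _ f hf _ h
      have h0 : f = 0 := by
        refine ext_cellFns hf (Submodule.zero_mem _) fun x => ?_
        by_contra hx
        obtain ⟨c, hc, -⟩ := h x hx
        exact absurd hc (Finset.notMem_empty c)
      rw [h0]
      exact Submodule.zero_mem _
    | insert c t hct ih =>
      intro hbd f hf hinv hsupp
      have hc := hbd c (Finset.mem_insert_self c t)
      let f' := f - f.1 (cellMap c) • ccRep R (leftTranslation E bB) (lowerUnip c) w
      have hf'v : ∀ x, f'.1 (cellMap x) = f.1 (cellMap x) -
          f.1 (cellMap c) * if P (x - c) then 1 else 0 := fun x => by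
        rw [← htrans c x hc]
        rfl
      have h1 : (Submodule.Quotient.mk f : Steinberg E R) = Submodule.Quotient.mk f' +
          f.1 (cellMap c) • steinbergRep E R (lowerUnip c) (Submodule.Quotient.mk w) :=
        (congrArg (Submodule.Quotient.mk (p := steinbergRel E R))
          (sub_add_cancel f (f.1 (cellMap c) • ccRep R (leftTranslation E bB)
            (lowerUnip c) w))).symm
      rw [h1]
      refine Submodule.add_mem _ (ih (fun c hc => hbd c (Finset.mem_insert_of_mem hc)) f' ?_ ?_ ?_)
        (Submodule.smul_mem _ _ (Submodule.subset_span ⟨c, _, hw, rfl⟩))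
      · exact Submodule.sub_mem _ hf
          (Submodule.smul_mem _ _ (ccRep_lowerUnip_mem_cellFns c (cellFn_mem _ _)))
      · intro x d hd
        rw [hf'v, hf'v, hinv x d hd, add_sub_right_comm]
        simp only [hPadd _ d hd]
      · intro x hx
        rw [hf'v] at hx
        have hxc : ¬ P (x - c) := by
          intro hP
          have h2 := hinv c (x - c) hP
          rw [add_sub_cancel] at h2
          rw [if_pos hP, mul_one, h2, sub_self] at hx
          exact hx rfl
        rw [if_neg hxc, mul_zero, sub_zero] at hx
        obtain ⟨c', hc', hP⟩ := hsupp x hx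
        rcases Finset.mem_insert.1 hc' with rfl | hc'
        · exact absurd hP hxc
        · exact ⟨c', hc', hP⟩
  have hcpt := isCompact_univ_pi fun _ : Fin 3 => LocalNorm.isCompact_ball (K := E) B
  obtain ⟨t, htB, ht⟩ := hcpt.elim_nhds_subcover (fun c => {x | P (x - c)}) fun c _ => by
    have h1 : ∀ (i : Fin 3) {r : ℝ}, 0 < r → ∀ᶠ x in 𝓝 c, LocalNorm.v (x i - c i) ≤ r :=
      fun i r hr => (continuous_apply i).continuousAt.eventually (LocalNorm.eventually_le (c i) hr)
    exact (h1 0 (div_pos hε hB0)).and ((h1 1 hε).and (h1 2 hε))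
  refine key t (fun c hc i => htB c hc i trivial) f hf (fun x d hd => hunif x d fun i => ?_)
    fun x hx => ?_
  · fin_cases i
    · exact hd.1.trans hεB
    · exact hd.2.1
    · exact hd.2.2
  · obtain ⟨c, hc, hP⟩ := Set.mem_iUnion₂.1 (ht fun i _ => hbound x hx i)
    exact ⟨c, hc, hP⟩

theorem eventually_steinbergRep_eq (v : Steinberg E R) :
    ∀ᶠ g in 𝓝 (1 : GL (Fin 3) E), steinbergRep E R g v = v := by
  induction v using Submodule.Quotient.induction_on with
  | H f =>
    have h1 : Tendsto (fun g : GL (Fin 3) E => g⁻¹) (𝓝 1) (𝓝 1) := by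
      have h2 := (continuous_inv (G := GL (Fin 3) E)).tendsto 1
      rwa [inv_one] at h2
    filter_upwards [h1.eventually (eventually_smul_eq (mem_ccInf.1 f.2))] with g hg
    exact congrArg (Submodule.Quotient.mk (p := steinbergRel E R))
      (Subtype.ext (funext fun x => hg x))

theorem steinbergRep_scalar (c : Eˣ) (v : Steinberg E R) :
    steinbergRep E R (GeneralLinearGroup.scalar (Fin 3) c) v = v := by
  induction v using Submodule.Quotient.induction_on with
  | H f =>
    refine congrArg (Submodule.Quotient.mk (p := steinbergRel E R))
      (Subtype.ext (funext fun x => ?_))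
    change f.1 ((GeneralLinearGroup.scalar (Fin 3) c)⁻¹ • x) = f.1 x
    refine congrArg f.1 ?_
    rw [inv_smul_eq_iff]
    induction x using QuotientGroup.induction_on with
    | H g =>
      refine QuotientGroup.eq.2 ?_
      have h1 : g⁻¹ * (GeneralLinearGroup.scalar (Fin 3) c * g) =
          GeneralLinearGroup.scalar (Fin 3) c := by
        rw [GeneralLinearGroup.scalar_commute c g,
          inv_mul_cancel_left]
      change g⁻¹ * (GeneralLinearGroup.scalar (Fin 3) c * g) ∈ parabolic E bB
      rw [h1]
      intro i j hij
      exact Matrix.diagonal_apply_ne _ (by rintro rfl; exact lt_irrefl _ hij)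

end CellTranslate

/-! ### Additive characters -/

section Character

variable (l : ℕ) [Fact l.Prime]

theorem isUnit_natCast {n : ℕ} (hn : ¬ l ∣ n) : IsUnit (n : Zbar l) := by
  rw [isUnit_iff_norm_eq_one]
  have h2 : ((n : Zbar l) : Qbar l) = algebraMap ℚ_[l] (Qbar l) (n : ℚ_[l]) := by simp
  rw [h2, PadicAlgCl.norm_extends, Padic.norm_natCast_eq_one_iff]
  exact ((Nat.Prime.coprime_iff_not_dvd Fact.out).2 hn)

/-- A local field of residue characteristic `p` has a nontrivial additive character that is trivial
on the unit ball. -/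
theorem exists_addChar {K : Type*} [Field K] [TopologicalSpace K] [LocalNorm K] {p : ℕ}
    (hp : p.Prime) (hp0 : (p : K) ≠ 0) (hv : LocalNorm.v (p : K) < 1) :
    ∃ ψ : AddChar K (Zbar l), (∀ d, LocalNorm.v d ≤ 1 → ψ d = 1) ∧ ∃ x, ψ x ≠ 1 := by
  have : Fact p.Prime := ⟨hp⟩
  -- The class of 1 / p has order p in A. Sending it to a primitive p-th root of unity extends to
  -- all of A, because the unit group of Qbar is divisible.
  let A := K ⧸ LocalNorm.ball K 1 zero_le_one
  let q : A := QuotientAddGroup.mk ((p : K)⁻¹)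
  have hq : p • q = 0 := by
    rw [← QuotientAddGroup.mk_nsmul, QuotientAddGroup.eq_zero_iff, nsmul_eq_mul,
      mul_inv_cancel₀ hp0]
    exact (map_one LocalNorm.v).le
  have hq0 : q ≠ 0 := by
    rw [Ne, QuotientAddGroup.eq_zero_iff]
    intro h
    have h1 : LocalNorm.v ((p : K)⁻¹) ≤ 1 := h
    rw [map_inv₀] at h1
    exact h1.not_gt (one_lt_inv₀ (LocalNorm.v.pos hp0) |>.2 hv)
  have hord : addOrderOf q = p := addOrderOf_eq_prime hq hq0
  obtain ⟨ζ, hζ⟩ := HasEnoughRootsOfUnity.exists_primitiveRoot (Qbar l) p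
  have hζu := hζ.isUnit hp.ne_zero
  let z : Additive (Qbar l)ˣ := Additive.ofMul hζu.unit
  have hz : p • z = 0 := by
    refine Additive.toMul.injective (Units.ext ?_)
    change ζ ^ p = 1
    exact hζ.pow_eq_one
  have hz0 : z ≠ 0 := by
    intro h
    have h1 : ζ = 1 := congrArg (fun y : Additive (Qbar l)ˣ => (y.toMul : Qbar l)) h
    exact hζ.ne_one hp.one_lt h1
  let f : ZMod p →+ A := ZMod.lift p ⟨zmultiplesHom A q, by simpa using hq⟩
  let g : ZMod p →+ Additive (Qbar l)ˣ :=
    ZMod.lift p ⟨zmultiplesHom (Additive (Qbar l)ˣ) z, by simpa using hz⟩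
  have hf : Function.Injective f := by
    refine (ZMod.lift_injective _).2 fun m hm => ?_
    have h1 : m • q = 0 := hm
    rw [← addOrderOf_dvd_iff_zsmul_eq_zero, hord] at h1
    exact (ZMod.intCast_zmod_eq_zero_iff_dvd m p).2 h1
  let _ : DivisibleBy (Additive (Qbar l)ˣ) ℕ := divisibleByOfSMulRightSurj _ _ fun {n} hn y => by
    obtain ⟨w, hw⟩ := IsAlgClosed.exists_pow_nat_eq (y.toMul : Qbar l) (Nat.pos_of_ne_zero hn)
    have hw0 : w ≠ 0 := by
      rintro rfl
      rw [zero_pow hn] at hw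
      exact y.toMul.ne_zero hw.symm
    exact ⟨Additive.ofMul (Units.mk0 w hw0), Additive.toMul.injective (Units.ext hw)⟩
  let _ : DivisibleBy (Additive (Qbar l)ˣ) ℤ := AddGroup.divisibleByIntOfDivisibleByNat _
  obtain ⟨Ψ, hΨ⟩ := (Module.Baer.of_divisible (Additive (Qbar l)ˣ)).extension_property_addMonoidHom
    f hf g
  -- A is p-power torsion, so the values are roots of unity, hence integral.
  have hintegral : ∀ x : K, IsIntegral ℤ_[l]
      (((Ψ (QuotientAddGroup.mk x)).toMul : (Qbar l)ˣ) : Qbar l) := by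
    intro x
    have h1 : Tendsto (fun n : ℕ => LocalNorm.v (p : K) ^ n * LocalNorm.v x) atTop
        (𝓝 (0 * LocalNorm.v x)) :=
      (tendsto_pow_atTop_nhds_zero_of_lt_one (LocalNorm.v.nonneg _) hv).mul_const _
    rw [zero_mul] at h1
    obtain ⟨n, hn⟩ := (h1.eventually_le_const one_pos).exists
    have h2 : p ^ n • (QuotientAddGroup.mk x : A) = 0 := by
      rw [← QuotientAddGroup.mk_nsmul, QuotientAddGroup.eq_zero_iff]
      change LocalNorm.v (p ^ n • x) ≤ 1
      rwa [nsmul_eq_mul, Nat.cast_pow, map_mul, map_pow]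
    have h3 : p ^ n • Ψ (QuotientAddGroup.mk x) = 0 := by rw [← map_nsmul, h2, map_zero]
    refine IsIntegral.of_pow (pow_pos hp.pos n) ?_
    have h4 : (((Ψ (QuotientAddGroup.mk x)).toMul : (Qbar l)ˣ) : Qbar l) ^ p ^ n = 1 :=
      congrArg (fun y : Additive (Qbar l)ˣ => (y.toMul : Qbar l)) h3
    rw [h4]
    exact isIntegral_one
  refine ⟨⟨fun x => ⟨_, hintegral x⟩, ?_, fun x y => ?_⟩, fun d hd => ?_, (p : K)⁻¹,
    fun h => hz0 ?_⟩
  · refine Subtype.ext ?_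
    change ((Ψ (0 : A)).toMul : Qbar l) = 1
    rw [map_zero]
    rfl
  · refine Subtype.ext ?_
    change ((Ψ ((QuotientAddGroup.mk x : A) + QuotientAddGroup.mk y)).toMul : Qbar l) = _
    rw [map_add]
    rfl
  · refine Subtype.ext ?_
    change ((Ψ (QuotientAddGroup.mk d : A)).toMul : Qbar l) = 1
    rw [(QuotientAddGroup.eq_zero_iff d).2 hd, map_zero]
    rfl
  · have h1 : ((Ψ q).toMul : Qbar l) = 1 := congrArg Subtype.val h
    have h2 : Ψ q = z := by
      have h3 := DFunLike.congr_fun hΨ ((1 : ℤ) : ZMod p)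
      have h4 : f ((1 : ℤ) : ZMod p) = q := by
        rw [ZMod.lift_coe]
        exact one_zsmul q
      have h5 : g ((1 : ℤ) : ZMod p) = z := by
        rw [ZMod.lift_coe]
        exact one_zsmul z
      rw [AddMonoidHom.comp_apply, h4, h5] at h3
      exact h3
    rw [h2] at h1
    exact Additive.toMul.injective (Units.ext h1)

end Character

/-! ### Stable lattices in twisted Steinberg representations -/

section Lattice

variable {F E : Type*} [Field F] [Field E] [Algebra F E] [TopologicalSpace F] [TopologicalSpace E]
  [IsTopologicalRing F] [IsTopologicalRing E] [LocalNorm F] [LocalNorm E]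
  {γ : E ≃ₐ[F] E} {l : ℕ} [Fact l.Prime] {V : Type*} [AddCommGroup V] [Module (Qbar l) V]
  {ρ ρ₀ : Representation (Qbar l) (GL (Fin 3) E) V} {θ : Representation (Qbar l) (E ≃ₐ[F] E) V}

theorem exists_pow_smul_mem
    {L : Submodule (Zbar l) V} (hL : Submodule.span (Qbar l) (L : Set V) = ⊤) (v : V) :
    ∃ k : ℕ, l ^ k • v ∈ L := by
  have hv : v ∈ Submodule.span (Qbar l) (L : Set V) := hL ▸ Submodule.mem_top
  induction hv using Submodule.span_induction with
  | mem x hx => exact ⟨0, by simpa using hx⟩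
  | zero => exact ⟨0, by rw [smul_zero]; exact L.zero_mem⟩
  | add x y _ _ hx hy =>
    obtain ⟨k, hk⟩ := hx
    obtain ⟨k', hk'⟩ := hy
    refine ⟨k + k', ?_⟩
    rw [smul_add, pow_add, mul_comm, mul_smul, mul_comm, mul_smul]
    exact L.add_mem (nsmul_mem hk _) (nsmul_mem hk' _)
  | smul c x _ hx =>
    obtain ⟨k, hk⟩ := hx
    obtain ⟨n, hn⟩ := exists_pow_mul_mem l c
    refine ⟨n + k, ?_⟩
    have h1 : l ^ (n + k) • c • x = (⟨_, hn n le_rfl⟩ : Zbar l) • l ^ k • x := by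
      change _ = ((l : Qbar l) ^ n * c) • l ^ k • x
      simp only [← Nat.cast_smul_eq_nsmul (Qbar l), smul_smul, Nat.cast_pow]
      congr 1
      ring
    rw [h1]
    exact L.smul_mem _ hk

/-- The action of `GL₃(E)` on a stable submodule. -/
def latticeRep {L : Submodule (Zbar l) V}
    (hL : ∀ g, ∀ v ∈ L, ρ₀ g v ∈ L) :
    GL (Fin 3) E →* Module.End (Zbar l) L where
  toFun g := ((ρ₀ g).restrictScalars (Zbar l)).restrict (hL g)
  map_one' := LinearMap.ext fun v => Subtype.ext
    (LinearMap.congr_fun (map_one (ρ₀)) v.1)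
  map_mul' g h := LinearMap.ext fun v => Subtype.ext
    (LinearMap.congr_fun (map_mul (ρ₀) g h) v.1)

theorem latticeRep_coe {L : Submodule (Zbar l) V}
    (hL : ∀ g, ∀ v ∈ L, ρ₀ g v ∈ L) (g : GL (Fin 3) E) (v : L) :
    (latticeRep hL g v : V) = ρ₀ g v := rfl

theorem operator_coe {L : Submodule (Zbar l) V}
    (hL : IsStableLattice ρ (θ) L) (v : L) :
    (hL.operator γ v : V) = θ γ v := rfl

theorem nsmul_eq_zero {v : V} (h : l • v = 0) : v = 0 := by
  rw [← Nat.cast_smul_eq_nsmul (Qbar l)] at h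
  exact (smul_eq_zero.1 h).resolve_left (natCast_ne_zero l)

theorem operator_pow_coe {L : Submodule (Zbar l) V}
    (hL : IsStableLattice ρ (θ) L) (n : ℕ) (v : L) :
    ((hL.operator γ ^ n) v : V) = θ (γ ^ n) v := by
  induction n with
  | zero =>
    rw [pow_zero, pow_zero, map_one]
    rfl
  | succ n ih =>
    rw [pow_succ', pow_succ', Module.End.mul_apply, operator_coe, ih, map_mul,
      Module.End.mul_apply]

/-- The γ-fixed generators of V lie in L only after multiplication by powers of l, whence the power
of l in the span condition. -/
theorem isUnipGenerated_lattice (h : IsCyclicLocal γ l)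
    {L : Submodule (Zbar l) V}
    (hL : IsStableLattice ρ (θ) L)
    (hst : ∀ g, ∀ v ∈ L, ρ₀ g v ∈ L) (hsmooth : ∀ v, ∀ᶠ g in 𝓝 1, ρ₀ g v = v)
    (hgal : ∀ g, θ γ * ρ₀ g = ρ₀ (GeneralLinearGroup.map (γ : E →+* E) g) * θ γ)
    (hspan : ∀ v, v ∈ Submodule.span (Qbar l)
      {n | ∃ c w, θ γ w = w ∧ n = ρ₀ (lowerUnip c) w}) :
    IsUnipGenerated (R := Zbar l) (M := L) γ l (latticeRep hst) (hL.operator γ) where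
  smooth m := by
    filter_upwards [hsmooth m.1] with g hg
    exact Subtype.ext ((latticeRep_coe hst g m).trans hg)
  gal g := by
    refine LinearMap.ext fun v => Subtype.ext ?_
    rw [Module.End.mul_apply, Module.End.mul_apply, operator_coe, latticeRep_coe, latticeRep_coe,
      operator_coe, ← Module.End.mul_apply, hgal, Module.End.mul_apply]
  pow_eq_one := by
    refine LinearMap.ext fun v => Subtype.ext ?_
    rw [operator_pow_coe, h.pow_eq_one, map_one, Module.End.one_apply, Module.End.one_apply]
  torsionFree m hm := by
    refine Subtype.ext (nsmul_eq_zero (l := l) ?_)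
    exact congrArg Subtype.val hm
  span m := by
    suffices H : ∀ v : V, ∃ k : ℕ, l ^ k • v ∈ Submodule.map L.subtype
        (Submodule.span (Zbar l) {n | ∃ c w, hL.operator γ w = w ∧
          n = latticeRep hst (lowerUnip c) w}) by
      obtain ⟨k, y, hy, hyv⟩ := H m.1
      refine ⟨k, ?_⟩
      have h1 : y = l ^ k • m := Subtype.ext hyv
      rwa [← h1]
    intro v
    have hv := hspan v
    induction hv using Submodule.span_induction with
    | mem x hx =>
      obtain ⟨c, w, hw, rfl⟩ := hx
      obtain ⟨k, hk⟩ := exists_pow_smul_mem hL.span_eq_top w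
      refine ⟨k, latticeRep hst (lowerUnip c) ⟨_, hk⟩, Submodule.subset_span ⟨c, ⟨_, hk⟩, ?_, rfl⟩,
        ?_⟩
      · refine Subtype.ext ?_
        rw [operator_coe, map_nsmul, hw]
      · rw [Submodule.subtype_apply, latticeRep_coe, map_nsmul]
    | zero => exact ⟨0, by rw [smul_zero]; exact Submodule.zero_mem _⟩
    | add x y _ _ hx hy =>
      obtain ⟨k, hk⟩ := hx
      obtain ⟨k', hk'⟩ := hy
      refine ⟨k + k', ?_⟩
      rw [smul_add, pow_add, mul_comm, mul_smul, mul_comm, mul_smul]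
      exact Submodule.add_mem _ (nsmul_mem hk _) (nsmul_mem hk' _)
    | smul c x _ hx =>
      obtain ⟨k, hk⟩ := hx
      obtain ⟨n, hn⟩ := exists_pow_mul_mem l c
      refine ⟨n + k, ?_⟩
      have h1 : l ^ (n + k) • c • x = (⟨_, hn n le_rfl⟩ : Zbar l) • l ^ k • x := by
        change _ = ((l : Qbar l) ^ n * c) • l ^ k • x
        simp only [← Nat.cast_smul_eq_nsmul (Qbar l), smul_smul, Nat.cast_pow]
        congr 1
        ring
      rw [h1]
      exact Submodule.smul_mem _ _ hk

/-- A submodule that is stable under a scalar of norm greater than one is divisible by `l`. -/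
theorem inv_smul_mem_of_one_lt_norm {L : Submodule (Zbar l) V} {α : Qbar l} (hα : 1 < ‖α‖)
    (hL : ∀ v ∈ L, α • v ∈ L) {v : V} (hv : v ∈ L) : (l : Qbar l)⁻¹ • v ∈ L := by
  have hpow : ∀ n : ℕ, α ^ n • v ∈ L := by
    intro n
    induction n with
    | zero => rwa [pow_zero, one_smul]
    | succ n ih => rw [pow_succ', mul_smul]; exact hL _ ih
  obtain ⟨n, hn⟩ := pow_unbounded_of_one_lt ‖(l : Qbar l)⁻¹‖ hα
  have hα0 : α ^ n ≠ 0 := by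
    refine pow_ne_zero _ fun h => ?_
    rw [h, norm_zero] at hα
    exact hα.not_gt one_pos
  have hβ : IsIntegral ℤ_[l] ((l : Qbar l)⁻¹ / α ^ n) := by
    rw [isIntegral_iff_norm_le_one, norm_div, norm_pow]
    exact div_le_one_of_le₀ hn.le (by positivity)
  have h1 := L.smul_mem (⟨_, hβ⟩ : Zbar l) (hpow n)
  have h2 : (⟨_, hβ⟩ : Zbar l) • α ^ n • v = (l : Qbar l)⁻¹ • v := by
    change ((l : Qbar l)⁻¹ / α ^ n) • α ^ n • v = _
    rw [smul_smul, div_mul_cancel₀ _ hα0]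
  rwa [h2] at h1

theorem det_scalar (c : Eˣ) :
    GeneralLinearGroup.det (GeneralLinearGroup.scalar (Fin 3) c) = c ^ 3 := by
  refine Units.ext ?_
  rw [GeneralLinearGroup.val_det_apply]
  simp [GeneralLinearGroup.scalar]

/-- `Ĥ¹` vanishes for stable lattices in twists of a unipotently generated representation. -/
theorem subsingleton_tateH1_of_span (h : IsCyclicLocal γ l) {ψ : AddChar F (Zbar l)}
    {δ : ℝ} (hδ : 0 < δ) (hψ : ∀ d, LocalNorm.v d ≤ δ → ψ d = 1) {x₀ : F} (hx₀ : ψ x₀ ≠ 1)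
    (hsmooth : ∀ v, ∀ᶠ g in 𝓝 1, ρ₀ g v = v)
    (hgal : ∀ g, θ γ * ρ₀ g = ρ₀ (GeneralLinearGroup.map (γ : E →+* E) g) * θ γ)
    (hspan : ∀ v, v ∈ Submodule.span (Qbar l) {n | ∃ c w, θ γ w = w ∧ n = ρ₀ (lowerUnip c) w})
    (hscalar : ∀ c v, ρ₀ (GeneralLinearGroup.scalar (Fin 3) c) v = v) {χ : Eˣ →* (Qbar l)ˣ}
    (hρ : ∀ g v, ρ g v = (χ (GeneralLinearGroup.det g) : Qbar l) • ρ₀ g v)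
    {L : Submodule (Zbar l) V} (hL : IsStableLattice ρ θ L) :
    Subsingleton (TateH1 (hL.operator γ) l) := by
  refine Submodule.Quotient.subsingleton_iff.2 (eq_top_iff.2 fun v _ => ?_)
  obtain ⟨m, hm⟩ := v
  rw [Submodule.mem_comap, Submodule.subtype_apply]
  rw [LinearMap.mem_ker] at hm
  change m ∈ _
  by_cases hχ : ∃ c : Eˣ, 1 < ‖(χ c : Qbar l)‖
  -- The scalar matrix c acts by χ(c)³, since it is trivial on the untwisted module. Its norm
  -- exceeds 1, so L is divisible by l, and l • m = (1 - γ) w can be divided by l inside L.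
  · obtain ⟨c, hc⟩ := hχ
    have hα : 1 < ‖(χ c : Qbar l) ^ 3‖ := by
      rw [norm_pow]
      exact one_lt_pow₀ hc (by norm_num)
    have hst : ∀ v ∈ L, ((χ c : Qbar l) ^ 3) • v ∈ L := fun v hv => by
      have h1 := hL.stable_left (GeneralLinearGroup.scalar (Fin 3) c) v hv
      rwa [hρ, det_scalar, hscalar, map_pow, Units.val_pow_eq_pow_val] at h1
    have h1 := IsCyclicLocal.sub_tateNorm_mem_range (hL.operator γ) l m
    rw [hm, sub_zero] at h1
    obtain ⟨w, hw⟩ := h1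
    refine ⟨⟨_, inv_smul_mem_of_one_lt_norm hα hst w.2⟩, Subtype.ext ?_⟩
    have h2 : (w : V) - θ γ w =
        l • (m : V) := congrArg Subtype.val hw
    change (l : Qbar l)⁻¹ • (w : V) -
      θ γ ((l : Qbar l)⁻¹ • (w : V)) = m
    rw [map_smul, ← smul_sub, h2, ← Nat.cast_smul_eq_nsmul (Qbar l), smul_smul,
      inv_mul_cancel₀ (natCast_ne_zero l), one_smul]
  -- Applied to inverses, the bound makes every value of χ a unit of Zbar, so L is stable under the
  -- untwisted action.
  · push Not at hχ
    have hst : ∀ g, ∀ v ∈ L, ρ₀ g v ∈ L := by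
      intro g v hv
      have h1 := L.smul_mem (⟨_, (isIntegral_iff_norm_le_one l _).2
        (hχ (GeneralLinearGroup.det g)⁻¹)⟩ : Zbar l) (hL.stable_left g v hv)
      have h2 : (⟨_, (isIntegral_iff_norm_le_one l _).2
          (hχ (GeneralLinearGroup.det g)⁻¹)⟩ : Zbar l) • ρ g v =
          ρ₀ g v := by
        rw [hρ]
        change (χ (GeneralLinearGroup.det g)⁻¹ : Qbar l) •
          (χ (GeneralLinearGroup.det g) : Qbar l) • ρ₀ g v = _
        rw [smul_smul, ← Units.val_mul, ← map_mul, inv_mul_cancel, map_one, Units.val_one,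
          one_smul]
      rwa [h2] at h1
    exact (isUnipGenerated_lattice h hL hst hsmooth hgal hspan).mem_range h
      (fun n => isUnit_natCast l) hδ hψ hx₀ hm

/-- `Ĥ¹` vanishes for stable lattices in twisted Steinberg representations. -/
theorem subsingleton_tateH1 [IsModuleTopology F E] (h : IsCyclicLocal γ l)
    {ψ : AddChar F (Zbar l)} {δ : ℝ} (hδ : 0 < δ) (hψ : ∀ d, LocalNorm.v d ≤ δ → ψ d = 1) {x₀ : F}
    (hx₀ : ψ x₀ ≠ 1) {χ : Eˣ →* (Qbar l)ˣ} {L : Submodule (Zbar l) (Steinberg E (Qbar l))}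
    (hL : IsStableLattice (twistedSteinbergRep E (Qbar l) χ) (steinbergGal F E (Qbar l)) L) :
    Subsingleton (TateH1 (hL.operator γ) l) :=
  subsingleton_tateH1_of_span h hδ hψ hx₀ (ρ₀ := steinbergRep E (Qbar l))
    eventually_steinbergRep_eq (steinbergGal_mul_steinbergRep F E (Qbar l) γ)
    (mem_span_lowerUnip h.v_gal) steinbergRep_scalar (fun _ _ => rfl) hL

end Lattice

/-! ### Cyclic extensions of `p`-adic fields -/

section Padic

/-- A basis identifies E topologically with a finite power of F, which carries the module topology
over A. -/
theorem isModuleTopology_trans (A F E : Type*) [CommRing A] [TopologicalSpace A]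
    [IsTopologicalRing A] [Field F] [Algebra A F] [TopologicalSpace F] [IsTopologicalRing F]
    [IsModuleTopology A F] [AddCommGroup E] [Module F E] [FiniteDimensional F E] [Module A E]
    [IsScalarTower A F E] [TopologicalSpace E] [IsModuleTopology F E] : IsModuleTopology A E := by
  let e := (Module.finBasis F E).equivFun
  have h1 : Continuous e := IsModuleTopology.continuous_of_linearMap e.toLinearMap
  have h2 : Continuous e.symm := by
    have := IsModuleTopology.toContinuousAdd F E
    exact IsModuleTopology.continuous_of_linearMap e.symm.toLinearMap
  let e' : (Fin (Module.finrank F E) → F) ≃L[A] E :=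
    { toLinearEquiv := (e.restrictScalars A).symm
      continuous_toFun := h2
      continuous_invFun := h1 }
  exact IsModuleTopology.iso e'

/-- The spectral norm is compatible with towers and automorphisms, and l has p-adic norm 1 because l
≠ p. -/
theorem isCyclicLocal_ofPadic (p l : ℕ) [Fact p.Prime] [Fact l.Prime] (hpl : l ≠ p)
    {F E : Type*} [Field F] [Algebra ℚ_[p] F] [FiniteDimensional ℚ_[p] F] [TopologicalSpace F]
    [IsModuleTopology ℚ_[p] F] [Field E] [Algebra F E] [IsGalois F E] [FiniteDimensional F E]
    (hdeg : Module.finrank F E = l) [Algebra ℚ_[p] E] [IsScalarTower ℚ_[p] F E]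
    [FiniteDimensional ℚ_[p] E] [TopologicalSpace E] [IsModuleTopology ℚ_[p] E]
    (γ : E ≃ₐ[F] E) (hγ : ∀ σ : E ≃ₐ[F] E, σ ∈ Subgroup.zpowers γ) :
    letI := LocalNorm.ofPadic p F
    letI := LocalNorm.ofPadic p E
    IsCyclicLocal γ l := by
  let _ := LocalNorm.ofPadic p F
  let _ := LocalNorm.ofPadic p E
  refine ⟨Fact.out, ?_, fun x => ?_, fun x => ?_, ?_, fun x hx => ?_⟩
  · rw [← hdeg, ← IsGalois.card_aut_eq_finrank]
    exact pow_card_eq_one'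
  · exact (spectralNorm.eq_of_tower (K := ℚ_[p]) (L := E) x).symm
  · exact (spectralNorm_eq_of_equiv (γ.restrictScalars ℚ_[p]) x).symm
  · change spectralNorm ℚ_[p] E (l : E) = 1
    rw [← map_natCast (algebraMap ℚ_[p] E), spectralNorm_extends,
      Padic.norm_natCast_eq_one_iff]
    exact (Nat.coprime_primes Fact.out Fact.out).2 hpl.symm
  · have h1 : x ∈ IntermediateField.fixedField (⊤ : Subgroup (E ≃ₐ[F] E)) := by
      rintro ⟨σ, -⟩
      have h2 : Subgroup.zpowers γ ≤ MulAction.stabilizer (E ≃ₐ[F] E) x :=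
        Subgroup.zpowers_le.2 hx
      exact h2 (hγ σ)
    rw [IsGalois.fixedField_top] at h1
    exact IntermediateField.mem_bot.1 h1

end Padic

end SteinbergTate

end

open SteinbergTate in
theorem mainTheorem2 (p l : ℕ) [Fact p.Prime] [Fact l.Prime] (hpl : l ≠ p) (hl : l ≠ 2)
    (F E : Type*) [Field F] [Algebra ℚ_[p] F] [FiniteDimensional ℚ_[p] F]
    [TopologicalSpace F] [IsTopologicalRing F] [IsModuleTopology ℚ_[p] F]
    [Field E] [Algebra F E] [IsGalois F E] (hdeg : Module.finrank F E = l)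
    [TopologicalSpace E] [IsTopologicalRing E] [IsModuleTopology F E]
    (γ : E ≃ₐ[F] E) (hγ : ∀ σ : E ≃ₐ[F] E, σ ∈ Subgroup.zpowers γ) :
    -- the Borel–Serre module is a stable lattice in the Steinberg representation of `GL₃(E)`
    (Function.Injective (steinbergCoeff E (Zbar l) (Qbar l)) ∧
      (∀ g v, steinbergCoeff E (Zbar l) (Qbar l) (steinbergRep E (Zbar l) g v) =
        steinbergRep E (Qbar l) g (steinbergCoeff E (Zbar l) (Qbar l) v)) ∧
      (∀ σ v, steinbergCoeff E (Zbar l) (Qbar l) (steinbergGal F E (Zbar l) σ v) =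
        steinbergGal F E (Qbar l) σ (steinbergCoeff E (Zbar l) (Qbar l) v)) ∧
      IsStableLattice (steinbergRep E (Qbar l)) (steinbergGal F E (Qbar l))
        (LinearMap.range (steinbergCoeff E (Zbar l) (Qbar l)))) ∧
    -- its `Ĥ⁰`, a module over `Zbar l / l`, is the Steinberg module of `GL₃(F)` over `Zbar l / l`
    (∃ e : TateH0 (steinbergGal F E (Zbar l) γ) l ≃+ Steinberg F (ZbarMod l),
      (∀ (c : Zbar l) v, e (c • v) = algebraMap (Zbar l) (ZbarMod l) c • e v) ∧
      ∀ g v, e (steinbergTateH0Rep F E (Zbar l) γ l g v) =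
        steinbergRep F (ZbarMod l) g (e v)) ∧
    -- and, as an `Fbar l`-representation, it is the twist of the mod-`l` Steinberg representation
    Nonempty ((baseChangeRep (Fbar l) (steinbergTateH0Rep F E (Zbar l) γ l)).Equiv
      (frobTwistRep (Fbar l) l (steinbergRep F (Fbar l)))) ∧
    -- `Ĥ¹` vanishes for every stable lattice in a twisted Steinberg representation
    (∀ χ : Fˣ →* (Qbar l)ˣ, IsLocallyConstant χ →
      ∀ (L : Submodule (Zbar l) (Steinberg E (Qbar l)))
        (hL : IsStableLattice (twistedSteinbergRep E (Qbar l) (normChar E χ))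
          (steinbergGal F E (Qbar l)) L),
        Subsingleton (TateH1 (hL.operator γ) l)) := by
  have hfin : FiniteDimensional F E :=
    Module.finite_of_finrank_pos (by rw [hdeg]; exact (Fact.out : l.Prime).pos)
  let _ : Algebra ℚ_[p] E := ((algebraMap F E).comp (algebraMap ℚ_[p] F)).toAlgebra
  have : IsScalarTower ℚ_[p] F E := IsScalarTower.of_algebraMap_eq fun _ => rfl
  have : FiniteDimensional ℚ_[p] E := FiniteDimensional.trans ℚ_[p] F E
  have : IsModuleTopology ℚ_[p] E := isModuleTopology_trans ℚ_[p] F E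
  have h := isCyclicLocal_ofPadic p l hpl hdeg γ hγ
  let _ := LocalNorm.ofPadic p F
  let _ := LocalNorm.ofPadic p E
  have hl0 : ((l : ℕ) : ZbarMod l) = 0 := by
    rw [← map_natCast (Ideal.Quotient.mk (Ideal.span {(l : Zbar l)})),
      Ideal.Quotient.eq_zero_iff_mem]
    exact Ideal.mem_span_singleton_self _
  have hker : ∀ r, Ideal.Quotient.mk (Ideal.span {(l : Zbar l)}) r = 0 →
      ∃ c, (l : Zbar l) * c = r := fun r hr => by
    rw [Ideal.Quotient.eq_zero_iff_mem, Ideal.mem_span_singleton] at hr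
    obtain ⟨c, hc⟩ := hr
    exact ⟨c, hc.symm⟩
  have hbij := tateZeroMap_bijective (F := F) (γ := γ) _ h hl0 Ideal.Quotient.mk_surjective hker
  let e : TateH0 (steinbergGal F E (Zbar l) γ) l ≃+ Steinberg F (ZbarMod l) :=
    AddEquiv.ofBijective
      (tateZeroMap (γ := γ) (Ideal.Quotient.mk (Ideal.span {(l : Zbar l)})) hl0) hbij
  have he : ∀ (c : Zbar l) v, e (c • v) = algebraMap (Zbar l) (ZbarMod l) c • e v := fun c v =>
    LinearMap.map_smulₛₗ
      (tateZeroMap (γ := γ) (Ideal.Quotient.mk (Ideal.span {(l : Zbar l)})) hl0) c v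
  have heg : ∀ g v, e (steinbergTateH0Rep F E (Zbar l) γ l g v) =
      steinbergRep F (ZbarMod l) g (e v) := fun g v => tateZeroMap_rep _ hl0 g v
  refine ⟨⟨steinbergCoeff_injective E Subtype.val_injective, steinbergCoeff_rep E,
    steinbergCoeff_gal E, isStableLattice_range E l⟩, ⟨e, he, heg⟩,
    nonempty_equiv_frobTwist l _ e he heg, fun χ _ L hL => ?_⟩
  have hvp : LocalNorm.v ((p : ℕ) : F) < 1 := by
    change spectralNorm ℚ_[p] F ((p : ℕ) : F) < 1
    rw [← map_natCast (algebraMap ℚ_[p] F), spectralNorm_extends]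
    exact Padic.norm_p_lt_one
  have hp0 : ((p : ℕ) : F) ≠ 0 := by
    rw [← map_natCast (algebraMap ℚ_[p] F), map_ne_zero]
    exact_mod_cast (Fact.out : p.Prime).ne_zero
  obtain ⟨ψ, hψ, x₀, hx₀⟩ := exists_addChar l (Fact.out : p.Prime) hp0 hvp
  exact subsingleton_tateH1 h one_pos hψ hx₀ hL
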